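/- **Setup.** Let $f$ be either $f(x)=\theta(x,\tau)=-\sum_{j\in\mathbb Z}e^{\pi \mathrm i(j+\frac12)^2\tau+2\pi \mathrm i(j+\frac12)(x+\frac12)}$ with $\Im\tau>0$, or $f(x)=\sin(\pi x)$. Let $\eta,\lambda\in\mathbb C$ and let $(z_i)_{i\ge0}$, $(\Lambda_i)_{i\ge 0}$ be complex sequences. In the space $V_\Lambda(z)$ with basis $e_0,e_1,\dots$ put $$a(\lambda,w)e_k=\tfrac{f(z-w+(\Lambda+1-2k)\eta)}{f(z-w+(\Lambda+1)\eta)}\tfrac{f(\lambda+2k\eta)}{f(\lambda)}e_k,\qquad b(\lambda,w)e_k=-\tfrac{f(-\lambda+z-w+(\Lambda-1-2k)\eta)}{f(z-w+(\Lambda+1)\eta)}\tfrac{f(2\eta)}{f(\lambda)}e_{k+1},$$ $$c(\lambda,w)e_k=-\tfrac{f(-\lambda-z+w+(\Lambda+1-2k)\eta)}{f(z-w+(\Lambda+1)\eta)}\tfrac{f(2(\Lambda+1-k)\eta)}{f(\lambda)}\tfrac{f(2k\eta)}{f(2\eta)}e_{k-1}\ \ (c\,e_0=0),\qquad d(\lambda,w)e_k=\tfrac{f(z-w+(-\Lambda+1+2k)\eta)}{f(z-w+(\Lambda+1)\eta)}\tfrac{f(\lambda-2(\Lambda-k)\eta)}{f(\lambda)}e_k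 .$$ The weight of $e_k$ is $\Lambda-2k$, and weights add in tensor products. On a tensor product $V^{(1)}\otimes V^{(2)}$ the operators are the entries of $$\begin{bmatrix}a&b\\c&d\end{bmatrix}(\lambda,w)=\begin{bmatrix}a_2&b_2\\c_2&d_2\end{bmatrix}(\lambda-2\eta h^{(1)},w)\begin{bmatrix}a_1&b_1\\c_1&d_1\end{bmatrix}(\lambda,w),$$ where $h^{(1)}$ is the weight of the first component after the action of the right-most factor. A signature $\mu=(\mu_1\ge\dots\ge\mu_M\ge0)=0^{m_0}1^{m_1}2^{m_2}\cdots$ has length $\ell(\mu)=M$; put $E_\mu=e_{m_0}\otimes e_{m_1}\otimes\cdots\in V_{\Lambda_0}(z_0)\otimes V_{\Lambda_1}(z_1)\otimes\cdots$. Let $\Lambda_{[0,k)}=\Lambda_0+\dots+\Lambda_{k-1}$, $\Lambda_{[0,k]}=\Lambda_0+\dots+\Lambda_k$, $m_{<k}=\sum_{i<k}m_i$. *Definition of $B$.* $B_{\nu/\mu}(\lambda;w)$ is the coefficient of $E_\nu$ in $b(\lambda,w)E_\mu$, computed in a finite product $V_{\Lambda_0}(z_0)\otimes\cdots\otimes V_{\Lambda_K}(z_K)$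 with $K\ge\max(\mu_1,\nu_1)$ (it does not depend on $K$). $B_{\nu/\mu}(\lambda;w_1,\dots,w_n)$ is the coefficient of $E_\nu$ in $b(\lambda,w_1)b(\lambda+2\eta,w_2)\cdots b(\lambda+2\eta(n-1),w_n)E_\mu$, that is, $B_{\nu/\mu}(\lambda;w_1,\dots,w_n)=\sum_\kappa B_{\nu/\kappa}(\lambda;w_1)B_{\kappa/\mu}(\lambda+2\eta;w_2,\dots,w_n)$. Put $B_\mu=B_{\mu/\varnothing}$. *Definition of $D$.* $D_{\nu/\mu}(\lambda;w)$ is the limit as $m\to\infty$ of $$\prod_{i=0}^m\frac{f(z_i-w+(\Lambda_i+1)\eta)}{f(z_i-w+(-\Lambda_i+1)\eta)}\cdot\frac{1}{f(\lambda-2\eta(\Lambda_{[0,m]}-2\ell(\nu)))}$$ times the coefficient of $E_\mu$ in $d(\lambda,w)E_\nu$ in $V_{\Lambda_0}(z_0)\otimes\cdots\otimes V_{\Lambda_m}(z_m)$, and $D_{\nu/\mu}(\lambda;w_1,\dots,w_n)=\sum_\kappa D_{\kappa/\mu}(\lambda;w_1)D_{\nu/\kappa}(\lambda+2\eta;w_2,\dots,w_n)$.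 Put $D_\nu=D_{\nu/0^N}$ with $N=\ell(\nu)$. (With no variables, $B_{\nu/\mu}$ and $D_{\nu/\mu}$ are $\mathbf 1_{\mu=\nu}$; the sums over $\kappa$ have finitely many nonzero terms.) Let $p_j=z_j+(1-\Lambda_j)\eta$, $q_j=z_j+(1+\Lambda_j)\eta$, $$\phi_k(u)=\frac1{f(u-q_k)}\prod_{i=0}^{k-1}\frac{f(u-p_i)}{f(u-q_i)},\qquad \psi_l(v)=\frac1{f(v-p_l)}\prod_{j=0}^{l-1}\frac{f(v-q_j)}{f(v-p_j)} .$$ **Theorem.** (i) Let $\mu=(\mu_1\ge\dots\ge\mu_M\ge0)=0^{m_0}1^{m_1}2^{m_2}\cdots$ and $u_1,\dots,u_M\in\mathbb C$. Assume that the following are nonzero: $f(2\eta j)$ for $1\le j\le \max_i m_i$; $f(\lambda+2\eta k)$ for $0\le k<M$; $f(\lambda-2\eta\Lambda_{[0,l)}+2\eta k)$ for $1\le l\le\mu_1$, $0\le k\le 2M-2$; $f(u_i-q_l)$ for $0\le l\le\mu_1$; $f(u_i-u_j)$ for $i\ne j$. Then $$B_\mu(\lambda;u_1,\dots,u_M)=\frac{(-1)^Mf(2\eta)^M}{\prod_{i=0}^{M-1}f(\lambda+2\eta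 i)}\prod_{i\ge0}\prod_{j=1}^{m_i}\frac{f(2\eta)}{f(2\eta j)}$$ $$\times\sum_{\sigma\in S_M}\sigma\Bigl(\prod_{1\le i<j\le M}\frac{f(u_i-u_j-2\eta)}{f(u_i-u_j)}\prod_{i=1}^M\phi_{\mu_i}(u_i)f(\lambda+u_i-q_{\mu_i}+2\eta+4\eta(M-i)-2\eta\Lambda_{[0,\mu_i)})\Bigr),$$ where $\sigma$ permutes the variables $u_1,\dots,u_M$. (ii) Let $\nu=(\nu_1\ge\dots\ge\nu_N\ge0)=0^{n_0}1^{n_1}2^{n_2}\cdots$, $n\ge1$, $v_1,\dots,v_n\in\mathbb C$ and $\widetilde\lambda=\lambda+2\eta n$. Assume that the following are nonzero: $f(2\eta)$; $f(\lambda+2\eta k)$ for $0\le k<n$; $f(\lambda-2\eta\Lambda_{[0,l)}+2\eta k)$ for $l\ge1$, $0\le k<n+2N$; $f(v_i-p_l)$ and $f(v_i-q_l)$ for all $i$ and $l\ge0$; $f(v_i-v_j)$ for $i\ne j$. Then the limits defining $D_{\kappa/\rho}(\lambda+2\eta(k-1);v_k)$ exist for all $1\le k\le n$ and all signatures $\kappa,\rho$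 with $\ell(\kappa)=N$, and $$D_\nu(\lambda;v_1,\dots,v_n)=\frac{f(2\eta)^{N-n_0}}{\prod_{i=0}^{n-1}f(\lambda+2\eta i)}\prod_{i=N}^{n+n_0-1}\frac{f(\lambda+2\eta(i-\Lambda_0))}{f(\lambda+2\eta(i+n_0-\Lambda_0))}$$ $$\times\prod_{i\ge1}\prod_{j=0}^{n_i-1}\frac{f(2\eta(\Lambda_i-j))}{f(\widetilde\lambda+2\eta(2n_{<i}+n_i+j-\Lambda_{[0,i]}))\,f(\widetilde\lambda+2\eta(2n_{<i}+1+j-\Lambda_{[0,i)}))}$$ $$\times\sum_{\substack{I\subset\{1,\dots,n\}\\|I|=N-n_0}}\ \prod_{i\in I}\frac{f(\lambda+v_i-q_0+2\eta N)}{f(v_i-q_0)}\prod_{j\notin I}\frac{f(v_j-p_0-2\eta n_0)}{f(v_j-p_0)}\prod_{i\in I,\,j\notin I}\frac{f(v_j-v_i-2\eta)}{f(v_j-v_i)}$$ $$\times\sum_{\sigma:\{1,\dots,N-n_0\}\to I\text{ bijective}}\sigma\Bigl(\prod_{i<j}\frac{f(v_i-v_j+2\eta)}{f(v_i-v_j)}\prod_{i=1}^{N-n_0}\psi_{\nu_i}(v_i)f(\widetilde\lambda-v_i+p_{\nu_i}+2\eta+4\eta(N-i)-2\eta\Lambda_{[0,\nu_i)})\Bigr),$$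 where $\sigma$ replaces the variables $v_1,\dots,v_{N-n_0}$ by $v_{\sigma(1)},\dots,v_{\sigma(N-n_0)}$. If $N-n_0>n$, the sum over $I$ is empty and both sides are $0$; in this case the product $\prod_{i=N}^{n+n_0-1}$ is read as $1$. -/

import Mathlib

open Filter Topology

noncomputable section

namespace EllipticBethe

/-- The odd theta function
`θ(x, τ) = - ∑_{j ∈ ℤ} exp (π i (j + 1/2)² τ + 2 π i (j + 1/2) (x + 1/2))`. -/
def theta (τ x : ℂ) : ℂ :=
  -∑' j : ℤ, Complex.exp (Real.pi * Complex.I * ((j : ℂ) + 1 / 2) ^ 2 * τ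
      + 2 * Real.pi * Complex.I * ((j : ℂ) + 1 / 2) * (x + 1 / 2))

/-- The function `sin (π x)`, which replaces the theta function in the trigonometric case. -/
def sinPi (x : ℂ) : ℂ := Complex.sin (Real.pi * x)

/-! ### Evaluation Verma modules -/

/-- The vector space `Span {e_0, e_1, …}` underlying an evaluation Verma module;
`e_k` is `Finsupp.single k 1`. -/
abbrev Verma := ℕ →₀ ℂ

section Operators

variable (f : ℂ → ℂ) (η : ℂ)

/-- The operator `a(lam, w)` in `V_L(x)`. -/
def evalA (L x lam w : ℂ) : Verma →ₗ[ℂ] Verma :=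
  Finsupp.linearCombination ℂ fun k : ℕ => Finsupp.single k
    (f (x - w + (L + 1 - 2 * k) * η) / f (x - w + (L + 1) * η)
      * (f (lam + 2 * k * η) / f lam))

/-- The operator `b(lam, w)` in `V_L(x)`. -/
def evalB (L x lam w : ℂ) : Verma →ₗ[ℂ] Verma :=
  Finsupp.linearCombination ℂ fun k : ℕ => Finsupp.single (k + 1)
    (-(f (-lam + x - w + (L - 1 - 2 * k) * η) / f (x - w + (L + 1) * η))
      * (f (2 * η) / f lam))

/-- The operator `c(lam, w)` in `V_L(x)`; it kills `e_0`. -/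
def evalC (L x lam w : ℂ) : Verma →ₗ[ℂ] Verma :=
  Finsupp.linearCombination ℂ fun k : ℕ => if k = 0 then 0 else Finsupp.single (k - 1)
    (-(f (-lam - x + w + (L + 1 - 2 * k) * η) / f (x - w + (L + 1) * η))
      * (f (2 * (L + 1 - k) * η) / f lam) * (f (2 * k * η) / f (2 * η)))

/-- The operator `d(lam, w)` in `V_L(x)`. -/
def evalD (L x lam w : ℂ) : Verma →ₗ[ℂ] Verma :=
  Finsupp.linearCombination ℂ fun k : ℕ => Finsupp.single k
    (f (x - w + (-L + 1 + 2 * k) * η) / f (x - w + (L + 1) * η)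
      * (f (lam - 2 * (L - k) * η) / f lam))

/-- The matrix of operators `[a, b; c, d]` in `V_L(x)`. -/
def evalMat (L x lam w : ℂ) : Matrix (Fin 2) (Fin 2) (Module.End ℂ Verma) :=
  !![evalA f η L x lam w, evalB f η L x lam w; evalC f η L x lam w, evalD f η L x lam w]

/-! ### Tensor products -/

/-- Occupation numbers `(m_0, m_1, m_2, …)`, almost all zero. They encode the signature
`0^{m_0} 1^{m_1} 2^{m_2} ⋯`. -/
abbrev Occ := ℕ →₀ ℕ

/-- Finite linear combinations of the vectors `E_m = e_{m_0} ⊗ e_{m_1} ⊗ e_{m_2} ⊗ ⋯`,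
where `E_m` is `Finsupp.single m 1`. The tensor product `V_0 ⊗ ⋯ ⊗ V_{n-1}` is the span of the
`E_m` with `m_i = 0` for `i ≥ n`; operators in it are the operators below that act on the factors
with indices `< n` only. -/
abbrev Fock := Occ →₀ ℂ

/-- The basis vector `E_m`. -/
def basisVec (m : Occ) : Fock := Finsupp.single m 1

variable (z Λ : ℕ → ℂ)

/-- The weight `∑_{i < n} (Λ_i - 2 m_i)` of the component of `E_m` in `V_0 ⊗ ⋯ ⊗ V_{n-1}`. -/
def prefixWeight (n : ℕ) (m : Occ) : ℂ := ∑ i ∈ Finset.range n, (Λ i - 2 * (m i : ℂ))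

/-- The matrix of operators `[a, b; c, d] (lam - 2 η h, w)` that act in the factor `V_n`, with
`h` the weight of the component of the vector in `V_0 ⊗ ⋯ ⊗ V_{n-1}`. -/
def siteMat (n : ℕ) (lam w : ℂ) : Matrix (Fin 2) (Fin 2) (Module.End ℂ Fock) :=
  Matrix.of fun i j => Finsupp.linearCombination ℂ fun m : Occ =>
    Finsupp.mapDomain (fun k : ℕ => m.update n k)
      (evalMat f η (Λ n) (z n) (lam - 2 * η * prefixWeight Λ n m) w i j (Finsupp.single (m n) 1))

/-- The matrix of operators `[a, b; c, d] (lam, w)` in `V_0 ⊗ ⋯ ⊗ V_{n-1}`, built by tensoring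
with one factor at a time. The weight that shifts `lam` in the new factor is read off after the
action of the operators in the previous factors. -/
def monodromy : ℕ → ℂ → ℂ → Matrix (Fin 2) (Fin 2) (Module.End ℂ Fock)
  | 0, _, _ => 1
  | n + 1, lam, w => siteMat f η z Λ n lam w * monodromy n lam w

/-- The operator `b(lam, w)` in `V_0 ⊗ ⋯ ⊗ V_{n-1}`. -/
def opB (n : ℕ) (lam w : ℂ) : Module.End ℂ Fock := monodromy f η z Λ n lam w 0 1

/-- The operator `d(lam, w)` in `V_0 ⊗ ⋯ ⊗ V_{n-1}`. -/
def opD (n : ℕ) (lam w : ℂ) : Module.End ℂ Fock := monodromy f η z Λ n lam w 1 1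

/-! ### The coefficients `B` and `D` -/

/-- The coefficient `B_{ν/μ}(lam; w)` of `E_ν` in `b(lam, w) E_μ`, evaluated in the tensor product
`V_0 ⊗ ⋯ ⊗ V_K` with `K` the largest part of `ν` and `μ`; by `opB_succ_apply` below,
further factors do not change it. -/
def BOne (lam w : ℂ) (ν μ : Occ) : ℂ :=
  opB f η z Λ ((ν.support ∪ μ.support).sup id + 1) lam w (basisVec μ) ν

/-- The coefficient `B_{ν/μ}(lam; w_1, …, w_n)` of `E_ν` in
`b(lam, w_1) b(lam + 2 η, w_2) ⋯ b(lam + 2 η (n - 1), w_n) E_μ`. Only finitely many `κ` contribute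
to the sum. -/
def BSkew : (n : ℕ) → ℂ → (Fin n → ℂ) → Occ → Occ → ℂ
  | 0, _, _, ν, μ => if ν = μ then 1 else 0
  | n + 1, lam, w, ν, μ =>
      ∑ᶠ κ : Occ, BOne f η z Λ lam (w 0) ν κ * BSkew n (lam + 2 * η) (Fin.tail w) κ μ

/-- The length `ℓ(ν)`, that is the number of parts, of a signature. -/
def len (ν : Occ) : ℕ := ν.sum fun _ k => k

/-- The sum `Λ_0 + ⋯ + Λ_{k-1}`, written `Λ_{[0,k)}`. -/
def LamSum (k : ℕ) : ℂ := ∑ i ∈ Finset.range k, Λ i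

/-- The normalized coefficient of `E_μ` in `d(lam, w) E_ν` in the volume `V_0 ⊗ ⋯ ⊗ V_m`. -/
def DVol (lam w : ℂ) (ν μ : Occ) (m : ℕ) : ℂ :=
  (∏ i ∈ Finset.range (m + 1),
      f (z i - w + (Λ i + 1) * η) / f (z i - w + (-Λ i + 1) * η))
    * (1 / f (lam - 2 * η * (LamSum Λ (m + 1) - 2 * (len ν : ℂ))))
    * opD f η z Λ (m + 1) lam w (basisVec ν) μ

/-- The coefficient `D_{ν/μ}(lam; w)`: the infinite volume limit of `DVol`. -/
def DOne (lam w : ℂ) (ν μ : Occ) : ℂ := limUnder atTop (DVol f η z Λ lam w ν μ)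

/-- The coefficient `D_{ν/μ}(lam; w_1, …, w_n)`, defined by the branching rule
`D_{ν/μ}(lam; w_1, …, w_n) = ∑_κ D_{κ/μ}(lam; w_1) D_{ν/κ}(lam + 2 η; w_2, …, w_n)`. Only finitely
many `κ` contribute to the sum. -/
def DSkew : (n : ℕ) → ℂ → (Fin n → ℂ) → Occ → Occ → ℂ
  | 0, _, _, ν, μ => if ν = μ then 1 else 0
  | n + 1, lam, w, ν, μ =>
      ∑ᶠ κ : Occ, DOne f η z Λ lam (w 0) κ μ * DSkew n (lam + 2 * η) (Fin.tail w) ν κ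

/-- The function `B_μ = B_{μ/∅}`. -/
def BFun (n : ℕ) (lam : ℂ) (u : Fin n → ℂ) (μ : Occ) : ℂ := BSkew f η z Λ n lam u μ 0

/-- The function `D_ν = D_{ν/0^N}` with `N = ℓ(ν)`. -/
def DFun (n : ℕ) (lam : ℂ) (v : Fin n → ℂ) (ν : Occ) : ℂ :=
  DSkew f η z Λ n lam v ν (Finsupp.single 0 (len ν))

/-! ### Notation of the symmetrization formulas -/

/-- The multiplicities of a signature `μ_1 ≥ ⋯ ≥ μ_M ≥ 0`. -/
def occ {M : ℕ} (μ : Fin M → ℕ) : Occ := ∑ i, Finsupp.single (μ i) 1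

/-- The number `n_{<k}` of parts of `ν` that are smaller than `k`. -/
def numBelow (ν : Occ) (k : ℕ) : ℕ := ∑ i ∈ Finset.range k, ν i

/-- `p_j = z_j + (1 - Λ_j) η`. -/
def pPt (j : ℕ) : ℂ := z j + (1 - Λ j) * η

/-- `q_j = z_j + (1 + Λ_j) η`. -/
def qPt (j : ℕ) : ℂ := z j + (1 + Λ j) * η

/-- The function `φ_k`. -/
def phi (k : ℕ) (u : ℂ) : ℂ :=
  1 / f (u - qPt η z Λ k)
    * ∏ i ∈ Finset.range k, f (u - pPt η z Λ i) / f (u - qPt η z Λ i)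

/-- The function `ψ_l`. -/
def psi (l : ℕ) (v : ℂ) : ℂ :=
  1 / f (v - pPt η z Λ l)
    * ∏ j ∈ Finset.range l, f (v - qPt η z Λ j) / f (v - pPt η z Λ j)

end Operators

/-- Adding one more tensor factor does not change the coefficients of `b(lam, w)` between basis
vectors that have `e_0` in this factor, as long as the denominators in its action do not
vanish. -/
theorem opB_succ_apply (f : ℂ → ℂ) (η : ℂ) (z Λ : ℕ → ℂ) (n : ℕ) (lam w : ℂ) (ν μ : Occ)
    (hν : ν n = 0)
    (h1 : f (z n - w + (Λ n + 1) * η) ≠ 0)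
    (h2 : f (lam - 2 * η * prefixWeight Λ n ν) ≠ 0) :
    opB f η z Λ (n + 1) lam w (basisVec μ) ν = opB f η z Λ n lam w (basisVec μ) ν := by
  have hB : ∀ x : Fock, (siteMat f η z Λ n lam w 0 1 x) ν = 0 := by
    intro x
    induction x using Finsupp.induction_linear with
    | zero => simp
    | add x y hx hy => simp [hx, hy]
    | single m c =>
      have hne : m.update n (m n + 1) ≠ ν := by
        intro h
        have := DFunLike.congr_fun h n
        simp [hν] at this
      simp [siteMat, evalMat, evalB, Finsupp.mapDomain_single, hne,
        -Finsupp.single_mul, -Finsupp.single_neg]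
  have hA : ∀ x : Fock, (siteMat f η z Λ n lam w 0 0 x) ν = x ν := by
    intro x
    induction x using Finsupp.induction_linear with
    | zero => simp
    | add x y hx hy => simp [hx, hy]
    | single m c =>
      have hup : m.update n (m n) = m := by simp
      by_cases hm : m = ν
      · subst hm
        simp [siteMat, evalMat, evalA, Finsupp.mapDomain_single, hν, h1, h2,
          -Finsupp.single_mul]
      · simp [siteMat, evalMat, evalA, Finsupp.mapDomain_single, hm,
          -Finsupp.single_mul]
  simp only [opB, monodromy, Matrix.mul_apply, Fin.sum_univ_two, LinearMap.add_apply,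
    Module.End.mul_apply, Finsupp.add_apply, hA, hB, add_zero]

end EllipticBethe

end

noncomputable section

namespace EllipticBethe

/-- Entire odd functions such that `f (x + y) * f (x - y)` is an alternating bilinear expression
in `x` and `y`; this is the form of the three-term relation for theta functions. -/
structure SigmaLike (f : ℂ → ℂ) : Prop where
  odd : ∀ x, f (-x) = -f x
  addition : ∃ A B : ℂ → ℂ, ∀ x y, f (x + y) * f (x - y) = A x * B y - A y * B x
  differentiable : Differentiable ℂ f

theorem sinPi_sigmaLike : SigmaLike sinPi where
  odd x := by simp [sinPi]
  addition := by
    refine ⟨fun x => Complex.sin (Real.pi * x) ^ 2, fun _ => 1, fun x y => ?_⟩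
    simp only [sinPi, mul_add, mul_sub, Complex.sin_add, Complex.sin_sub]
    have h1 := Complex.sin_sq_add_cos_sq (Real.pi * x)
    have h2 := Complex.sin_sq_add_cos_sq (Real.pi * y)
    linear_combination (-Complex.sin (Real.pi * y) ^ 2) * h1 + Complex.sin (Real.pi * x) ^ 2 * h2
  differentiable := by
    unfold sinPi
    fun_prop

/-- The summand of the theta series. -/
def thetaTerm (τ x : ℂ) (j : ℤ) : ℂ :=
  Complex.exp (Real.pi * Complex.I * ((j : ℂ) + 1 / 2) ^ 2 * τ
      + 2 * Real.pi * Complex.I * ((j : ℂ) + 1 / 2) * (x + 1 / 2))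

theorem thetaTerm_eq (τ x : ℂ) (j : ℤ) :
    thetaTerm τ x j = Complex.exp (Real.pi * Complex.I * (τ / 4 + (x + 1 / 2)))
      * jacobiTheta₂_term j (x + 1 / 2 + τ / 2) τ := by
  rw [thetaTerm, jacobiTheta₂_term, ← Complex.exp_add]
  congr 1
  ring

theorem summable_thetaTerm {τ : ℂ} (hτ : 0 < τ.im) (x : ℂ) : Summable (thetaTerm τ x) := by
  rw [show thetaTerm τ x = _ from funext (thetaTerm_eq τ x)]
  exact ((summable_jacobiTheta₂_term_iff _ _).2 hτ).mul_left _

theorem theta_eq_jacobiTheta₂ (τ x : ℂ) :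
    theta τ x = -(Complex.exp (Real.pi * Complex.I * (τ / 4 + (x + 1 / 2)))
      * jacobiTheta₂ (x + 1 / 2 + τ / 2) τ) := by
  rw [jacobiTheta₂, ← tsum_mul_left, theta]
  congr 1
  exact tsum_congr (thetaTerm_eq τ x)

theorem theta_neg (τ x : ℂ) : theta τ (-x) = -theta τ x := by
  have h : ∀ j : ℤ, thetaTerm τ (-x) (-1 - j) = -thetaTerm τ x j := by
    intro j
    have h1 : (Real.pi * Complex.I * (((-1 - j : ℤ) : ℂ) + 1 / 2) ^ 2 * τ
      + 2 * Real.pi * Complex.I * (((-1 - j : ℤ) : ℂ) + 1 / 2) * (-x + 1 / 2))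
      = (Real.pi * Complex.I * ((j : ℂ) + 1 / 2) ^ 2 * τ
      + 2 * Real.pi * Complex.I * ((j : ℂ) + 1 / 2) * (x + 1 / 2))
        + (((-j - 1 : ℤ) : ℂ) * (2 * Real.pi * Complex.I) + Real.pi * Complex.I) := by
      push_cast
      ring
    rw [thetaTerm, thetaTerm, h1, Complex.exp_add,
      Complex.exp_add (((-j - 1 : ℤ) : ℂ) * (2 * Real.pi * Complex.I)),
      Complex.exp_int_mul_two_pi_mul_I, Complex.exp_pi_mul_I]
    ring
  have h2 : theta τ (-x) = -∑' j, thetaTerm τ (-x) j := rfl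
  rw [h2, ← (Equiv.subLeft (-1 : ℤ)).tsum_eq]
  simp only [Equiv.subLeft_apply, h, tsum_neg]
  rfl

/-- Pairs of integers, split according to the parity of the sum. -/
def parityEquiv : (ℤ × ℤ) ⊕ (ℤ × ℤ) ≃ ℤ × ℤ :=
  Equiv.ofBijective (Sum.elim (fun c => (c.1 + c.2, c.1 - c.2 - 1)) fun c => (c.1 + c.2, c.2 - c.1))
    (by
      constructor
      · rintro (⟨a, b⟩ | ⟨a, b⟩) (⟨c, d⟩ | ⟨c, d⟩) h <;>
          simp only [Sum.elim_inl, Sum.elim_inr, Prod.mk.injEq, Sum.inl.injEq, Sum.inr.injEq,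
            reduceCtorEq] at h ⊢ <;> omega
      · rintro ⟨m, n⟩
        rcases Int.emod_two_eq_zero_or_one (m + n) with h | h
        · exact ⟨Sum.inr ((m - n) / 2, (m + n) / 2), by simp only [Sum.elim_inr, Prod.mk.injEq]; omega⟩
        · exact ⟨Sum.inl ((m + n + 1) / 2, (m - n - 1) / 2), by
            simp only [Sum.elim_inl, Prod.mk.injEq]; omega⟩)

theorem parityEquiv_inl (c : ℤ × ℤ) :
    parityEquiv (Sum.inl c) = (c.1 + c.2, c.1 - c.2 - 1) := rfl

theorem parityEquiv_inr (c : ℤ × ℤ) :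
    parityEquiv (Sum.inr c) = (c.1 + c.2, c.2 - c.1) := rfl

theorem theta_addition {τ : ℂ} (hτ : 0 < τ.im) (x y : ℂ) :
    theta τ (x + y) * theta τ (x - y) =
      jacobiTheta₂ (2 * x) (2 * τ) * (Complex.exp (Real.pi * Complex.I * (τ / 2 + 2 * y))
          * jacobiTheta₂ (2 * y + τ) (2 * τ))
        - jacobiTheta₂ (2 * y) (2 * τ) * (Complex.exp (Real.pi * Complex.I * (τ / 2 + 2 * x))
          * jacobiTheta₂ (2 * x + τ) (2 * τ)) := by
  have hτ2 : 0 < (2 * τ).im := by simpa using hτ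
  have hs : ∀ u, Summable fun n => jacobiTheta₂_term n u (2 * τ) := fun u =>
    (summable_jacobiTheta₂_term_iff _ _).2 hτ2
  have key : ∀ u v : ℂ, HasSum (fun c : ℤ × ℤ => jacobiTheta₂_term c.1 (2 * u) (2 * τ) *
      (Complex.exp (Real.pi * Complex.I * (τ / 2 + 2 * v)) * jacobiTheta₂_term c.2 (2 * v + τ) (2 * τ)))
      (jacobiTheta₂ (2 * u) (2 * τ) * (Complex.exp (Real.pi * Complex.I * (τ / 2 + 2 * v))
          * jacobiTheta₂ (2 * v + τ) (2 * τ))) := by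
    intro u v
    have h1 := hs (2 * u)
    have h2 := (hs (2 * v + τ)).mul_left (Complex.exp (Real.pi * Complex.I * (τ / 2 + 2 * v)))
    have h3 := summable_mul_of_summable_norm h1.norm h2.norm
    rw [jacobiTheta₂, jacobiTheta₂, ← tsum_mul_left, tsum_mul_tsum_of_summable_norm h1.norm h2.norm]
    exact h3.hasSum
  have hA := summable_thetaTerm hτ (x + y)
  have hB := summable_thetaTerm hτ (x - y)
  have h4 := summable_mul_of_summable_norm hA.norm hB.norm
  have h5 : theta τ (x + y) * theta τ (x - y)
      = ∑' c : ℤ × ℤ, thetaTerm τ (x + y) c.1 * thetaTerm τ (x - y) c.2 := by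
    rw [← tsum_mul_tsum_of_summable_norm hA.norm hB.norm]
    exact neg_mul_neg _ _
  rw [h5, ← parityEquiv.tsum_eq, sub_eq_add_neg (_ * _)]
  refine HasSum.tsum_eq (HasSum.sum ?_ ?_)
  · refine Eq.subst (motive := fun g => HasSum g _) (funext fun c => Eq.symm ?_) (key x y)
    simp only [Function.comp, parityEquiv_inl, thetaTerm, jacobiTheta₂_term, ← Complex.exp_add]
    rw [Complex.exp_eq_exp_iff_exists_int]
    refine ⟨c.1, ?_⟩
    push_cast
    ring
  · refine Eq.subst (motive := fun g => HasSum g _) (funext fun c => Eq.symm ?_) (key y x).neg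
    simp only [Function.comp, parityEquiv_inr, thetaTerm, jacobiTheta₂_term, ← Complex.exp_add]
    rw [← mul_neg_one (Complex.exp _), ← Complex.exp_pi_mul_I, ← Complex.exp_add,
      Complex.exp_eq_exp_iff_exists_int]
    refine ⟨c.2, ?_⟩
    push_cast
    ring

theorem theta_sigmaLike {τ : ℂ} (hτ : 0 < τ.im) : SigmaLike (theta τ) where
  odd := theta_neg τ
  addition := ⟨fun x => jacobiTheta₂ (2 * x) (2 * τ),
    fun x => Complex.exp (Real.pi * Complex.I * (τ / 2 + 2 * x)) * jacobiTheta₂ (2 * x + τ) (2 * τ),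
    theta_addition hτ⟩
  differentiable := by
    intro x
    rw [show theta τ = _ from funext (theta_eq_jacobiTheta₂ τ)]
    have h1 : DifferentiableAt ℂ (fun x : ℂ => jacobiTheta₂ (x + 1 / 2 + τ / 2) τ) x :=
      (differentiableAt_jacobiTheta₂_fst (x + 1 / 2 + τ / 2) hτ).comp (f := fun x : ℂ =>
        x + 1 / 2 + τ / 2) x (by fun_prop)
    exact (DifferentiableAt.mul (by fun_prop) h1).neg

namespace SigmaLike

variable {f : ℂ → ℂ}

theorem map_zero (hf : SigmaLike f) : f 0 = 0 := by
  have := hf.odd 0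
  simp only [neg_zero] at this
  linear_combination this / 2

theorem map_sub_comm (hf : SigmaLike f) (x y : ℂ) : f (x - y) = -f (y - x) := by
  rw [← hf.odd, neg_sub]

theorem continuous (hf : SigmaLike f) : Continuous f := hf.differentiable.continuous

/-- Zeros are isolated: a nonconstant affine perturbation of any argument avoids them. -/
theorem eventually_ne_zero (hf : SigmaLike f) {c : ℂ} (hc : f c ≠ 0) (a : ℂ) {s : ℂ} (hs : s ≠ 0) :
    ∀ᶠ ε in 𝓝[≠] (0 : ℂ), f (a + s * ε) ≠ 0 := by
  have hd : Differentiable ℂ fun ε : ℂ => f (a + s * ε) :=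
    hf.differentiable.comp (by fun_prop)
  have ha : AnalyticOnNhd ℂ (fun ε : ℂ => f (a + s * ε)) Set.univ :=
    (Complex.analyticOnNhd_univ_iff_differentiable).2 hd
  rcases (ha 0 (Set.mem_univ _)).eventually_eq_zero_or_eventually_ne_zero with h | h
  · exfalso
    have h0 := ha.eqOn_zero_of_preconnected_of_eventuallyEq_zero isPreconnected_univ
      (Set.mem_univ 0) h
    have h1 := h0 (Set.mem_univ ((c - a) / s))
    apply hc
    simpa [mul_div_cancel₀ _ hs] using h1
  · exact h

theorem eq_of_eventually_eq {g h : ℂ → ℂ} (hg : ContinuousAt g 0) (hh : ContinuousAt h 0)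
    (he : ∀ᶠ ε in 𝓝[≠] (0 : ℂ), g ε = h ε) : g 0 = h 0 :=
  tendsto_nhds_unique_of_frequently_eq (hg.tendsto.mono_left nhdsWithin_le_nhds)
    (hh.tendsto.mono_left nhdsWithin_le_nhds) he.frequently

/-- The three-term relation. -/
theorem three_term (hf : SigmaLike f) (x y z w : ℂ) :
    f (x + y) * f (x - y) * (f (z + w) * f (z - w)) =
      f (x + w) * f (x - w) * (f (z + y) * f (z - y))
        + f (x + z) * f (x - z) * (f (y + w) * f (y - w)) := by
  obtain ⟨A, B, h⟩ := hf.addition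
  simp only [h]
  ring

end SigmaLike

namespace SigmaLike

variable {f : ℂ → ℂ}

theorem interpolation (hf : SigmaLike f) (a b y y' X : ℂ) (hab : f (a - b) ≠ 0)
    (hD : f (a + b - (y + y')) ≠ 0) :
    f (X - y) * f (X - y') =
      f (a - y) * f (a - y') / (f (a - b) * f (a + b - (y + y')))
          * (f (X - b) * f (X - (y + y' - b)))
        - f (b - y) * f (b - y') / (f (a - b) * f (a + b - (y + y')))
          * (f (X - a) * f (X - (y + y' - a))) := by
  have h := hf.three_term (X - (y + y') / 2) ((y - y') / 2) (a - (y + y') / 2) (b - (y + y') / 2)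
  have e : ∀ u v : ℂ, u = v → f u = f v := fun u v h => by rw [h]
  rw [e (X - (y + y') / 2 + (y - y') / 2) (X - y') (by ring),
    e (X - (y + y') / 2 - (y - y') / 2) (X - y) (by ring),
    e (a - (y + y') / 2 + (b - (y + y') / 2)) (a + b - (y + y')) (by ring),
    e (a - (y + y') / 2 - (b - (y + y') / 2)) (a - b) (by ring),
    e (X - (y + y') / 2 + (b - (y + y') / 2)) (X - (y + y' - b)) (by ring),
    e (X - (y + y') / 2 - (b - (y + y') / 2)) (X - b) (by ring),
    e (a - (y + y') / 2 + (y - y') / 2) (a - y') (by ring),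
    e (a - (y + y') / 2 - (y - y') / 2) (a - y) (by ring),
    e (X - (y + y') / 2 + (a - (y + y') / 2)) (X - (y + y' - a)) (by ring),
    e (X - (y + y') / 2 - (a - (y + y') / 2)) (X - a) (by ring),
    e ((y - y') / 2 + (b - (y + y') / 2)) (b - y') (by ring),
    e ((y - y') / 2 - (b - (y + y') / 2)) (-(b - y)) (by ring), hf.odd] at h
  field_simp
  linear_combination h

theorem sum_prod_div_prod_of_generic {ι : Type*} [DecidableEq ι] (hf : SigmaLike f)
    (s : Finset ι) (x y : ι → ℂ)
    (hx : ∀ i ∈ s, ∀ j ∈ s, i ≠ j → f (x i - x j) ≠ 0) (hsum : ∑ i ∈ s, x i = ∑ i ∈ s, y i)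
    (ih : ∀ b ∈ s, ∀ y' : ι → ℂ, ∑ i ∈ s.erase b, x i = ∑ i ∈ s.erase b, y' i →
      ∑ j ∈ s.erase b, (∏ i ∈ s.erase b, f (x j - y' i)) / ∏ i ∈ (s.erase b).erase j, f (x j - x i) = 0)
    {a b : ι} (ha : a ∈ s) (hb : b ∈ s) (hab : a ≠ b) (hD : f (x a + x b - (y a + y b)) ≠ 0) :
    ∑ j ∈ s, (∏ i ∈ s, f (x j - y i)) / ∏ i ∈ s.erase j, f (x j - x i) = 0 := by
  have main : ∀ a ∈ s, ∀ b ∈ s, a ≠ b →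
      ∑ j ∈ s, f (x j - x b) * f (x j - (y a + y b - x b))
        * (∏ i ∈ (s.erase b).erase a, f (x j - y i)) / ∏ i ∈ s.erase j, f (x j - x i) = 0 := by
    intro a ha b hb hab
    rw [← Finset.add_sum_erase s _ hb, sub_self, hf.map_zero]
    have hae : a ∈ s.erase b := Finset.mem_erase.2 ⟨hab, ha⟩
    have h := ih b hb (Function.update y a (y a + y b - x b)) (by
      have h1 := Finset.add_sum_erase s x hb
      have h2 := Finset.add_sum_erase s y hb
      rw [← Finset.add_sum_erase _ _ hae] at h2
      rw [← Finset.add_sum_erase _ (Function.update y a (y a + y b - x b)) hae,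
        Function.update_self, Finset.sum_congr rfl fun i hi =>
          Function.update_of_ne (Finset.ne_of_mem_erase hi) _ y]
      linear_combination h1 - h2 + hsum)
    rw [zero_mul, zero_mul, zero_div, zero_add, ← h]
    refine Finset.sum_congr rfl fun j hj => ?_
    have hjb := Finset.mem_erase.1 hj
    have hbj : b ∈ s.erase j := Finset.mem_erase.2 ⟨hjb.1.symm, hb⟩
    rw [← Finset.mul_prod_erase _ (fun i => f (x j - x i)) hbj, Finset.erase_right_comm (a := j),
      ← Finset.mul_prod_erase _ (fun i => f (x j - Function.update y a _ i)) hae,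
      Function.update_self, mul_assoc, mul_div_mul_left _ _ (hx j hjb.2 b hb hjb.1)]
    congr 2
    exact Finset.prod_congr rfl fun i hi => by
      rw [Function.update_of_ne (Finset.ne_of_mem_erase hi)]
  have h1 := main a ha b hb hab
  have h2 := main b hb a ha hab.symm
  have hxab := hx a ha b hb hab
  have hterm : ∀ j ∈ s, (∏ i ∈ s, f (x j - y i)) / ∏ i ∈ s.erase j, f (x j - x i) =
      f (x a - y a) * f (x a - y b) / (f (x a - x b) * f (x a + x b - (y a + y b))) *
        (f (x j - x b) * f (x j - (y a + y b - x b))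
        * (∏ i ∈ (s.erase b).erase a, f (x j - y i)) / ∏ i ∈ s.erase j, f (x j - x i)) -
      f (x b - y a) * f (x b - y b) / (f (x a - x b) * f (x a + x b - (y a + y b))) *
        (f (x j - x a) * f (x j - (y b + y a - x a))
        * (∏ i ∈ (s.erase a).erase b, f (x j - y i)) / ∏ i ∈ s.erase j, f (x j - x i)) := by
    intro j _
    rw [← Finset.mul_prod_erase s (fun i => f (x j - y i)) hb,
      ← Finset.mul_prod_erase (s.erase b) (fun i => f (x j - y i)) (Finset.mem_erase.2 ⟨hab, ha⟩),
      Finset.erase_right_comm (a := a), add_comm (y b) (y a)]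
    have h3 := hf.interpolation (x a) (x b) (y a) (y b) (x j) hxab hD
    rw [← mul_assoc, mul_comm (f (x j - y b)), h3]
    ring
  rw [Finset.sum_congr rfl hterm, Finset.sum_sub_distrib, ← Finset.mul_sum, ← Finset.mul_sum, h1, h2]
  ring

/-- The partial fraction identity for theta functions. -/
theorem sum_prod_div_prod {ι : Type*} [DecidableEq ι] (hf : SigmaLike f) {c : ℂ} (hc : f c ≠ 0)
    (s : Finset ι) (x y : ι → ℂ)
    (hx : ∀ i ∈ s, ∀ j ∈ s, i ≠ j → f (x i - x j) ≠ 0) (hsum : ∑ i ∈ s, x i = ∑ i ∈ s, y i) :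
    ∑ j ∈ s, (∏ i ∈ s, f (x j - y i)) / ∏ i ∈ s.erase j, f (x j - x i) = 0 := by
  induction hn : s.card generalizing s y with
  | zero => simp [Finset.card_eq_zero.1 hn]
  | succ n ih =>
    have ih' : ∀ b ∈ s, ∀ y' : ι → ℂ, ∑ i ∈ s.erase b, x i = ∑ i ∈ s.erase b, y' i →
        ∑ j ∈ s.erase b, (∏ i ∈ s.erase b, f (x j - y' i))
          / ∏ i ∈ (s.erase b).erase j, f (x j - x i) = 0 := fun b hb y' hy' =>
      ih (s.erase b) y' (fun i hi j hj => hx i (Finset.mem_of_mem_erase hi) j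
        (Finset.mem_of_mem_erase hj)) hy' (by rw [Finset.card_erase_of_mem hb, hn]; rfl)
    rcases Nat.lt_or_ge n 2 with hn2 | hn2
    · rcases Nat.lt_or_ge n 1 with hn1 | hn1
      · obtain rfl : n = 0 := by omega
        obtain ⟨a, rfl⟩ := Finset.card_eq_one.1 hn
        simp only [Finset.sum_singleton] at hsum
        rw [Finset.sum_singleton, Finset.prod_singleton, hsum, sub_self, hf.map_zero, zero_div]
      · obtain rfl : n = 1 := by omega
        obtain ⟨a, b, hab, rfl⟩ := Finset.card_eq_two.1 hn
        rw [Finset.sum_pair hab, Finset.sum_pair hab] at hsum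
        have e1 : ({a, b} : Finset ι).erase a = {b} := Finset.erase_insert (by simpa using hab)
        have e2 : ({a, b} : Finset ι).erase b = {a} := by
          rw [Finset.pair_comm]
          exact Finset.erase_insert (by simpa using hab.symm)
        rw [Finset.sum_pair hab, Finset.prod_pair hab, Finset.prod_pair hab, e1, e2,
          Finset.prod_singleton, Finset.prod_singleton, hf.map_sub_comm (x b) (x a),
          show x b - y a = -(x a - y b) by linear_combination hsum,
          show x b - y b = -(x a - y a) by linear_combination hsum, hf.odd, hf.odd]
        ring
    · obtain ⟨a, b, e, ha, hb, he, hab, hae, hbe⟩ := (Finset.two_lt_card_iff (s := s)).1 (by omega)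
      by_cases hD : f (x a + x b - (y a + y b)) = 0
      · let Y : ℂ → ι → ℂ := fun ε => y + ε • (Pi.single a 1 - Pi.single e 1)
        have hcont : Continuous fun ε =>
            ∑ j ∈ s, (∏ i ∈ s, f (x j - Y ε i)) / ∏ i ∈ s.erase j, f (x j - x i) := by
          refine continuous_finsetSum _ fun j _ => Continuous.div_const
            (continuous_finsetProd _ fun i _ => hf.continuous.comp ?_) _
          simp only [Y, Pi.add_apply, Pi.smul_apply, smul_eq_mul]
          fun_prop
        have hev : ∀ᶠ ε in 𝓝[≠] (0 : ℂ),
            ∑ j ∈ s, (∏ i ∈ s, f (x j - Y ε i)) / ∏ i ∈ s.erase j, f (x j - x i) = 0 := by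
          filter_upwards [hf.eventually_ne_zero hc (x a + x b - (y a + y b)) (neg_ne_zero.2 one_ne_zero)]
            with ε hε
          refine hf.sum_prod_div_prod_of_generic s x (Y ε) hx ?_ ih' ha hb hab ?_
          · simp only [Y, Pi.add_apply, Pi.smul_apply, Pi.sub_apply, smul_eq_mul,
              Finset.sum_add_distrib, ← Finset.mul_sum, Finset.sum_sub_distrib,
              Finset.sum_pi_single', ha, he, if_true, sub_self, mul_zero, add_zero, hsum]
          · convert hε using 2
            simp only [Y, Pi.add_apply, Pi.smul_apply, Pi.sub_apply, smul_eq_mul,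
              Pi.single_eq_same, Pi.single_eq_of_ne hae, Pi.single_eq_of_ne hab.symm,
              Pi.single_eq_of_ne hbe]
            ring
        have h0 := eq_of_eventually_eq hcont.continuousAt continuousAt_const hev
        simpa [Y] using h0
      · exact hf.sum_prod_div_prod_of_generic s x y hx hsum ih' ha hb hab hD

/-- The partial fraction identity with zeros `u + t` next to the poles `u ∈ s`, and two more poles
`x₀`, `x₁`; the denominators with `x₀` are cleared. -/
theorem sum_shifted (hf : SigmaLike f) {c : ℂ} (hc : f c ≠ 0) (s : Finset ℂ) (t x₀ x₁ y₀ y₁ : ℂ)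
    (hs : ∀ u ∈ s, ∀ v ∈ s, u ≠ v → f (u - v) ≠ 0) (hx₁ : ∀ u ∈ s, f (x₁ - u) ≠ 0)
    (hsum : x₀ + x₁ = y₀ + y₁ + s.card * t) :
    f (x₁ - y₀) * f (x₁ - y₁) * ∏ u ∈ s, f (x₁ - u - t) / f (x₁ - u) * f (u - x₀) =
      f (x₀ - y₀) * f (x₀ - y₁) * ∏ u ∈ s, f (u + t - x₀)
        + f t * f (x₁ - x₀) * ∑ j ∈ s, f (j - y₀) * f (j - y₁) / f (j - x₁)
          * ∏ u ∈ s.erase j, f (j - u - t) / f (j - u) * f (u - x₀) := by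
  have generic : ∀ x₀ y₀ : ℂ, x₀ + x₁ = y₀ + y₁ + s.card * t → (∀ u ∈ s, f (x₀ - u) ≠ 0) →
      f (x₀ - x₁) ≠ 0 →
      f (x₁ - y₀) * f (x₁ - y₁) * ∏ u ∈ s, f (x₁ - u - t) / f (x₁ - u) * f (u - x₀) =
      f (x₀ - y₀) * f (x₀ - y₁) * ∏ u ∈ s, f (u + t - x₀)
        + f t * f (x₁ - x₀) * ∑ j ∈ s, f (j - y₀) * f (j - y₁) / f (j - x₁)
          * ∏ u ∈ s.erase j, f (j - u - t) / f (j - u) * f (u - x₀) := by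
    intro x₀ y₀ hsum h0 h01
    have n0 : ∀ u ∈ s, u ≠ x₀ := fun u hu e => h0 u hu (by rw [e, sub_self, hf.map_zero])
    have n1 : ∀ u ∈ s, u ≠ x₁ := fun u hu e => hx₁ u hu (by rw [e, sub_self, hf.map_zero])
    have n01 : x₀ ≠ x₁ := fun e => h01 (by rw [e, sub_self, hf.map_zero])
    have m1 : x₁ ∉ s := fun h => n1 _ h rfl
    have m0 : x₀ ∉ insert x₁ s := by
      rw [Finset.mem_insert]
      rintro (h | h)
      exacts [n01 h, n0 _ h rfl]
    have m0' : x₀ ∉ s := fun h => n0 _ h rfl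
    let y : ℂ → ℂ := fun u => if u = x₀ then y₀ else if u = x₁ then y₁ else u + t
    have yy0 : y x₀ = y₀ := if_pos rfl
    have yy1 : y x₁ = y₁ := by simp [y, n01.symm]
    have yys : ∀ u ∈ s, y u = u + t := fun u hu => by simp [y, n0 u hu, n1 u hu]
    have hsum' : ∑ u ∈ insert x₀ (insert x₁ s), u = ∑ u ∈ insert x₀ (insert x₁ s), y u := by
      rw [Finset.sum_insert m0, Finset.sum_insert m1, Finset.sum_insert m0, Finset.sum_insert m1,
        yy0, yy1, Finset.sum_congr rfl yys, Finset.sum_add_distrib, Finset.sum_const, nsmul_eq_mul]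
      linear_combination hsum
    have hprod : ∀ g : ℂ, ∏ u ∈ insert x₀ (insert x₁ s), f (g - y u)
        = f (g - y₀) * (f (g - y₁) * ∏ u ∈ s, f (g - u - t)) := by
      intro g
      rw [Finset.prod_insert m0, Finset.prod_insert m1, yy0, yy1]
      congr 2
      exact Finset.prod_congr rfl fun u hu => by rw [yys u hu, sub_sub]
    have h := hf.sum_prod_div_prod hc (insert x₀ (insert x₁ s)) id y (by
      intro i hi j hj hij
      simp only [Finset.mem_insert] at hi hj
      simp only [id]
      rcases hi with rfl | rfl | hi <;> rcases hj with rfl | rfl | hj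
      · exact absurd rfl hij
      · exact h01
      · exact h0 _ hj
      · rw [hf.map_sub_comm]; exact neg_ne_zero.2 h01
      · exact absurd rfl hij
      · exact hx₁ _ hj
      · rw [hf.map_sub_comm]; exact neg_ne_zero.2 (h0 _ hi)
      · rw [hf.map_sub_comm]; exact neg_ne_zero.2 (hx₁ _ hi)
      · exact hs _ hi _ hj hij) hsum'
    simp only [id, hprod] at h
    have er1 : (insert x₀ (insert x₁ s)).erase x₁ = insert x₀ s := by
      rw [Finset.erase_insert_of_ne n01, Finset.erase_insert m1]
    have ers : ∀ j ∈ s, (insert x₀ (insert x₁ s)).erase j = insert x₀ (insert x₁ (s.erase j)) := by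
      intro j hj
      rw [Finset.erase_insert_of_ne (n0 j hj).symm, Finset.erase_insert_of_ne (n1 j hj).symm]
    rw [Finset.sum_insert m0, Finset.sum_insert m1, Finset.erase_insert m0, er1,
      Finset.prod_insert m1, Finset.prod_insert m0'] at h
    have hs3 : ∀ j ∈ s, f (j - y₀) * (f (j - y₁) * ∏ u ∈ s, f (j - u - t))
          / ∏ u ∈ (insert x₀ (insert x₁ s)).erase j, f (j - u)
        = (-(f t * (f (j - y₀) * f (j - y₁) / f (j - x₁) *
            ∏ u ∈ s.erase j, f (j - u - t) / f (j - u) * f (u - x₀)))) / ∏ u ∈ s, f (u - x₀) := by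
      intro j hj
      have hm0 : x₀ ∉ insert x₁ (s.erase j) := by
        simp only [Finset.mem_insert, Finset.mem_erase]; tauto
      have hm1 : x₁ ∉ s.erase j := by
        simp only [Finset.mem_erase]; tauto
      rw [ers j hj, Finset.prod_insert hm0, Finset.prod_insert hm1, ← Finset.mul_prod_erase s _ hj,
        ← Finset.mul_prod_erase s (fun u => f (u - x₀)) hj, sub_self, zero_sub, hf.odd,
        Finset.prod_mul_distrib, Finset.prod_div_distrib]
      have k1 : f (j - x₀) ≠ 0 := by rw [hf.map_sub_comm]; exact neg_ne_zero.2 (h0 j hj)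
      have k2 : f (j - x₁) ≠ 0 := by rw [hf.map_sub_comm]; exact neg_ne_zero.2 (hx₁ j hj)
      have k3 : ∏ u ∈ s.erase j, f (j - u) ≠ 0 := Finset.prod_ne_zero_iff.2 fun u hu =>
        hs j hj u (Finset.mem_of_mem_erase hu) (Finset.ne_of_mem_erase hu).symm
      have k4 : ∏ u ∈ s.erase j, f (u - x₀) ≠ 0 := Finset.prod_ne_zero_iff.2 fun u hu => by
        rw [hf.map_sub_comm]; exact neg_ne_zero.2 (h0 u (Finset.mem_of_mem_erase hu))
      field_simp
    have k0 : ∏ u ∈ s, f (u - x₀) ≠ 0 := Finset.prod_ne_zero_iff.2 fun u hu => by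
      rw [hf.map_sub_comm]; exact neg_ne_zero.2 (h0 u hu)
    have k0' : ∏ u ∈ s, f (x₀ - u) ≠ 0 := Finset.prod_ne_zero_iff.2 h0
    have k1 : ∏ u ∈ s, f (x₁ - u) ≠ 0 := Finset.prod_ne_zero_iff.2 hx₁
    have hr : (∏ u ∈ s, f (x₀ - u - t)) / ∏ u ∈ s, f (x₀ - u)
        = (∏ u ∈ s, f (u + t - x₀)) / ∏ u ∈ s, f (u - x₀) := by
      rw [← Finset.prod_div_distrib, ← Finset.prod_div_distrib]
      refine Finset.prod_congr rfl fun u _ => ?_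
      rw [hf.map_sub_comm x₀ u, sub_sub, hf.map_sub_comm x₀, neg_div_neg_eq]
    rw [Finset.sum_congr rfl hs3, ← Finset.sum_div, Finset.sum_neg_distrib, ← Finset.mul_sum,
      hf.map_sub_comm x₁ x₀, ← mul_assoc, mul_div_mul_comm, hr] at h
    rw [Finset.prod_mul_distrib, Finset.prod_div_distrib, hf.map_sub_comm x₁ x₀]
    generalize ∑ j ∈ s, f (j - y₀) * f (j - y₁) / f (j - x₁) *
            ∏ u ∈ s.erase j, f (j - u - t) / f (j - u) * f (u - x₀) = S at h ⊢
    field_simp at h ⊢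
    linear_combination -h
  have hev : ∀ᶠ ε in 𝓝[≠] (0 : ℂ), (∀ u ∈ s, f (x₀ + ε - u) ≠ 0) ∧ f (x₀ + ε - x₁) ≠ 0 := by
    have h1 : ∀ a : ℂ, ∀ᶠ ε in 𝓝[≠] (0 : ℂ), f (x₀ + ε - a) ≠ 0 := fun a => by
      filter_upwards [hf.eventually_ne_zero hc (x₀ - a) one_ne_zero] with ε hε
      convert hε using 2
      ring
    exact ((Filter.eventually_all_finset s).2 fun u _ => h1 u).and (h1 x₁)
  have hfc := hf.continuous
  have h0 := eq_of_eventually_eq (g := fun ε => f (x₁ - (y₀ + ε)) * f (x₁ - y₁) *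
      ∏ u ∈ s, f (x₁ - u - t) / f (x₁ - u) * f (u - (x₀ + ε)))
    (h := fun ε => f (x₀ + ε - (y₀ + ε)) * f (x₀ + ε - y₁) * ∏ u ∈ s, f (u + t - (x₀ + ε))
        + f t * f (x₁ - (x₀ + ε)) * ∑ j ∈ s, f (j - (y₀ + ε)) * f (j - y₁) / f (j - x₁)
          * ∏ u ∈ s.erase j, f (j - u - t) / f (j - u) * f (u - (x₀ + ε)))
    (Continuous.continuousAt (by fun_prop)) (Continuous.continuousAt (by fun_prop)) (by
      filter_upwards [hev] with ε hε
      exact generic _ _ (by linear_combination hsum) hε.1 hε.2)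
  simpa only [add_zero] using h0

end SigmaLike

namespace SigmaLike

variable {f : ℂ → ℂ}

theorem congr_arg_of_eq {u v : ℂ} (h : u = v) : f u = f v := by rw [h]

theorem map_eq_neg (hf : SigmaLike f) {u v : ℂ} (h : u = -v) : f u = -f v := by rw [h, hf.odd]

theorem ne_zero_sub_comm (hf : SigmaLike f) {u v : ℂ} (h : f (u - v) ≠ 0) : f (v - u) ≠ 0 := by
  rw [hf.map_sub_comm]; exact neg_ne_zero.2 h

theorem ne_of_map_sub_ne_zero (hf : SigmaLike f) {u v : ℂ} (h : f (u - v) ≠ 0) : u ≠ v := fun e =>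
  h (by rw [e, sub_self, hf.map_zero])

/-- Symmetrization over the variables that sit at one site. -/
theorem sum_block (hf : SigmaLike f) {t : ℂ} (ht : f t ≠ 0) (s : Finset ℂ) (k : ℕ)
    (hk : s.card = k + 1) (Y : ℂ) (hs : ∀ u ∈ s, ∀ v ∈ s, u ≠ v → f (u - v) ≠ 0) :
    ∑ j ∈ s, f (Y + j + t + 2 * k * t)
      * ∏ u ∈ s.erase j, f (j - u - t) / f (j - u) * f (Y + u + k * t)
    = f ((k + 1) * t) / f t * ∏ u ∈ s, f (Y + u + (k + 1) * t) := by
  have hev : ∀ᶠ ε in 𝓝[≠] (0 : ℂ), (∀ u ∈ s, f (ε - u) ≠ 0) ∧ f (ε + Y + k * t) ≠ 0 := by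
    have h1 : ∀ a : ℂ, ∀ᶠ ε in 𝓝[≠] (0 : ℂ), f (ε - a) ≠ 0 := fun a => by
      filter_upwards [hf.eventually_ne_zero ht (-a) one_ne_zero] with ε hε
      convert hε using 2
      ring
    refine ((Filter.eventually_all_finset s).2 fun u _ => h1 u).and ?_
    filter_upwards [h1 (-Y - k * t)] with ε hε
    convert hε using 2
    ring
  obtain ⟨x₁, h1, h2⟩ := hev.exists
  have h := hf.sum_shifted ht s t (-Y - k * t) x₁ (-Y - t - 2 * k * t) x₁ hs h1 (by
    rw [hk]; push_cast; ring)
  rw [sub_self, hf.map_zero, mul_zero, zero_mul] at h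
  have h3 : ∀ j ∈ s, f (j - (-Y - t - 2 * k * t)) * f (j - x₁) / f (j - x₁)
      * ∏ u ∈ s.erase j, f (j - u - t) / f (j - u) * f (u - (-Y - k * t)) =
      f (Y + j + t + 2 * k * t)
      * ∏ u ∈ s.erase j, f (j - u - t) / f (j - u) * f (Y + u + k * t) := by
    intro j hj
    rw [mul_div_cancel_right₀ _ (hf.ne_zero_sub_comm (h1 j hj))]
    congr 1
    · congr 1; ring
    · refine Finset.prod_congr rfl fun u _ => ?_
      congr 2; ring
  rw [Finset.sum_congr rfl h3, hf.map_sub_comm _ x₁,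
    congr_arg_of_eq (f := f) (show x₁ - (-Y - k * t) = x₁ + Y + k * t by ring),
    congr_arg_of_eq (f := f) (show -Y - k * t - (-Y - t - 2 * k * t) = (k + 1) * t by ring),
    Finset.prod_congr rfl fun u _ =>
      congr_arg_of_eq (f := f) (show u + t - (-Y - k * t) = Y + u + (k + 1) * t by ring)] at h
  rw [div_mul_eq_mul_div, eq_div_iff ht]
  refine mul_left_cancel₀ h2 ?_
  linear_combination -h

theorem sum_step_b (hf : SigmaLike f) {c : ℂ} (hc : f c ≠ 0) (s : Finset ℂ) (t w x q : ℂ)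
    (hs : ∀ u ∈ s, ∀ v ∈ s, u ≠ v → f (u - v) ≠ 0) (hw : ∀ u ∈ s, f (w - u) ≠ 0) :
    f (w - q + s.card * t) * f (x + s.card * t) * ∏ u ∈ s, f (x + u - q + (s.card - 1) * t)
      + f (x + w - q + s.card * t) * ∑ j ∈ s, f t * f (x - w + j) / f (w - j) * f (j - q)
        * ∏ u ∈ s.erase j, f (u - j - t) / f (u - j) * f (x + u - q + s.card * t)
    = f (w - q) * f x * ∏ u ∈ s, f (u - w - t) / f (u - w) * f (x + u - q + s.card * t) := by
  have h := hf.sum_shifted hc s (-t) (q - x - s.card * t) w q (w - x) hs hw (by ring)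
  have e1 : ∀ w u : ℂ, f (w - u - -t) / f (w - u) = f (u - w - t) / f (u - w) := fun w u => by
    rw [hf.map_eq_neg (show w - u - -t = -(u - w - t) by ring), hf.map_sub_comm w u, neg_div_neg_eq]
  have e2 : ∀ u : ℂ, f (u - (q - x - s.card * t)) = f (x + u - q + s.card * t) := fun u =>
    congr_arg_of_eq (by ring)
  have e3 : ∀ u : ℂ, f (u + -t - (q - x - s.card * t)) = f (x + u - q + (s.card - 1) * t) :=
    fun u => congr_arg_of_eq (by ring)
  have h3 : ∀ j ∈ s, f (j - q) * f (j - (w - x)) / f (j - w)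
      * ∏ u ∈ s.erase j, f (u - j - t) / f (u - j) * f (x + u - q + s.card * t) =
      -(f (x - w + j) / f (w - j) * f (j - q)
        * ∏ u ∈ s.erase j, f (u - j - t) / f (u - j) * f (x + u - q + s.card * t)) := by
    intro j _
    rw [hf.map_sub_comm j w, congr_arg_of_eq (f := f) (show j - (w - x) = x - w + j by ring)]
    ring
  simp only [e1, e3] at h
  simp only [e2] at h
  rw [Finset.sum_congr rfl h3, Finset.sum_neg_distrib, hf.odd,
    congr_arg_of_eq (f := f) (show w - (w - x) = x by ring),
    hf.map_eq_neg (show q - x - s.card * t - q = -(x + s.card * t) by ring),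
    hf.map_eq_neg (show q - x - s.card * t - (w - x) = -(w - q + s.card * t) by ring)] at h
  have h4 : ∀ j, f t * f (x - w + j) / f (w - j) * f (j - q)
        * ∏ u ∈ s.erase j, f (u - j - t) / f (u - j) * f (x + u - q + s.card * t) =
      f t * (f (x - w + j) / f (w - j) * f (j - q)
        * ∏ u ∈ s.erase j, f (u - j - t) / f (u - j) * f (x + u - q + s.card * t)) := fun j => by
    ring
  simp only [h4]
  rw [← Finset.mul_sum]
  linear_combination -h

theorem sum_step_d (hf : SigmaLike f) {c : ℂ} (hc : f c ≠ 0) (s : Finset ℂ) (t w x p q : ℂ)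
    (hs : ∀ u ∈ s, ∀ v ∈ s, u ≠ v → f (u - v) ≠ 0) (hw : ∀ u ∈ s, f (w - u) ≠ 0) :
    f (w - p - s.card * t) * f (x - (q - p) + s.card * t)
        * ∏ u ∈ s, f (x + u - q + (s.card + 1) * t) =
      f (x - (q - p) + 2 * s.card * t) * f (w - p)
        * (∏ u ∈ s, f (w - u - t) / f (w - u) * f (x + u - q + s.card * t))
      + f (x + w - q + s.card * t) *
        ∑ j ∈ s, f t * f (x - (q - p) + 2 * s.card * t - w + j) / f (w - j) * f (j - p)
          * ∏ u ∈ s.erase j, f (j - u - t) / f (j - u) * f (x + u - q + s.card * t) := by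
  have h := hf.sum_shifted hc s t (q - x - s.card * t) w p (w - (x - (q - p) + 2 * s.card * t))
    hs hw (by ring)
  have e2 : ∀ u : ℂ, f (u - (q - x - s.card * t)) = f (x + u - q + s.card * t) := fun u =>
    congr_arg_of_eq (by ring)
  have e3 : ∀ u : ℂ, f (u + t - (q - x - s.card * t)) = f (x + u - q + (s.card + 1) * t) :=
    fun u => congr_arg_of_eq (by ring)
  have h3 : ∀ j ∈ s, f (j - p) * f (j - (w - (x - (q - p) + 2 * s.card * t))) / f (j - w)
      * ∏ u ∈ s.erase j, f (j - u - t) / f (j - u) * f (x + u - q + s.card * t) =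
      -(f (x - (q - p) + 2 * s.card * t - w + j) / f (w - j) * f (j - p)
        * ∏ u ∈ s.erase j, f (j - u - t) / f (j - u) * f (x + u - q + s.card * t)) := by
    intro j _
    rw [hf.map_sub_comm j w, congr_arg_of_eq (f := f)
      (show j - (w - (x - (q - p) + 2 * s.card * t)) = x - (q - p) + 2 * s.card * t - w + j by ring)]
    ring
  simp only [e3] at h
  simp only [e2] at h
  rw [Finset.sum_congr rfl h3, Finset.sum_neg_distrib,
    congr_arg_of_eq (f := f) (show w - (w - (x - (q - p) + 2 * s.card * t))
      = x - (q - p) + 2 * s.card * t by ring),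
    hf.map_eq_neg (show q - x - s.card * t - p = -(x - (q - p) + s.card * t) by ring),
    hf.map_eq_neg (show q - x - s.card * t - (w - (x - (q - p) + 2 * s.card * t))
      = -(w - p - s.card * t) by ring)] at h
  have h4 : ∀ j, f t * f (x - (q - p) + 2 * s.card * t - w + j) / f (w - j) * f (j - p)
        * ∏ u ∈ s.erase j, f (j - u - t) / f (j - u) * f (x + u - q + s.card * t) =
      f t * (f (x - (q - p) + 2 * s.card * t - w + j) / f (w - j) * f (j - p)
        * ∏ u ∈ s.erase j, f (j - u - t) / f (j - u) * f (x + u - q + s.card * t)) := fun j => by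
    ring
  simp only [h4]
  rw [← Finset.mul_sum]
  linear_combination -h

theorem sum_step_row (hf : SigmaLike f) {c : ℂ} (hc : f c ≠ 0) (s : Finset ℂ) (t w x y p' : ℂ)
    (hs : ∀ u ∈ s, ∀ v ∈ s, u ≠ v → f (u - v) ≠ 0) (hw : ∀ u ∈ s, f (w - u) ≠ 0)
    (hx : x = -y - p' - s.card * t) :
    f (w + y + s.card * t) * f (p' + y) * (∏ u ∈ s, f (u - p' - t))
      = f (w - p') * (∑ j ∈ s, f t * f (x - w + j) / f (w - j) * f (y + j)
          * ∏ u ∈ s.erase j, f (u - j - t) / f (u - j) * f (u - p'))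
        - f x * f (y + w) * (∏ u ∈ s, f (u - w - t) / f (u - w) * f (u - p')) := by
  have h := hf.sum_shifted hc s (-t) p' w (-y) (w - x) hs hw (by rw [hx]; ring)
  have e1 : ∀ w u : ℂ, f (w - u - -t) / f (w - u) = f (u - w - t) / f (u - w) := fun w u => by
    rw [hf.map_eq_neg (show w - u - -t = -(u - w - t) by ring), hf.map_sub_comm w u, neg_div_neg_eq]
  have e3 : ∀ u : ℂ, f (u + -t - p') = f (u - p' - t) := fun u => congr_arg_of_eq (by ring)
  have h3 : ∀ j ∈ s, f (j - -y) * f (j - (w - x)) / f (j - w)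
      * ∏ u ∈ s.erase j, f (u - j - t) / f (u - j) * f (u - p') =
      -(f (x - w + j) / f (w - j) * f (y + j)
        * ∏ u ∈ s.erase j, f (u - j - t) / f (u - j) * f (u - p')) := by
    intro j _
    rw [hf.map_sub_comm j w, congr_arg_of_eq (f := f) (show j - (w - x) = x - w + j by ring),
      congr_arg_of_eq (f := f) (show j - -y = y + j by ring)]
    ring
  simp only [e1, e3] at h
  rw [Finset.sum_congr rfl h3, Finset.sum_neg_distrib, hf.odd,
    congr_arg_of_eq (f := f) (show w - (w - x) = x by ring),
    congr_arg_of_eq (f := f) (show w - -y = y + w by ring),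
    congr_arg_of_eq (f := f) (show p' - -y = p' + y by ring),
    hf.map_eq_neg (show p' - (w - x) = -(w + y + s.card * t) by rw [hx]; ring)] at h
  have h4 : ∀ j, f t * f (x - w + j) / f (w - j) * f (y + j)
        * ∏ u ∈ s.erase j, f (u - j - t) / f (u - j) * f (u - p') =
      f t * (f (x - w + j) / f (w - j) * f (y + j)
        * ∏ u ∈ s.erase j, f (u - j - t) / f (u - j) * f (u - p')) := fun j => by
    ring
  simp only [h4]
  rw [← Finset.mul_sum]
  linear_combination h

end SigmaLike

namespace SigmaLike

variable {f : ℂ → ℂ}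

theorem sum_step_c_aux (hf : SigmaLike f) {c : ℂ} (hc : f c ≠ 0) (s : Finset ℂ) (t w x p q : ℂ)
    (k : ℕ) (hk : s.card = k + 1)
    (hs : ∀ u ∈ s, ∀ v ∈ s, u ≠ v → f (u - v) ≠ 0) (hw : ∀ u ∈ s, f (w - u) ≠ 0)
    (hw' : ∀ u ∈ s, f (w + t - u) ≠ 0) :
    f (x + w - q + (k + 1) * t) *
      ∑ j ∈ s, f t * f (x - (q - p) + 2 * k * t - w + j) / f (w - j) * f (j - p)
        * ∏ u ∈ s.erase j, f (j - u - t) / f (j - u) * f (x + u - q + k * t)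
          * (f (u - w - t) / f (u - w))
    = f (x - (q - p) + k * t) * f (w - p - k * t)
        * (∏ u ∈ s, f (u - w - t) / f (u - w) * f (x + u - q + (k + 1) * t))
      - f (w + t - p) * f (x - (q - p) + 2 * k * t + t) * ∏ u ∈ s, f (x + u - q + k * t) := by
  have h := hf.sum_shifted hc s t (q - x - k * t) (w + t) p (w - (x - (q - p) + 2 * k * t))
    hs hw' (by rw [hk]; push_cast; ring)
  have e3 : ∀ u : ℂ, f (u + t - (q - x - k * t)) = f (x + u - q + (k + 1) * t) :=
    fun u => congr_arg_of_eq (by ring)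
  simp only [e3] at h
  have e2 : ∀ u : ℂ, f (u - (q - x - k * t)) = f (x + u - q + k * t) := fun u =>
    congr_arg_of_eq (by ring)
  simp only [e2] at h
  have e4 : ∏ u ∈ s, f (w + t - u - t) / f (w + t - u) * f (x + u - q + k * t)
      = (∏ u ∈ s, f (x + u - q + k * t)) / ∏ u ∈ s, f (u - w - t) / f (u - w) := by
    rw [← Finset.prod_div_distrib]
    refine Finset.prod_congr rfl fun u hu => ?_
    have h1 := hw u hu
    have h2 := hw' u hu
    rw [congr_arg_of_eq (f := f) (show w + t - u - t = w - u by ring), hf.map_sub_comm u w,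
      hf.map_eq_neg (show u - w - t = -(w + t - u) by ring)]
    field_simp
  have e5 : ∏ u ∈ s, f (u - w - t) / f (u - w) ≠ 0 := Finset.prod_ne_zero_iff.2 fun u hu => by
    rw [hf.map_sub_comm u w, hf.map_eq_neg (show u - w - t = -(w + t - u) by ring)]
    exact div_ne_zero (neg_ne_zero.2 (hw' u hu)) (neg_ne_zero.2 (hw u hu))
  have h3 : ∀ j ∈ s, f t * f (x - (q - p) + 2 * k * t - w + j) / f (w - j) * f (j - p)
        * ∏ u ∈ s.erase j, f (j - u - t) / f (j - u) * f (x + u - q + k * t)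
          * (f (u - w - t) / f (u - w)) =
      (∏ u ∈ s, f (u - w - t) / f (u - w)) * (-f t) *
       (f (j - p) * f (j - (w - (x - (q - p) + 2 * k * t))) / f (j - (w + t))
      * ∏ u ∈ s.erase j, f (j - u - t) / f (j - u) * f (x + u - q + k * t)) := by
    intro j hj
    rw [Finset.prod_mul_distrib (s := s.erase j), ← Finset.mul_prod_erase s _ hj,
      hf.map_sub_comm j (w + t), hf.map_sub_comm j w,
      hf.map_eq_neg (show j - w - t = -(w + t - j) by ring),
      congr_arg_of_eq (f := f)
        (show j - (w - (x - (q - p) + 2 * k * t)) = x - (q - p) + 2 * k * t - w + j by ring)]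
    have h1 := hw j hj
    have h2 := hw' j hj
    field_simp
  rw [Finset.sum_congr rfl h3, ← Finset.mul_sum]
  rw [e4, congr_arg_of_eq (f := f) (show w + t - (w - (x - (q - p) + 2 * k * t))
      = x - (q - p) + 2 * k * t + t by ring),
    hf.map_eq_neg (show q - x - k * t - p = -(x - (q - p) + k * t) by ring),
    hf.map_eq_neg (show q - x - k * t - (w - (x - (q - p) + 2 * k * t))
      = -(w - p - k * t) by ring)] at h
  rw [Finset.prod_mul_distrib (s := s) (f := fun u => f (u - w - t) / f (u - w))]
  rw [mul_div_assoc', div_eq_iff e5] at h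
  linear_combination h

theorem sum_step_c (hf : SigmaLike f) {c : ℂ} (hc : f c ≠ 0) (s : Finset ℂ) (t w x p q : ℂ)
    (k : ℕ) (hk : s.card = k + 1)
    (hs : ∀ u ∈ s, ∀ v ∈ s, u ≠ v → f (u - v) ≠ 0) (hw : ∀ u ∈ s, f (w - u) ≠ 0) :
    f (w - p - k * t) * f (x - (q - p) + k * t) *
        (∑ j ∈ s, f t * f (x - w + j) / f (w - j) * f (j - q)
          * ∏ u ∈ s.erase j, f (u - j - t) / f (u - j) * f (x + u - q + (k + 1) * t))
      + f (x + p - w + k * t) * f (q - p - k * t) * f ((k + 1) * t)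
        * (∏ u ∈ s, f (x + u - q + k * t))
    = f (w - q) * f x *
      ∑ j ∈ s, f t * f (x - (q - p) + 2 * k * t - w + j) / f (w - j) * f (j - p)
        * ∏ u ∈ s.erase j, f (j - u - t) / f (j - u) * f (x + u - q + k * t)
          * (f (u - w - t) / f (u - w)) := by
  have generic : ∀ w, (∀ u ∈ s, f (w - u) ≠ 0) → (∀ u ∈ s, f (w + t - u) ≠ 0) →
      f (x + w - q + (k + 1) * t) ≠ 0 →
      f (w - p - k * t) * f (x - (q - p) + k * t) *
        (∑ j ∈ s, f t * f (x - w + j) / f (w - j) * f (j - q)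
          * ∏ u ∈ s.erase j, f (u - j - t) / f (u - j) * f (x + u - q + (k + 1) * t))
      + f (x + p - w + k * t) * f (q - p - k * t) * f ((k + 1) * t)
        * (∏ u ∈ s, f (x + u - q + k * t))
      = f (w - q) * f x *
      ∑ j ∈ s, f t * f (x - (q - p) + 2 * k * t - w + j) / f (w - j) * f (j - p)
        * ∏ u ∈ s.erase j, f (j - u - t) / f (j - u) * f (x + u - q + k * t)
          * (f (u - w - t) / f (u - w)) := by
    intro w hw hw' hD
    have h1 := hf.sum_step_b hc s t w x q hs hw
    have h2 := hf.sum_step_c_aux hc s t w x p q k hk hs hw hw'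
    have h3 := hf.three_term (x - (q - p) / 2 + k * t + t / 2) ((q - p + t) / 2)
      (w - q / 2 - p / 2 + t / 2) ((q - p) / 2 - k * t - t / 2)
    rw [show (x - (q - p) / 2 + k * t + t / 2)
        + ((q - p + t) / 2) = x + (k + 1) * t by ring,
      show (x - (q - p) / 2 + k * t + t / 2)
        - ((q - p + t) / 2) = x - (q - p) + k * t by ring,
      show (w - q / 2 - p / 2 + t / 2)
        + ((q - p) / 2 - k * t - t / 2) = w - p - k * t by ring,
      show (w - q / 2 - p / 2 + t / 2)
        - ((q - p) / 2 - k * t - t / 2) = w - q + (k + 1) * t by ring,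
      show (x - (q - p) / 2 + k * t + t / 2)
        + ((q - p) / 2 - k * t - t / 2) = x by ring,
      show (x - (q - p) / 2 + k * t + t / 2)
        - ((q - p) / 2 - k * t - t / 2) = x - (q - p) + 2 * k * t + t by ring,
      show (w - q / 2 - p / 2 + t / 2)
        + ((q - p + t) / 2) = w + t - p by ring,
      show (w - q / 2 - p / 2 + t / 2)
        - ((q - p + t) / 2) = w - q by ring,
      show (x - (q - p) / 2 + k * t + t / 2)
        + (w - q / 2 - p / 2 + t / 2) = x + w - q + (k + 1) * t by ring,
      show (x - (q - p) / 2 + k * t + t / 2)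
        - (w - q / 2 - p / 2 + t / 2) = x + p - w + k * t by ring,
      show ((q - p + t) / 2)
        + ((q - p) / 2 - k * t - t / 2) = q - p - k * t by ring,
      show ((q - p + t) / 2)
        - ((q - p) / 2 - k * t - t / 2) = (k + 1) * t by ring] at h3
    simp only [hk, Nat.cast_add, Nat.cast_one, add_sub_cancel_right] at h1
    refine mul_left_cancel₀ hD ?_
    linear_combination f (w - p - k * t) * f (x - (q - p) + k * t) * h1 - f (w - q) * f x * h2
      - (∏ u ∈ s, f (x + u - q + k * t)) * h3
  have h1 : ∀ a : ℂ, ∀ᶠ ε in 𝓝[≠] (0 : ℂ), f (a + ε) ≠ 0 := fun a => by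
    filter_upwards [hf.eventually_ne_zero hc a one_ne_zero] with ε hε
    convert hε using 2
    ring
  have hev : ∀ᶠ ε in 𝓝[≠] (0 : ℂ), (∀ u ∈ s, f (w - u + ε) ≠ 0) ∧
      (∀ u ∈ s, f (w + t - u + ε) ≠ 0) ∧ f (x + w - q + (k + 1) * t + ε) ≠ 0 :=
    ((Filter.eventually_all_finset s).2 fun u _ => h1 _).and
      (((Filter.eventually_all_finset s).2 fun u _ => h1 _).and (h1 _))
  have hfc := hf.continuous
  have hw'' : ∀ u ∈ s, f (w + 0 - u) ≠ 0 := by simpa using hw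
  have h0 := eq_of_eventually_eq (g := fun ε => f (w + ε - p - k * t) * f (x - (q - p) + k * t) *
        (∑ j ∈ s, f t * f (x - (w + ε) + j) / f (w + ε - j) * f (j - q)
          * ∏ u ∈ s.erase j, f (u - j - t) / f (u - j) * f (x + u - q + (k + 1) * t))
      + f (x + p - (w + ε) + k * t) * f (q - p - k * t) * f ((k + 1) * t)
        * (∏ u ∈ s, f (x + u - q + k * t)))
    (h := fun ε => f (w + ε - q) * f x *
      ∑ j ∈ s, f t * f (x - (q - p) + 2 * k * t - (w + ε) + j) / f (w + ε - j) * f (j - p)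
        * ∏ u ∈ s.erase j, f (j - u - t) / f (j - u) * f (x + u - q + k * t)
          * (f (u - (w + ε) - t) / f (u - (w + ε))))
    (by
      refine ContinuousAt.add (ContinuousAt.mul (by fun_prop) ?_) (by fun_prop)
      refine tendsto_finsetSum _ fun j hj => ContinuousAt.mul (ContinuousAt.mul
        (ContinuousAt.div (by fun_prop) (by fun_prop) (hw'' j hj)) (by fun_prop)) (by fun_prop))
    (by
      refine ContinuousAt.mul (by fun_prop) ?_
      refine tendsto_finsetSum _ fun j hj => ContinuousAt.mul (ContinuousAt.mul
        (ContinuousAt.div (by fun_prop) (by fun_prop) (hw'' j hj)) (by fun_prop)) ?_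
      refine tendsto_finsetProd _ fun u hu => ContinuousAt.mul (by fun_prop) ?_
      exact ContinuousAt.div (by fun_prop) (by fun_prop)
        (hf.ne_zero_sub_comm (hw'' u (Finset.mem_of_mem_erase hu))))
    (by
      filter_upwards [hev] with ε hε
      refine generic (w + ε) (fun u hu => ?_) (fun u hu => ?_) ?_
      · convert hε.1 u hu using 2; ring
      · convert hε.2.1 u hu using 2; ring
      · convert hε.2.2 using 2; ring)
  simpa only [add_zero] using h0

end SigmaLike

section Subsets

variable {α M : Type*} [AddCommMonoid M]

/-- The subsets of `U` with `k - 1` elements; there are none for `k = 0`. -/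
def predSubsets (U : Finset α) (k : ℕ) : Finset (Finset α) := U.powerset.filter fun I => I.card + 1 = k

theorem mem_predSubsets {U I : Finset α} {k : ℕ} : I ∈ predSubsets U k ↔ I ⊆ U ∧ I.card + 1 = k := by
  simp [predSubsets]

theorem predSubsets_succ (U : Finset α) (k : ℕ) : predSubsets U (k + 1) = U.powersetCard k := by
  ext I
  simp [mem_predSubsets, Finset.mem_powersetCard]

variable [DecidableEq α]

theorem sum_powersetCard_sdiff (U : Finset α) (k : ℕ) (G : Finset α → α → M) :
    ∑ I ∈ U.powersetCard k, ∑ j ∈ U \ I, G I j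
      = ∑ J ∈ U.powersetCard (k + 1), ∑ j ∈ J, G (J.erase j) j := by
  rw [Finset.sum_sigma', Finset.sum_sigma']
  refine Finset.sum_bij' (fun a _ => ⟨insert a.2 a.1, a.2⟩) (fun a _ => ⟨a.1.erase a.2, a.2⟩)
    ?_ ?_ ?_ ?_ ?_
  · rintro ⟨I, j⟩ h
    simp only [Finset.mem_sigma, Finset.mem_powersetCard, Finset.mem_sdiff] at h ⊢
    exact ⟨⟨Finset.insert_subset h.2.1 h.1.1, by rw [Finset.card_insert_of_notMem h.2.2, h.1.2]⟩,
      Finset.mem_insert_self _ _⟩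
  · rintro ⟨J, j⟩ h
    simp only [Finset.mem_sigma, Finset.mem_powersetCard, Finset.mem_sdiff] at h ⊢
    exact ⟨⟨(Finset.erase_subset _ _).trans h.1.1, by rw [Finset.card_erase_of_mem h.2, h.1.2]; rfl⟩,
      h.1.1 h.2, Finset.notMem_erase _ _⟩
  · rintro ⟨I, j⟩ h
    simp only [Finset.mem_sigma, Finset.mem_sdiff] at h
    simp [Finset.erase_insert h.2.2]
  · rintro ⟨J, j⟩ h
    simp only [Finset.mem_sigma] at h
    simp [Finset.insert_erase h.2]
  · rintro ⟨I, j⟩ h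
    simp only [Finset.mem_sigma, Finset.mem_sdiff] at h
    simp [Finset.erase_insert h.2.2]

theorem sum_powersetCard_insert {U : Finset α} {w : α} (hw : w ∉ U) (k : ℕ) (H : Finset α → M) :
    ∑ J ∈ (insert w U).powersetCard k, H J
      = ∑ J ∈ U.powersetCard k, H J + ∑ I ∈ predSubsets U k, H (insert w I) := by
  cases k with
  | zero =>
    have : predSubsets U 0 = ∅ := by ext I; simp [mem_predSubsets]
    simp [this]
  | succ k =>
    rw [Finset.powersetCard_succ_insert hw, Finset.sum_union, Finset.sum_image, predSubsets_succ]
    · intro I hI J hJ h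
      have hI' := fun h => hw ((Finset.mem_powersetCard.1 hI).1 h)
      have hJ' := fun h => hw ((Finset.mem_powersetCard.1 hJ).1 h)
      rw [← Finset.erase_insert hI', h, Finset.erase_insert hJ']
    · rw [Finset.disjoint_left]
      intro I hI hJ
      obtain ⟨J, _, rfl⟩ := Finset.mem_image.1 hJ
      exact hw ((Finset.mem_powersetCard.1 hI).1 (Finset.mem_insert_self _ _))

theorem sum_sum_predSubsets (U : Finset α) (k : ℕ) (G : Finset α → α → M) :
    ∑ j ∈ U, ∑ I ∈ predSubsets (U.erase j) k, G I j
      = ∑ J ∈ U.powersetCard k, ∑ j ∈ J, G (J.erase j) j := by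
  rw [Finset.sum_sigma', Finset.sum_sigma']
  refine Finset.sum_bij' (fun a _ => ⟨insert a.1 a.2, a.1⟩) (fun a _ => ⟨a.2, a.1.erase a.2⟩)
    ?_ ?_ ?_ ?_ ?_
  · rintro ⟨j, I⟩ h
    simp only [Finset.mem_sigma, Finset.mem_powersetCard, mem_predSubsets] at h ⊢
    exact ⟨⟨Finset.insert_subset h.1 (h.2.1.trans (Finset.erase_subset _ _)), by
      rw [Finset.card_insert_of_notMem fun h' => Finset.notMem_erase _ _ (h.2.1 h'), h.2.2]⟩,
      Finset.mem_insert_self _ _⟩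
  · rintro ⟨J, j⟩ h
    simp only [Finset.mem_sigma, Finset.mem_powersetCard, mem_predSubsets] at h ⊢
    exact ⟨h.1.1 h.2, Finset.erase_subset_erase _ h.1.1, by
      rw [Finset.card_erase_add_one h.2, h.1.2]⟩
  · rintro ⟨j, I⟩ h
    simp only [Finset.mem_sigma, mem_predSubsets] at h
    simp [Finset.erase_insert fun h' => Finset.notMem_erase _ _ (h.2.1 h')]
  · rintro ⟨J, j⟩ h
    simp only [Finset.mem_sigma] at h
    simp [Finset.insert_erase h.2]
  · rintro ⟨j, I⟩ h
    simp only [Finset.mem_sigma, mem_predSubsets] at h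
    simp [Finset.erase_insert fun h' => Finset.notMem_erase _ _ (h.2.1 h')]

theorem sum_sum_powersetCard_erase (U : Finset α) (k : ℕ) (G : Finset α → α → M) :
    ∑ j ∈ U, ∑ I ∈ (U.erase j).powersetCard k, G I j
      = ∑ J ∈ U.powersetCard (k + 1), ∑ j ∈ J, G (J.erase j) j := by
  simp only [← predSubsets_succ]
  rw [sum_sum_predSubsets, predSubsets_succ]

theorem sdiff_erase_of_mem {U J : Finset α} {j : α} (hJ : J ⊆ U) (hj : j ∈ J) :
    U \ J.erase j = insert j (U \ J) := by
  rw [Finset.sdiff_erase (hJ hj)]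

theorem erase_sdiff_erase {U J : Finset α} {j : α} (hj : j ∈ J) :
    U.erase j \ J.erase j = U \ J := by
  ext a
  simp only [Finset.mem_sdiff, Finset.mem_erase]
  grind

end Subsets

section Blocks

variable (f : ℂ → ℂ) (t : ℂ)

/-- The exchange factor between two groups of variables. -/
def cross (I V : Finset ℂ) : ℂ := ∏ u ∈ I, ∏ y ∈ V, f (u - y - t) / f (u - y)

/-- Distribute `k` of the variables `U` to a new site; the others go to `F`. -/
def blkSum (Δ : ℂ → ℂ) (q : ℂ) (k : ℕ) (x : ℂ) (F : Finset ℂ → ℂ) (U : Finset ℂ) : ℂ :=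
  ∑ I ∈ U.powersetCard k,
    (∏ u ∈ I, Δ u * f (x + u - q) / f (u - q)) * cross f t I (U \ I) * F (U \ I)

/-- The action of the diagonal operator with spectral parameter `w` on a Bethe vector. -/
def dAct (Δ : ℂ → ℂ) (x w : ℂ) (F : Finset ℂ → ℂ) (U : Finset ℂ) : ℂ :=
  f x * Δ w * (∏ u ∈ U, f (w - u - t) / f (w - u)) * F U
    + ∑ j ∈ U, f t * f (x - w + j) / f (w - j) * Δ j
      * (∏ u ∈ U.erase j, f (j - u - t) / f (j - u)) * F (insert w (U.erase j))

variable {f t}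

theorem cross_insert_left {w : ℂ} {I : Finset ℂ} (hw : w ∉ I) (V : Finset ℂ) :
    cross f t (insert w I) V = (∏ y ∈ V, f (w - y - t) / f (w - y)) * cross f t I V :=
  Finset.prod_insert hw

theorem cross_erase_left {w : ℂ} {I : Finset ℂ} (hw : w ∈ I) (V : Finset ℂ) :
    cross f t I V = (∏ y ∈ V, f (w - y - t) / f (w - y)) * cross f t (I.erase w) V :=
  (Finset.mul_prod_erase _ _ hw).symm

theorem cross_insert_right {w : ℂ} {V : Finset ℂ} (hw : w ∉ V) (I : Finset ℂ) :
    cross f t I (insert w V) = (∏ u ∈ I, f (u - w - t) / f (u - w)) * cross f t I V := by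
  simp only [cross, Finset.prod_insert hw, Finset.prod_mul_distrib]

theorem blkSum_zero (Δ : ℂ → ℂ) (q x : ℂ) (F : Finset ℂ → ℂ) (U : Finset ℂ) :
    blkSum f t Δ q 0 x F U = F U := by
  simp [blkSum, cross]

theorem blkSum_insert (hf : SigmaLike f) (Δ : ℂ → ℂ) (q x w : ℂ) (k : ℕ) (F : Finset ℂ → ℂ)
    (U : Finset ℂ) (hU : ∀ u ∈ U, ∀ v ∈ U, u ≠ v → f (u - v) ≠ 0) (hw : ∀ u ∈ U, f (w - u) ≠ 0)
    (hq : ∀ u ∈ U, f (u - q) ≠ 0) (hwq : f (w - q) ≠ 0) (hx : f x ≠ 0) :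
    f (w - q + (k + 1) * t) * f (x + (k + 1) * t) / (f (w - q) * f x)
        * blkSum f t Δ q (k + 1) (x + k * t) (fun V => F (insert w V)) U
      + f (x + w - q + (k + 1) * t) / (f (w - q) * f x)
        * blkSum f t Δ q k (x + (k + 1) * t) (dAct f t Δ x w F) U
      = blkSum f t Δ q (k + 1) (x + (k + 1) * t) F (insert w U) := by
  have hwU : w ∉ U := fun h => hf.ne_of_map_sub_ne_zero (hw w h) rfl
  have e1 : ∀ a u : ℂ, x + a + u - q = x + u - q + a := fun a u => by ring
  have hR : blkSum f t Δ q (k + 1) (x + (k + 1) * t) F (insert w U) =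
      ∑ J ∈ U.powersetCard (k + 1), (∏ u ∈ J, Δ u * f (x + u - q + (k + 1) * t) / f (u - q))
          * ((∏ u ∈ J, f (u - w - t) / f (u - w)) * cross f t J (U \ J)) * F (insert w (U \ J))
      + f (x + w - q + (k + 1) * t) / (f (w - q) * f x) *
        ∑ I ∈ U.powersetCard k, (∏ u ∈ I, Δ u * f (x + u - q + (k + 1) * t) / f (u - q))
          * cross f t I (U \ I) * (f x * Δ w * (∏ u ∈ U \ I, f (w - u - t) / f (w - u)) * F (U \ I)) := by
    rw [blkSum, sum_powersetCard_insert hwU, predSubsets_succ, Finset.mul_sum]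
    simp only [e1]
    congr 1
    · refine Finset.sum_congr rfl fun J hJ => ?_
      have hJU := (Finset.mem_powersetCard.1 hJ).1
      rw [Finset.insert_sdiff_of_notMem _ fun h => hwU (hJU h),
        cross_insert_right fun h => hwU (Finset.mem_sdiff.1 h).1]
    · refine Finset.sum_congr rfl fun I hI => ?_
      have hIU := (Finset.mem_powersetCard.1 hI).1
      have hwI : w ∉ I := fun h => hwU (hIU h)
      rw [Finset.insert_sdiff_insert, Finset.sdiff_insert_of_notMem hwU, cross_insert_left hwI,
        Finset.prod_insert hwI]
      field_simp
  have hD : blkSum f t Δ q k (x + (k + 1) * t) (dAct f t Δ x w F) U =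
      ∑ I ∈ U.powersetCard k, (∏ u ∈ I, Δ u * f (x + u - q + (k + 1) * t) / f (u - q))
          * cross f t I (U \ I) * (f x * Δ w * (∏ u ∈ U \ I, f (w - u - t) / f (w - u)) * F (U \ I))
      + ∑ J ∈ U.powersetCard (k + 1), ∑ j ∈ J,
        (∏ u ∈ J.erase j, Δ u * f (x + u - q + (k + 1) * t) / f (u - q))
          * ((∏ u ∈ J.erase j, f (u - j - t) / f (u - j)) * cross f t J (U \ J))
          * (f t * f (x - w + j) / f (w - j) * Δ j * F (insert w (U \ J))) := by
    simp only [blkSum, dAct, mul_add, Finset.sum_add_distrib, Finset.mul_sum, e1]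
    congr 1
    rw [sum_powersetCard_sdiff]
    refine Finset.sum_congr rfl fun J hJ => Finset.sum_congr rfl fun j hj => ?_
    have hJU := (Finset.mem_powersetCard.1 hJ).1
    have hjV : j ∉ U \ J := fun h => (Finset.mem_sdiff.1 h).2 hj
    rw [sdiff_erase_of_mem hJU hj, Finset.erase_insert hjV, cross_insert_right hjV,
      cross_erase_left hj]
    ring
  rw [hR, hD, blkSum]
  simp only [e1]
  rw [mul_add, ← add_assoc, add_right_comm]
  congr 1
  rw [Finset.mul_sum, Finset.mul_sum, ← Finset.sum_add_distrib]
  refine Finset.sum_congr rfl fun J hJ => ?_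
  obtain ⟨hJU, hJc⟩ := Finset.mem_powersetCard.1 hJ
  have h := hf.sum_step_b hx J t w x q (fun u hu v hv => hU u (hJU hu) v (hJU hv))
    fun u hu => hw u (hJU hu)
  simp only [hJc, Nat.cast_add, Nat.cast_one, add_sub_cancel_right] at h
  have hj : ∀ j ∈ J, (∏ u ∈ J.erase j, Δ u * f (x + u - q + (k + 1) * t) / f (u - q))
          * ((∏ u ∈ J.erase j, f (u - j - t) / f (u - j)) * cross f t J (U \ J))
          * (f t * f (x - w + j) / f (w - j) * Δ j * F (insert w (U \ J)))
      = ((∏ u ∈ J, Δ u / f (u - q)) * cross f t J (U \ J) * F (insert w (U \ J))) *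
        (f t * f (x - w + j) / f (w - j) * f (j - q)
        * ∏ u ∈ J.erase j, f (u - j - t) / f (u - j) * f (x + u - q + (k + 1) * t)) := by
    intro j hj
    have h1 : ∏ u ∈ J.erase j, Δ u * f (x + u - q + (k + 1) * t) / f (u - q)
        = (∏ u ∈ J.erase j, Δ u / f (u - q)) * ∏ u ∈ J.erase j, f (x + u - q + (k + 1) * t) := by
      rw [← Finset.prod_mul_distrib]
      exact Finset.prod_congr rfl fun u _ => by ring
    rw [h1, ← Finset.mul_prod_erase J (fun u => Δ u / f (u - q)) hj, Finset.prod_mul_distrib]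
    have h2 : Δ j / f (j - q) * f (j - q) = Δ j := div_mul_cancel₀ _ (hq j (hJU hj))
    generalize f (j - q) = g at h2 ⊢
    generalize f t * f (x - w + j) / f (w - j) = E
    linear_combination (-((∏ u ∈ J.erase j, Δ u / f (u - q))
      * (∏ u ∈ J.erase j, f (x + u - q + (k + 1) * t))
      * (∏ u ∈ J.erase j, f (u - j - t) / f (u - j)) * cross f t J (U \ J) * E
      * F (insert w (U \ J)))) * h2
  rw [Finset.sum_congr rfl hj, ← Finset.mul_sum]
  have h1 : ∀ a : ℂ, ∏ u ∈ J, Δ u * f (x + u - q + a) / f (u - q)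
      = (∏ u ∈ J, Δ u / f (u - q)) * ∏ u ∈ J, f (x + u - q + a) := fun a => by
    rw [← Finset.prod_mul_distrib]
    exact Finset.prod_congr rfl fun u _ => by ring
  rw [h1, h1]
  rw [Finset.prod_mul_distrib (s := J) (f := fun u => f (u - w - t) / f (u - w))] at h
  generalize ∑ j ∈ J, f t * f (x - w + j) / f (w - j) * f (j - q)
        * ∏ u ∈ J.erase j, f (u - j - t) / f (u - j) * f (x + u - q + (k + 1) * t) = S at h ⊢
  rw [div_mul_eq_mul_div, div_mul_eq_mul_div, ← add_div, div_eq_iff (mul_ne_zero hwq hx)]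
  linear_combination ((∏ u ∈ J, Δ u / f (u - q)) * cross f t J (U \ J) * F (insert w (U \ J))) * h

end Blocks

section Blocks

variable {f : ℂ → ℂ} {t : ℂ}

theorem prod_block_add (Δ : ℂ → ℂ) (q x a : ℂ) (I : Finset ℂ) :
    ∏ u ∈ I, Δ u * f (x + u - q + a) / f (u - q)
      = (∏ u ∈ I, Δ u / f (u - q)) * ∏ u ∈ I, f (x + u - q + a) := by
  rw [← Finset.prod_mul_distrib]
  exact Finset.prod_congr rfl fun u _ => by ring

theorem prod_sdiff_mul_prod {U J : Finset ℂ} (hJ : J ⊆ U) (g : ℂ → ℂ) :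
    (∏ u ∈ U \ J, g u) * ∏ u ∈ J, g u = ∏ u ∈ U, g u := Finset.prod_sdiff hJ

theorem prod_erase_eq {U J : Finset ℂ} {j : ℂ} (hJ : J ⊆ U) (hj : j ∈ J) (g : ℂ → ℂ) :
    ∏ u ∈ U.erase j, g u = (∏ u ∈ U \ J, g u) * ∏ u ∈ J.erase j, g u := by
  rw [← Finset.prod_sdiff (Finset.erase_subset_erase j hJ), erase_sdiff_erase hj]

theorem blkSum_dAct (Δ : ℂ → ℂ) (q x X w : ℂ) (k : ℕ) (F : Finset ℂ → ℂ)
    (U : Finset ℂ) :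
    blkSum f t Δ q k X (dAct f t Δ x w F) U =
      ∑ I ∈ U.powersetCard k, (∏ u ∈ I, Δ u * f (X + u - q) / f (u - q))
          * cross f t I (U \ I) * (f x * Δ w * (∏ u ∈ U \ I, f (w - u - t) / f (w - u)) * F (U \ I))
      + ∑ J ∈ U.powersetCard (k + 1), ∑ j ∈ J,
        (∏ u ∈ J.erase j, Δ u * f (X + u - q) / f (u - q))
          * ((∏ u ∈ J.erase j, f (u - j - t) / f (u - j)) * cross f t J (U \ J))
          * (f t * f (x - w + j) / f (w - j) * Δ j * F (insert w (U \ J))) := by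
  simp only [blkSum, dAct, mul_add, Finset.sum_add_distrib, Finset.mul_sum]
  congr 1
  rw [sum_powersetCard_sdiff]
  refine Finset.sum_congr rfl fun J hJ => Finset.sum_congr rfl fun j hj => ?_
  have hJU := (Finset.mem_powersetCard.1 hJ).1
  have hjV : j ∉ U \ J := fun h => (Finset.mem_sdiff.1 h).2 hj
  rw [sdiff_erase_of_mem hJU hj, Finset.erase_insert hjV, cross_insert_right hjV,
    cross_erase_left hj]
  ring

theorem dAct_blkSum_expand (Δ Δ' : ℂ → ℂ) (q x X w : ℂ) (k : ℕ) (F : Finset ℂ → ℂ)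
    (U : Finset ℂ) (hwU : w ∉ U) :
    dAct f t Δ' x w (blkSum f t Δ q k X F) U =
      ∑ J ∈ U.powersetCard k, (f x * Δ' w * (∏ u ∈ J, f (w - u - t) / f (w - u))
          * (∏ u ∈ J, Δ u * f (X + u - q) / f (u - q))
          + ∑ j ∈ J, f t * f (x - w + j) / f (w - j) * Δ' j
            * (∏ u ∈ J.erase j, f (j - u - t) / f (j - u)) * (Δ w * f (X + w - q) / f (w - q))
            * ∏ u ∈ J.erase j, Δ u * f (X + u - q) / f (u - q))
          * ((∏ u ∈ U \ J, f (w - u - t) / f (w - u)) * cross f t J (U \ J) * F (U \ J))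
      + ∑ J ∈ U.powersetCard (k + 1), (∑ j ∈ J, f t * f (x - w + j) / f (w - j) * Δ' j
            * (∏ u ∈ J.erase j, f (j - u - t) / f (j - u))
            * (∏ u ∈ J.erase j, f (u - w - t) / f (u - w))
            * ∏ u ∈ J.erase j, Δ u * f (X + u - q) / f (u - q))
          * (cross f t J (U \ J) * F (insert w (U \ J))) := by
  have hexp : ∀ j, blkSum f t Δ q k X F (insert w (U.erase j)) =
      ∑ I ∈ (U.erase j).powersetCard k, (∏ u ∈ I, Δ u * f (X + u - q) / f (u - q))
        * ((∏ u ∈ I, f (u - w - t) / f (u - w)) * cross f t I (U.erase j \ I))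
        * F (insert w (U.erase j \ I))
      + ∑ I ∈ predSubsets (U.erase j) k, (Δ w * f (X + w - q) / f (w - q))
        * (∏ u ∈ I, Δ u * f (X + u - q) / f (u - q))
        * ((∏ u ∈ U.erase j \ I, f (w - u - t) / f (w - u)) * cross f t I (U.erase j \ I))
        * F (U.erase j \ I) := by
    intro j
    have hw' : w ∉ U.erase j := fun h => hwU (Finset.mem_of_mem_erase h)
    rw [blkSum, sum_powersetCard_insert hw']
    congr 1
    · refine Finset.sum_congr rfl fun J hJ => ?_
      have hJU := (Finset.mem_powersetCard.1 hJ).1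
      rw [Finset.insert_sdiff_of_notMem _ fun h => hw' (hJU h),
        cross_insert_right fun h => hw' (Finset.mem_sdiff.1 h).1]
    · refine Finset.sum_congr rfl fun I hI => ?_
      have hIU := (mem_predSubsets.1 hI).1
      have hwI : w ∉ I := fun h => hw' (hIU h)
      rw [Finset.insert_sdiff_insert, Finset.sdiff_insert_of_notMem hw', cross_insert_left hwI,
        Finset.prod_insert hwI]
  rw [dAct]
  simp only [hexp, mul_add, Finset.sum_add_distrib, Finset.mul_sum]
  rw [sum_sum_powersetCard_erase U k (fun I j => f t * f (x - w + j) / f (w - j) * Δ' j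
      * (∏ u ∈ U.erase j, f (j - u - t) / f (j - u))
      * ((∏ u ∈ I, Δ u * f (X + u - q) / f (u - q))
        * ((∏ u ∈ I, f (u - w - t) / f (u - w)) * cross f t I (U.erase j \ I))
        * F (insert w (U.erase j \ I)))),
    sum_sum_predSubsets U k (fun I j => f t * f (x - w + j) / f (w - j) * Δ' j
      * (∏ u ∈ U.erase j, f (j - u - t) / f (j - u))
      * ((Δ w * f (X + w - q) / f (w - q))
        * (∏ u ∈ I, Δ u * f (X + u - q) / f (u - q))
        * ((∏ u ∈ U.erase j \ I, f (w - u - t) / f (w - u)) * cross f t I (U.erase j \ I))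
        * F (U.erase j \ I))), add_comm (∑ J ∈ U.powersetCard (k + 1), _), ← add_assoc]
  rw [blkSum, Finset.mul_sum, ← Finset.sum_add_distrib]
  congr 1
  · refine Finset.sum_congr rfl fun J hJ => ?_
    obtain ⟨hJU, hJc⟩ := Finset.mem_powersetCard.1 hJ
    rw [add_mul, Finset.sum_mul]
    congr 1
    · rw [← prod_sdiff_mul_prod hJU]
      ring
    · refine Finset.sum_congr rfl fun j hj => ?_
      rw [prod_erase_eq hJU hj, erase_sdiff_erase hj, cross_erase_left hj]
      ring
  · refine Finset.sum_congr rfl fun J hJ => ?_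
    obtain ⟨hJU, hJc⟩ := Finset.mem_powersetCard.1 hJ
    rw [Finset.sum_mul]
    refine Finset.sum_congr rfl fun j hj => ?_
    rw [prod_erase_eq hJU hj, erase_sdiff_erase hj, cross_erase_left hj]
    ring

theorem block_dAct (hf : SigmaLike f) {c : ℂ} (hc : f c ≠ 0) (Δ : ℂ → ℂ) (p q x w : ℂ) (k : ℕ)
    (J : Finset ℂ) (hJc : J.card = k)
    (hU : ∀ u ∈ J, ∀ v ∈ J, u ≠ v → f (u - v) ≠ 0) (hw : ∀ u ∈ J, f (w - u) ≠ 0) :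
    f (x - (q - p) + 2 * k * t) * (Δ w * (f (w - p) / f (w - q)))
        * (∏ u ∈ J, f (w - u - t) / f (w - u))
        * (∏ u ∈ J, Δ u * f (x + u - q + k * t) / f (u - q))
      + ∑ j ∈ J, f t * f (x - (q - p) + 2 * k * t - w + j) / f (w - j)
        * (Δ j * (f (j - p) / f (j - q)))
        * (∏ u ∈ J.erase j, f (j - u - t) / f (j - u))
        * (Δ w * f (x + w - q + k * t) / f (w - q))
        * (∏ u ∈ J.erase j, Δ u * f (x + u - q + k * t) / f (u - q))
    = f (w - p - k * t) * f (x - (q - p) + k * t) / f (w - q)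
        * (∏ u ∈ J, Δ u * f (x + u - q + (k + 1) * t) / f (u - q)) * Δ w := by
  have h := hf.sum_step_d hc J t w x p q hU hw
  simp only [hJc] at h
  have hj : ∀ j ∈ J, f t * f (x - (q - p) + 2 * k * t - w + j) / f (w - j)
          * (Δ j * (f (j - p) / f (j - q)))
          * (∏ u ∈ J.erase j, f (j - u - t) / f (j - u))
          * (Δ w * f (x + w - q + k * t) / f (w - q))
          * (∏ u ∈ J.erase j, Δ u * f (x + u - q + k * t) / f (u - q)) =
      (∏ u ∈ J, Δ u / f (u - q)) * (Δ w * f (x + w - q + k * t) / f (w - q)) *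
      (f t * f (x - (q - p) + 2 * k * t - w + j) / f (w - j) * f (j - p)
        * ∏ u ∈ J.erase j, f (j - u - t) / f (j - u) * f (x + u - q + k * t)) := by
    intro j hj
    rw [prod_block_add, ← Finset.mul_prod_erase J (fun u => Δ u / f (u - q)) hj,
      Finset.prod_mul_distrib]
    ring
  rw [Finset.sum_congr rfl hj, ← Finset.mul_sum]
  rw [prod_block_add, prod_block_add]
  rw [Finset.prod_mul_distrib (s := J) (f := fun u => f (w - u - t) / f (w - u))] at h
  generalize ∑ j ∈ J, f t * f (x - (q - p) + 2 * k * t - w + j) / f (w - j) * f (j - p)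
        * ∏ u ∈ J.erase j, f (j - u - t) / f (j - u) * f (x + u - q + k * t) = S at h ⊢
  generalize ∏ u ∈ J, Δ u / f (u - q) = P
  generalize ∏ u ∈ J, f (x + u - q + (k + 1) * t) = X₁ at h ⊢
  generalize ∏ u ∈ J, f (x + u - q + k * t) = X₀ at h ⊢
  generalize ∏ u ∈ J, f (w - u - t) / f (w - u) = W at h ⊢
  linear_combination (-(P * Δ w / f (w - q))) * h

theorem dAct_blkSum (hf : SigmaLike f) (Δ Δ' : ℂ → ℂ) (p q x w : ℂ) (k : ℕ) (F : Finset ℂ → ℂ)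
    (U : Finset ℂ) (hΔ : ∀ u, Δ' u = Δ u * (f (u - p) / f (u - q)))
    (hU : ∀ u ∈ U, ∀ v ∈ U, u ≠ v → f (u - v) ≠ 0) (hw : ∀ u ∈ U, f (w - u) ≠ 0)
    (hq : ∀ u ∈ U, f (u - q) ≠ 0) (hwq : f (w - q) ≠ 0) (hx : f x ≠ 0) :
    f (w - p - k * t) * f (x - (q - p) + k * t) / (f (w - q) * f x)
        * blkSum f t Δ q k (x + (k + 1) * t) (dAct f t Δ x w F) U
      + f (x + p - w + k * t) * f (q - p - k * t) * f ((k + 1) * t) / (f (w - q) * f x)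
        * blkSum f t Δ q (k + 1) (x + k * t) (fun V => F (insert w V)) U
      = dAct f t Δ' (x - (q - p) + 2 * k * t) w (blkSum f t Δ q k (x + k * t) F) U := by
  have hwU : w ∉ U := fun h => hf.ne_of_map_sub_ne_zero (hw w h) rfl
  have e1 : ∀ a u : ℂ, x + a + u - q = x + u - q + a := fun a u => by ring
  rw [blkSum_dAct, dAct_blkSum_expand _ _ _ _ _ _ _ _ _ hwU]
  simp only [blkSum, e1, hΔ]
  rw [mul_add, add_assoc]
  congr 1
  · rw [Finset.mul_sum]
    refine Finset.sum_congr rfl fun J hJ => ?_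
    obtain ⟨hJU, hJc⟩ := Finset.mem_powersetCard.1 hJ
    rw [block_dAct hf hx Δ p q x w k J hJc (fun u hu v hv => hU u (hJU hu) v (hJU hv))
      (fun u hu => hw u (hJU hu)), mul_comm (f (w - q)) (f x), ← div_div,
      div_right_comm _ (f x)]
    generalize f (w - p - k * t) * f (x - (q - p) + k * t) / f (w - q) = E
    generalize ∏ u ∈ J, Δ u * f (x + u - q + (k + 1) * t) / f (u - q) = P
    field_simp
  · rw [Finset.mul_sum, Finset.mul_sum, ← Finset.sum_add_distrib]
    refine Finset.sum_congr rfl fun J hJ => ?_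
    obtain ⟨hJU, hJc⟩ := Finset.mem_powersetCard.1 hJ
    have h := hf.sum_step_c hx J t w x p q k hJc (fun u hu v hv => hU u (hJU hu) v (hJU hv))
      fun u hu => hw u (hJU hu)
    have hj : ∀ j ∈ J, f t * f (x - (q - p) + 2 * k * t - w + j) / f (w - j)
            * (Δ j * (f (j - p) / f (j - q)))
            * (∏ u ∈ J.erase j, f (j - u - t) / f (j - u))
            * (∏ u ∈ J.erase j, f (u - w - t) / f (u - w))
            * (∏ u ∈ J.erase j, Δ u * f (x + u - q + k * t) / f (u - q)) =
        (∏ u ∈ J, Δ u / f (u - q)) *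
        (f t * f (x - (q - p) + 2 * k * t - w + j) / f (w - j) * f (j - p)
        * ∏ u ∈ J.erase j, f (j - u - t) / f (j - u) * f (x + u - q + k * t)
          * (f (u - w - t) / f (u - w))) := by
      intro j hj
      rw [prod_block_add, ← Finset.mul_prod_erase J (fun u => Δ u / f (u - q)) hj,
        Finset.prod_mul_distrib, Finset.prod_mul_distrib]
      ring
    have hj' : ∀ j ∈ J, (∏ u ∈ J.erase j, Δ u * f (x + u - q + (k + 1) * t) / f (u - q))
          * ((∏ u ∈ J.erase j, f (u - j - t) / f (u - j)) * cross f t J (U \ J))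
          * (f t * f (x - w + j) / f (w - j) * Δ j * F (insert w (U \ J))) =
        ((∏ u ∈ J, Δ u / f (u - q)) * (cross f t J (U \ J) * F (insert w (U \ J)))) *
        (f t * f (x - w + j) / f (w - j) * f (j - q)
          * ∏ u ∈ J.erase j, f (u - j - t) / f (u - j) * f (x + u - q + (k + 1) * t)) := by
      intro j hj
      rw [prod_block_add, ← Finset.mul_prod_erase J (fun u => Δ u / f (u - q)) hj,
        Finset.prod_mul_distrib]
      have h2 : Δ j / f (j - q) * f (j - q) = Δ j := div_mul_cancel₀ _ (hq j (hJU hj))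
      generalize f (j - q) = g at h2 ⊢
      generalize f t * f (x - w + j) / f (w - j) = E
      linear_combination (-((∏ u ∈ J.erase j, Δ u / f (u - q))
        * (∏ u ∈ J.erase j, f (x + u - q + (k + 1) * t))
        * (∏ u ∈ J.erase j, f (u - j - t) / f (u - j)) * cross f t J (U \ J) * E
        * F (insert w (U \ J)))) * h2
    rw [Finset.sum_congr rfl hj, ← Finset.mul_sum, Finset.sum_congr rfl hj', ← Finset.mul_sum,
      prod_block_add]
    generalize ∑ j ∈ J, f t * f (x - (q - p) + 2 * k * t - w + j) / f (w - j) * f (j - p)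
        * ∏ u ∈ J.erase j, f (j - u - t) / f (j - u) * f (x + u - q + k * t)
          * (f (u - w - t) / f (u - w)) = S at h ⊢
    generalize ∑ j ∈ J, f t * f (x - w + j) / f (w - j) * f (j - q)
          * ∏ u ∈ J.erase j, f (u - j - t) / f (u - j) * f (x + u - q + (k + 1) * t) = S' at h ⊢
    generalize ∏ u ∈ J, Δ u / f (u - q) = P
    generalize ∏ u ∈ J, f (x + u - q + k * t) = X₀ at h ⊢
    rw [div_mul_eq_mul_div, div_mul_eq_mul_div, ← add_div, div_eq_iff (mul_ne_zero hwq hx)]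
    linear_combination P * (cross f t J (U \ J) * F (insert w (U \ J))) * h

/-- The quotient of `dAct` by `f x`; for `U = ∅` the division is carried out. -/
def dActN (f : ℂ → ℂ) (t : ℂ) (Δ : ℂ → ℂ) (x w : ℂ) (F : Finset ℂ → ℂ) (U : Finset ℂ) : ℂ :=
  Δ w * (∏ u ∈ U, f (w - u - t) / f (w - u)) * F U
    + (∑ j ∈ U, f t * f (x - w + j) / f (w - j) * Δ j
      * (∏ u ∈ U.erase j, f (j - u - t) / f (j - u)) * F (insert w (U.erase j))) / f x

theorem dAct_eq_mul_dActN {Δ : ℂ → ℂ} {x : ℂ} (hx : f x ≠ 0) (w : ℂ) (F : Finset ℂ → ℂ)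
    (U : Finset ℂ) : dAct f t Δ x w F U = f x * dActN f t Δ x w F U := by
  rw [dAct, dActN, mul_add, mul_div_cancel₀ _ hx]
  ring

theorem blkSum_dActN {Δ : ℂ → ℂ} {x : ℂ} (hx : f x ≠ 0) (q X w : ℂ) (k : ℕ) (F : Finset ℂ → ℂ)
    (U : Finset ℂ) :
    blkSum f t Δ q k X (dAct f t Δ x w F) U = f x * blkSum f t Δ q k X (dActN f t Δ x w F) U := by
  simp only [blkSum, dAct_eq_mul_dActN hx, Finset.mul_sum]
  exact Finset.sum_congr rfl fun I _ => by ring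

theorem blkSum_card (Δ : ℂ → ℂ) (q x : ℂ) (F : Finset ℂ → ℂ) {k : ℕ} {U : Finset ℂ}
    (hk : U.card = k) :
    blkSum f t Δ q k x F U = (∏ u ∈ U, Δ u * f (x + u - q) / f (u - q)) * F ∅ := by
  rw [blkSum, ← hk, Finset.powersetCard_self, Finset.sum_singleton, sdiff_self]
  simp [cross]

theorem blkSum_of_card_lt (Δ : ℂ → ℂ) (q x : ℂ) (F : Finset ℂ → ℂ) {k : ℕ} {U : Finset ℂ}
    (hk : U.card < k) : blkSum f t Δ q k x F U = 0 := by
  rw [blkSum, Finset.powersetCard_eq_empty.2 hk, Finset.sum_empty]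

theorem blkSum_insert_dActN (hf : SigmaLike f) (Δ : ℂ → ℂ) (q x w : ℂ) (k : ℕ)
    (F : Finset ℂ → ℂ) (U : Finset ℂ) (hk : k ≤ U.card)
    (hU : ∀ u ∈ U, ∀ v ∈ U, u ≠ v → f (u - v) ≠ 0)
    (hw : ∀ u ∈ U, f (w - u) ≠ 0) (hq : ∀ u ∈ U, f (u - q) ≠ 0) (hwq : f (w - q) ≠ 0)
    (hx : k < U.card → f x ≠ 0) :
    f (w - q + (k + 1) * t) * f (x + (k + 1) * t) / (f (w - q) * f x)
        * blkSum f t Δ q (k + 1) (x + k * t) (fun V => F (insert w V)) U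
      + f (x + w - q + (k + 1) * t) / f (w - q)
        * blkSum f t Δ q k (x + (k + 1) * t) (dActN f t Δ x w F) U
      = blkSum f t Δ q (k + 1) (x + (k + 1) * t) F (insert w U) := by
  rcases hk.lt_or_eq with h | h
  · have hx' := hx h
    rw [← blkSum_insert hf Δ q x w k F U hU hw hq hwq hx', blkSum_dActN hx']
    field_simp
  · have hwU : w ∉ U := fun h => hf.ne_of_map_sub_ne_zero (hw w h) rfl
    rw [blkSum_of_card_lt _ _ _ _ (by omega), blkSum_card _ _ _ _ h.symm,
      blkSum_card _ _ _ _ (by rw [Finset.card_insert_of_notMem hwU, h]), Finset.prod_insert hwU,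
      dActN]
    have e : x + (k + 1) * t + w - q = x + w - q + (k + 1) * t := by ring
    simp only [Finset.prod_empty, Finset.sum_empty, e]
    ring

theorem dActN_blkSum (hf : SigmaLike f) (ht : f t ≠ 0) (Δ Δ' : ℂ → ℂ) (p q x w : ℂ) (k : ℕ)
    (F : Finset ℂ → ℂ) (U : Finset ℂ) (hk : k ≤ U.card)
    (hΔ : ∀ u, Δ' u = Δ u * (f (u - p) / f (u - q)))
    (hU : ∀ u ∈ U, ∀ v ∈ U, u ≠ v → f (u - v) ≠ 0) (hw : ∀ u ∈ U, f (w - u) ≠ 0)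
    (hq : ∀ u ∈ U, f (u - q) ≠ 0) (hwq : f (w - q) ≠ 0) (hx : k < U.card → f x ≠ 0) :
    f (w - p - k * t) * f (x - (q - p) + k * t) / f (w - q)
        * blkSum f t Δ q k (x + (k + 1) * t) (dActN f t Δ x w F) U
      + f (x + p - w + k * t) * f (q - p - k * t) * f ((k + 1) * t) / (f (w - q) * f x)
        * blkSum f t Δ q (k + 1) (x + k * t) (fun V => F (insert w V)) U
      = dAct f t Δ' (x - (q - p) + 2 * k * t) w (blkSum f t Δ q k (x + k * t) F) U := by
  rcases hk.lt_or_eq with h | h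
  · have hx' := hx h
    rw [← dAct_blkSum hf Δ Δ' p q x w k F U hΔ hU hw hq hwq hx', blkSum_dActN hx']
    field_simp
  · have hwU : w ∉ U := fun h => hf.ne_of_map_sub_ne_zero (hw w h) rfl
    have e1 : ∀ a u : ℂ, x + a + u - q = x + u - q + a := fun a u => by ring
    rw [blkSum_of_card_lt _ _ _ _ (by omega : U.card < k + 1), blkSum_card _ _ _ _ h.symm,
      dAct_blkSum_expand _ _ _ _ _ _ _ _ _ hwU,
      Finset.powersetCard_eq_empty.2 (by omega : U.card < k + 1), Finset.sum_empty]
    have h2 : Finset.powersetCard k U = {U} := by rw [h, Finset.powersetCard_self]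
    rw [h2, Finset.sum_singleton]
    simp only [e1, hΔ]
    rw [block_dAct hf ht Δ p q x w k U h.symm hU hw]
    simp [dActN, cross]
    ring

end Blocks

section Sites

/-- The coefficient of `e_k` in `a(lam, w) e_k`, with step `t = 2 η`. -/
def coefA (f : ℂ → ℂ) (t q lam w : ℂ) (k : ℕ) : ℂ :=
  f (w - q + k * t) * f (lam + k * t) / (f (w - q) * f lam)

/-- The coefficient of `e_{k+1}` in `b(lam, w) e_k`. -/
def coefB (f : ℂ → ℂ) (t q lam w : ℂ) (k : ℕ) : ℂ :=
  -(f (lam + w - q + (k + 1) * t) * f t / (f (w - q) * f lam))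

/-- The coefficient of `e_k` in `c(lam, w) e_{k+1}`. -/
def coefC (f : ℂ → ℂ) (t p q lam w : ℂ) (k : ℕ) : ℂ :=
  -(f (lam + p - w + k * t) * f (q - p - k * t) * f ((k + 1) * t) / (f (w - q) * f lam * f t))

/-- The coefficient of `e_k` in `d(lam, w) e_k`. -/
def coefD (f : ℂ → ℂ) (t p q lam w : ℂ) (k : ℕ) : ℂ :=
  f (w - p - k * t) * f (lam - (q - p) + k * t) / (f (w - q) * f lam)

variable {f : ℂ → ℂ} (η : ℂ) (z Λ : ℕ → ℂ)

/-- The dynamical parameter seen by the factor `V_n`. -/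
def dynPar (n : ℕ) (lam : ℂ) (ν : Occ) : ℂ := lam - 2 * η * prefixWeight Λ n ν

theorem dynPar_eq (n : ℕ) (lam : ℂ) (ν : Occ) :
    dynPar η Λ n lam ν = lam - 2 * η * LamSum Λ n + 2 * (2 * η) * (numBelow ν n : ℂ) := by
  simp only [dynPar, prefixWeight, LamSum, numBelow, Finset.sum_sub_distrib, ← Finset.mul_sum,
    Nat.cast_sum]
  ring

theorem numBelow_update (ν : Occ) {n l : ℕ} (h : n ≤ l) (k : ℕ) :
    numBelow (ν.update l k) n = numBelow ν n := by
  refine Finset.sum_congr rfl fun i hi => ?_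
  have : i ≠ l := by have := Finset.mem_range.1 hi; omega
  simp [Function.update, this]

theorem numBelow_succ (ν : Occ) (n : ℕ) : numBelow ν (n + 1) = numBelow ν n + ν n :=
  Finset.sum_range_succ _ _

theorem dynPar_update (n : ℕ) (lam : ℂ) (ν : Occ) (k : ℕ) :
    dynPar η Λ n lam (ν.update n k) = dynPar η Λ n lam ν := by
  rw [dynPar_eq, dynPar_eq, numBelow_update _ le_rfl]

variable {η z Λ}

theorem siteMat_basisVec_zero_zero (hf : SigmaLike f) (n : ℕ) (lam w : ℂ) (ν : Occ) :
    siteMat f η z Λ n lam w 0 0 (basisVec ν)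
      = coefA f (2 * η) (qPt η z Λ n) (dynPar η Λ n lam ν) w (ν n) • basisVec ν := by
  have hup : ν.update n (ν n) = ν := by simp
  have e1 : z n - w + (Λ n + 1 - 2 * (ν n : ℕ)) * η = -(w - qPt η z Λ n + (ν n : ℕ) * (2 * η)) := by
    rw [qPt]; ring
  have e2 : z n - w + (Λ n + 1) * η = -(w - qPt η z Λ n) := by rw [qPt]; ring
  have e3 : ∀ x : ℂ, x + 2 * (ν n : ℕ) * η = x + (ν n : ℕ) * (2 * η) := fun x => by ring
  have e5 : siteMat f η z Λ n lam w 0 0 (basisVec ν) = Finsupp.single (ν.update n (ν n))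
      (f (z n - w + (Λ n + 1 - 2 * (ν n : ℕ)) * η) / f (z n - w + (Λ n + 1) * η)
      * (f (dynPar η Λ n lam ν + 2 * (ν n : ℕ) * η) / f (dynPar η Λ n lam ν))) := by
    simp [siteMat, evalMat, evalA, basisVec, dynPar, Finsupp.mapDomain_single,
      -Finsupp.single_mul, -Finsupp.single_neg]
  rw [e5, e1, e2, e3, hf.odd, hf.odd, neg_div_neg_eq, div_mul_div_comm, hup]
  simp only [basisVec, coefA, Finsupp.smul_single, smul_eq_mul, mul_one]

theorem siteMat_basisVec_zero_one (hf : SigmaLike f) (n : ℕ) (lam w : ℂ) (ν : Occ) :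
    siteMat f η z Λ n lam w 0 1 (basisVec ν)
      = coefB f (2 * η) (qPt η z Λ n) (dynPar η Λ n lam ν) w (ν n)
        • basisVec (ν.update n (ν n + 1)) := by
  have e1 : ∀ x : ℂ, -x + z n - w + (Λ n - 1 - 2 * (ν n : ℕ)) * η
      = -(x + w - qPt η z Λ n + ((ν n : ℕ) + 1) * (2 * η)) := by
    intro x; rw [qPt]; ring
  have e2 : z n - w + (Λ n + 1) * η = -(w - qPt η z Λ n) := by rw [qPt]; ring
  have e5 : siteMat f η z Λ n lam w 0 1 (basisVec ν) = Finsupp.single (ν.update n (ν n + 1))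
      (-(f (-(dynPar η Λ n lam ν) + z n - w + (Λ n - 1 - 2 * (ν n : ℕ)) * η)
        / f (z n - w + (Λ n + 1) * η)) * (f (2 * η) / f (dynPar η Λ n lam ν))) := by
    simp [siteMat, evalMat, evalB, basisVec, dynPar, Finsupp.mapDomain_single,
      -Finsupp.single_mul, -Finsupp.single_neg]
  rw [e5, e1, e2, hf.odd, hf.odd, neg_div_neg_eq, neg_mul, div_mul_div_comm]
  simp only [basisVec, coefB, Finsupp.smul_single, smul_eq_mul, mul_one]

theorem siteMat_basisVec_one_zero (hf : SigmaLike f) (n : ℕ) (lam w : ℂ) (ν : Occ) :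
    siteMat f η z Λ n lam w 1 0 (basisVec ν)
      = if ν n = 0 then 0 else
        coefC f (2 * η) (pPt η z Λ n) (qPt η z Λ n) (dynPar η Λ n lam ν) w (ν n - 1)
        • basisVec (ν.update n (ν n - 1)) := by
  by_cases h0 : ν n = 0
  · simp [siteMat, evalMat, evalC, basisVec, h0]
  obtain ⟨k, hk⟩ := Nat.exists_eq_succ_of_ne_zero h0
  have e1 : ∀ x : ℂ, -x - z n + w + (Λ n + 1 - 2 * ((k : ℂ) + 1)) * η
      = -(x + pPt η z Λ n - w + k * (2 * η)) := by
    intro x; rw [pPt]; ring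
  have e2 : z n - w + (Λ n + 1) * η = -(w - qPt η z Λ n) := by rw [qPt]; ring
  have e3 : 2 * (Λ n + 1 - ((k : ℂ) + 1)) * η = qPt η z Λ n - pPt η z Λ n - k * (2 * η) := by
    rw [qPt, pPt]; ring
  have e4 : 2 * ((k : ℂ) + 1) * η = (k + 1) * (2 * η) := by ring
  have e5 : siteMat f η z Λ n lam w 1 0 (basisVec ν) = Finsupp.single (ν.update n k)
      (-(f (-(dynPar η Λ n lam ν) - z n + w + (Λ n + 1 - 2 * ((k : ℂ) + 1)) * η)
        / f (z n - w + (Λ n + 1) * η)) * (f (2 * (Λ n + 1 - ((k : ℂ) + 1)) * η)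
        / f (dynPar η Λ n lam ν)) * (f (2 * ((k : ℂ) + 1) * η) / f (2 * η))) := by
    simp [siteMat, evalMat, evalC, basisVec, hk, dynPar, Finsupp.mapDomain_single,
      -Finsupp.single_mul, -Finsupp.single_neg]
  rw [e5, if_neg h0, e1, e2, e3, e4, hf.odd, hf.odd, neg_div_neg_eq, hk]
  simp only [Nat.succ_eq_add_one, Nat.add_sub_cancel, basisVec, coefC, Finsupp.smul_single,
    smul_eq_mul, mul_one]
  congr 1
  rw [neg_mul, neg_mul, div_mul_div_comm, div_mul_div_comm]

theorem siteMat_basisVec_one_one (hf : SigmaLike f) (n : ℕ) (lam w : ℂ) (ν : Occ) :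
    siteMat f η z Λ n lam w 1 1 (basisVec ν)
      = coefD f (2 * η) (pPt η z Λ n) (qPt η z Λ n) (dynPar η Λ n lam ν) w (ν n)
        • basisVec ν := by
  have hup : ν.update n (ν n) = ν := by simp
  have e1 : z n - w + (-Λ n + 1 + 2 * (ν n : ℕ)) * η = -(w - pPt η z Λ n - (ν n : ℕ) * (2 * η)) := by
    rw [pPt]; ring
  have e2 : z n - w + (Λ n + 1) * η = -(w - qPt η z Λ n) := by rw [qPt]; ring
  have e3 : ∀ x : ℂ, x - 2 * (Λ n - (ν n : ℕ)) * η
      = x - (qPt η z Λ n - pPt η z Λ n) + (ν n : ℕ) * (2 * η) := fun x => by rw [qPt, pPt]; ring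
  have e5 : siteMat f η z Λ n lam w 1 1 (basisVec ν) = Finsupp.single (ν.update n (ν n))
      (f (z n - w + (-Λ n + 1 + 2 * (ν n : ℕ)) * η) / f (z n - w + (Λ n + 1) * η)
      * (f (dynPar η Λ n lam ν - 2 * (Λ n - (ν n : ℕ)) * η) / f (dynPar η Λ n lam ν))) := by
    simp [siteMat, evalMat, evalD, basisVec, dynPar, Finsupp.mapDomain_single,
      -Finsupp.single_mul, -Finsupp.single_neg]
  rw [e5, e1, e2, e3, hf.odd, hf.odd, neg_div_neg_eq, div_mul_div_comm, hup]
  simp only [basisVec, coefD, Finsupp.smul_single, smul_eq_mul, mul_one]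

theorem update_update (m : Occ) (n k l : ℕ) : (m.update n k).update n l = m.update n l := by
  ext i
  by_cases h : i = n <;> simp [Function.update, h]

theorem update_apply_self (m : Occ) (n k : ℕ) : m.update n k n = k := by simp

theorem siteMat_apply_zero_zero (hf : SigmaLike f) (n : ℕ) (lam w : ℂ) (x : Fock) (ν : Occ) :
    siteMat f η z Λ n lam w 0 0 x ν
      = coefA f (2 * η) (qPt η z Λ n) (dynPar η Λ n lam ν) w (ν n) * x ν := by
  induction x using Finsupp.induction_linear with
  | zero => simp
  | add x y hx hy => simp [hx, hy, mul_add]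
  | single m c =>
    rw [← mul_one c, ← smul_eq_mul, ← Finsupp.smul_single, ← basisVec, map_smul,
      siteMat_basisVec_zero_zero hf]
    by_cases h : m = ν
    · subst h; simp [basisVec, mul_comm]
    · simp [basisVec, h]

theorem siteMat_apply_one_one (hf : SigmaLike f) (n : ℕ) (lam w : ℂ) (x : Fock) (ν : Occ) :
    siteMat f η z Λ n lam w 1 1 x ν
      = coefD f (2 * η) (pPt η z Λ n) (qPt η z Λ n) (dynPar η Λ n lam ν) w (ν n) * x ν := by
  induction x using Finsupp.induction_linear with
  | zero => simp
  | add x y hx hy => simp [hx, hy, mul_add]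
  | single m c =>
    rw [← mul_one c, ← smul_eq_mul, ← Finsupp.smul_single, ← basisVec, map_smul,
      siteMat_basisVec_one_one hf]
    by_cases h : m = ν
    · subst h; simp [basisVec, mul_comm]
    · simp [basisVec, h]

theorem siteMat_apply_zero_one (hf : SigmaLike f) (n : ℕ) (lam w : ℂ) (x : Fock) (ν : Occ) :
    siteMat f η z Λ n lam w 0 1 x ν
      = if ν n = 0 then 0 else
        coefB f (2 * η) (qPt η z Λ n) (dynPar η Λ n lam ν) w (ν n - 1)
          * x (ν.update n (ν n - 1)) := by
  induction x using Finsupp.induction_linear with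
  | zero => simp
  | add x y hx hy => rw [map_add, Finsupp.add_apply, hx, hy]; split_ifs <;> simp [mul_add]
  | single m c =>
    rw [← mul_one c, ← smul_eq_mul, ← Finsupp.smul_single, ← basisVec, map_smul,
      siteMat_basisVec_zero_one hf]
    by_cases h : m.update n (m n + 1) = ν
    · subst h
      simp only [update_apply_self, dynPar_update, update_update, Nat.add_sub_cancel]
      simp [basisVec, mul_comm]
    · split_ifs with h0
      · simp [basisVec, h]
      · have h4 : m ≠ ν.update n (ν n - 1) := by
          rintro rfl
          refine h ?_
          rw [update_update, update_apply_self, Nat.sub_add_cancel (Nat.pos_of_ne_zero h0)]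
          simp
        simp [basisVec, h, h4]

theorem siteMat_apply_one_zero (hf : SigmaLike f) (n : ℕ) (lam w : ℂ) (x : Fock) (ν : Occ) :
    siteMat f η z Λ n lam w 1 0 x ν
      = coefC f (2 * η) (pPt η z Λ n) (qPt η z Λ n) (dynPar η Λ n lam ν) w (ν n)
          * x (ν.update n (ν n + 1)) := by
  induction x using Finsupp.induction_linear with
  | zero => simp
  | add x y hx hy => rw [map_add, Finsupp.add_apply, hx, hy]; simp [mul_add]
  | single m c =>
    rw [← mul_one c, ← smul_eq_mul, ← Finsupp.smul_single, ← basisVec, map_smul,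
      siteMat_basisVec_one_zero hf]
    by_cases h : m = ν.update n (ν n + 1)
    · subst h
      simp only [update_apply_self, dynPar_update, update_update, Nat.add_sub_cancel]
      simp [basisVec, mul_comm]
    · split_ifs with h0
      · simp [basisVec, h]
      · have h4 : m.update n (m n - 1) ≠ ν := by
          rintro rfl
          refine h ?_
          rw [update_update, update_apply_self, Nat.sub_add_cancel (Nat.pos_of_ne_zero h0)]
          simp
        simp [basisVec, h, h4]

end Sites

section Rows

variable (f : ℂ → ℂ) (η : ℂ) (z Λ : ℕ → ℂ) (lam w : ℂ)

/-- The action of the rows of the monodromy matrix on functions of the occupation numbers: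
`rowBD n g ν` consists of the coefficients of `E_ν` in `b(lam, w) x` and `d(lam, w) x`, where
`x = ∑ g(κ) E_κ`. -/
def rowBD : ℕ → (Occ → ℂ) → Occ → ℂ × ℂ
  | 0, g, ν => (0, g ν)
  | n + 1, g, ν =>
    (coefA f (2 * η) (qPt η z Λ n) (dynPar η Λ n lam ν) w (ν n) * (rowBD n g ν).1
      + if ν n = 0 then 0 else
        coefB f (2 * η) (qPt η z Λ n) (dynPar η Λ n lam ν) w (ν n - 1)
          * (rowBD n g (ν.update n (ν n - 1))).2,
    coefC f (2 * η) (pPt η z Λ n) (qPt η z Λ n) (dynPar η Λ n lam ν) w (ν n)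
        * (rowBD n g (ν.update n (ν n + 1))).1
      + coefD f (2 * η) (pPt η z Λ n) (qPt η z Λ n) (dynPar η Λ n lam ν) w (ν n)
        * (rowBD n g ν).2)

variable {f η z Λ lam w}

theorem monodromy_apply_eq_rowBD (hf : SigmaLike f) (n : ℕ) (x : Fock) (ν : Occ) :
    (monodromy f η z Λ n lam w 0 1 x ν, monodromy f η z Λ n lam w 1 1 x ν)
      = rowBD f η z Λ lam w n x ν := by
  induction n generalizing ν with
  | zero => simp [monodromy, rowBD]
  | succ n ih =>
    simp only [monodromy, Matrix.mul_apply, Fin.sum_univ_two, LinearMap.add_apply,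
      Module.End.mul_apply, Finsupp.add_apply, siteMat_apply_zero_zero hf,
      siteMat_apply_zero_one hf, siteMat_apply_one_zero hf, siteMat_apply_one_one hf, rowBD,
      ← ih]

theorem update_congr_ge {κ ν : Occ} {n k : ℕ} (h : ∀ i, n ≤ i → κ i = ν.update n k i) :
    κ n = k ∧ ∀ i, n + 1 ≤ i → κ i = ν i := by
  refine ⟨by simp [h n le_rfl], fun i hi => ?_⟩
  rw [h i (by omega)]
  simp [Function.update, show i ≠ n by omega]

/-- Locality and linearity of `rowBD`. -/
theorem rowBD_congr_sum {ι : Type*} (s : Finset ι) (c : ι → ℂ) (h : ι → Occ → ℂ) (n : ℕ)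
    (g : Occ → ℂ) (ν : Occ) :
    ((∀ κ : Occ, (∀ i, n ≤ i → κ i = ν i) → numBelow κ n + 1 = numBelow ν n →
        g κ = ∑ i ∈ s, c i * h i κ) →
      (rowBD f η z Λ lam w n g ν).1 = ∑ i ∈ s, c i * (rowBD f η z Λ lam w n (h i) ν).1) ∧
    ((∀ κ : Occ, (∀ i, n ≤ i → κ i = ν i) → numBelow κ n = numBelow ν n →
        g κ = ∑ i ∈ s, c i * h i κ) →
      (rowBD f η z Λ lam w n g ν).2 = ∑ i ∈ s, c i * (rowBD f η z Λ lam w n (h i) ν).2) := by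
  induction n generalizing ν with
  | zero => exact ⟨fun _ => by simp [rowBD], fun H => by simpa [rowBD] using H ν (by simp) rfl⟩
  | succ n ih =>
    refine ⟨fun H => ?_, fun H => ?_⟩
    · rw [rowBD, (ih ν).1]
      · by_cases h0 : ν n = 0
        · simp only [rowBD, h0, if_true, add_zero, Finset.mul_sum]
          exact Finset.sum_congr rfl fun i _ => by ring
        · rw [if_neg h0, (ih _).2]
          · simp only [rowBD, if_neg h0, Finset.mul_sum, ← Finset.sum_add_distrib]
            exact Finset.sum_congr rfl fun i _ => by ring
          · intro κ hκ hk
            obtain ⟨h1, h2⟩ := update_congr_ge hκ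
            rw [numBelow_update _ le_rfl] at hk
            exact H κ h2 (by rw [numBelow_succ, numBelow_succ]; omega)
      · intro κ hκ hk
        exact H κ (fun i hi => hκ i (by omega))
          (by rw [numBelow_succ, numBelow_succ, hκ n le_rfl]; omega)
    · rw [rowBD, (ih (ν.update n (ν n + 1))).1, (ih ν).2]
      · simp only [rowBD, Finset.mul_sum, ← Finset.sum_add_distrib]
        exact Finset.sum_congr rfl fun i _ => by ring
      · intro κ hκ hk
        exact H κ (fun i hi => hκ i (by omega))
          (by rw [numBelow_succ, numBelow_succ, hκ n le_rfl]; omega)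
      · intro κ hκ hk
        obtain ⟨h1, h2⟩ := update_congr_ge hκ
        rw [numBelow_update _ le_rfl] at hk
        exact H κ h2 (by rw [numBelow_succ, numBelow_succ]; omega)

/-- The rows are finite. -/
theorem exists_rowBD_fst_eq (n : ℕ) (ν : Occ) :
    (∃ r : Occ →₀ ℂ, ∀ g, (rowBD f η z Λ lam w n g ν).1 = r.sum fun κ a => a * g κ) ∧
      ∃ r : Occ →₀ ℂ, ∀ g, (rowBD f η z Λ lam w n g ν).2 = r.sum fun κ a => a * g κ := by
  have hadd : ∀ (a b : ℂ) (r s : Occ →₀ ℂ) (g : Occ → ℂ),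
      (a • r + b • s).sum (fun κ c => c * g κ)
        = a * (r.sum fun κ c => c * g κ) + b * s.sum fun κ c => c * g κ := by
    intro a b r s g
    rw [Finsupp.sum_add_index' (by simp) (by intros; ring), Finsupp.sum_smul_index (by simp),
      Finsupp.sum_smul_index (by simp), Finsupp.mul_sum, Finsupp.mul_sum]
    simp only [mul_assoc]
  induction n generalizing ν with
  | zero => exact ⟨⟨0, by simp [rowBD]⟩, ⟨Finsupp.single ν 1, by simp [rowBD]⟩⟩
  | succ n ih =>
    obtain ⟨r₁, h₁⟩ := (ih ν).1
    obtain ⟨r₂, h₂⟩ := (ih ν).2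
    obtain ⟨r₃, h₃⟩ := (ih (ν.update n (ν n - 1))).2
    obtain ⟨r₄, h₄⟩ := (ih (ν.update n (ν n + 1))).1
    constructor
    · by_cases h0 : ν n = 0
      · exact ⟨_, fun g => by rw [rowBD, if_pos h0, h₁, ← zero_mul (r₃.sum _), ← hadd]⟩
      · exact ⟨_, fun g => by rw [rowBD, if_neg h0, h₁, h₃, ← hadd]⟩
    · exact ⟨_, fun g => by rw [rowBD, h₂, h₄, ← hadd]⟩

/-- The sums that define `B_{ν/μ}` with values on the left are rows of the monodromy matrix. -/
theorem finsum_opB_mul (hf : SigmaLike f) (n : ℕ) (g : Occ → ℂ) (ν : Occ) :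
    ∑ᶠ κ : Occ, opB f η z Λ n lam w (basisVec κ) ν * g κ = (rowBD f η z Λ lam w n g ν).1 := by
  obtain ⟨r, hr⟩ := (exists_rowBD_fst_eq (f := f) (η := η) (z := z) (Λ := Λ) (lam := lam) (w := w)
    n ν).1
  have h1 : ∀ κ, opB f η z Λ n lam w (basisVec κ) ν = r κ := by
    intro κ
    have := congrArg Prod.fst (monodromy_apply_eq_rowBD (η := η) (z := z) (Λ := Λ) (lam := lam)
      (w := w) hf n (basisVec κ) ν)
    rw [opB]
    refine this.trans ?_
    rw [hr, Finsupp.sum]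
    simp only [basisVec, Finsupp.single_apply, mul_ite, mul_one, mul_zero]
    rw [Finset.sum_ite_eq]
    split_ifs with h
    · rfl
    · exact (Finsupp.notMem_support_iff.1 h).symm
  rw [hr, Finsupp.sum]
  simp only [h1]
  refine finsum_eq_sum_of_support_subset _ fun κ hκ => ?_
  simp only [Finset.mem_coe, Finsupp.mem_support_iff]
  exact left_ne_zero_of_mul hκ

theorem opB_basisVec_apply_eq_zero (hf : SigmaLike f) {n i : ℕ} {κ ν : Occ} (hi : n ≤ i)
    (h : κ i ≠ ν i) : opB f η z Λ n lam w (basisVec κ) ν = 0 := by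
  have := congrArg Prod.fst (monodromy_apply_eq_rowBD (η := η) (z := z) (Λ := Λ) (lam := lam)
      (w := w) hf n (basisVec κ) ν)
  refine this.trans ?_
  have h2 := (rowBD_congr_sum (f := f) (η := η) (z := z) (Λ := Λ) (lam := lam) (w := w)
    (∅ : Finset ℕ) (fun _ => 0) (fun _ _ => 0) n (basisVec κ) ν).1
  rw [h2, Finset.sum_empty]
  intro κ' hκ' _
  rw [Finset.sum_empty, basisVec, Finsupp.single_apply, if_neg]
  rintro rfl
  exact h (hκ' i hi)

theorem le_sup_of_apply_ne_zero {ν : Occ} {i : ℕ} (h : ν i ≠ 0) : i ≤ ν.support.sup id :=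
  Finset.le_sup (f := id) (Finsupp.mem_support_iff.2 h)

theorem apply_eq_zero_of_sup_lt {ν : Occ} {i : ℕ} (h : ν.support.sup id < i) : ν i = 0 := by
  by_contra h0
  exact absurd (le_sup_of_apply_ne_zero h0) (by omega)

theorem BOne_eq_opB (hf : SigmaLike f) (ν κ : Occ) :
    BOne f η z Λ lam w ν κ
      = opB f η z Λ (ν.support.sup id + 1) lam w (basisVec κ) ν := by
  rw [BOne, Finset.sup_union]
  rcases le_or_gt (κ.support.sup id) (ν.support.sup id) with h | h
  · rw [sup_eq_left.2 h]
  · rw [sup_eq_right.2 h.le]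
    have hne : κ.support.Nonempty := by
      by_contra h0
      rw [Finset.not_nonempty_iff_eq_empty.1 h0] at h
      simp at h
    obtain ⟨m, hm, hm'⟩ := Finset.exists_mem_eq_sup _ hne id
    have hκ : κ m ≠ 0 := Finsupp.mem_support_iff.1 hm
    rw [hm', id] at h ⊢
    have hν : ν m = 0 := apply_eq_zero_of_sup_lt h
    have hne : κ m ≠ ν m := by rwa [hν]
    rw [opB_basisVec_apply_eq_zero hf (Nat.succ_le_of_lt h) hne]
    have h1 := congrArg Prod.fst (monodromy_apply_eq_rowBD (η := η) (z := z) (Λ := Λ) (lam := lam)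
      (w := w) hf (m + 1) (basisVec κ) ν)
    have h2 := congrArg Prod.fst (monodromy_apply_eq_rowBD (η := η) (z := z) (Λ := Λ) (lam := lam)
      (w := w) hf m (basisVec κ) ν)
    rw [rowBD, ← h2] at h1
    refine h1.trans ?_
    have h3 := opB_basisVec_apply_eq_zero (η := η) (z := z) (Λ := Λ) (lam := lam)
      (w := w) hf le_rfl hne
    rw [opB] at h3
    simp [hν, h3]

/-- The sum over `κ` in the branching rule of `B`. -/
theorem finsum_BOne_mul (hf : SigmaLike f) (g : Occ → ℂ) (ν : Occ) :
    ∑ᶠ κ : Occ, BOne f η z Λ lam w ν κ * g κ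
      = (rowBD f η z Λ lam w (ν.support.sup id + 1) g ν).1 := by
  simp only [BOne_eq_opB hf, finsum_opB_mul hf]

end Rows

section BetheB

theorem blkSum_congr {f : ℂ → ℂ} {t : ℂ} {Δ : ℂ → ℂ} {q x x' : ℂ} {k : ℕ} {F F' : Finset ℂ → ℂ}
    {U : Finset ℂ} (hx : x = x') (hF : ∀ I ⊆ U, I.card = k → F (U \ I) = F' (U \ I)) :
    blkSum f t Δ q k x F U = blkSum f t Δ q k x' F' U := by
  subst hx
  refine Finset.sum_congr rfl fun I hI => ?_
  rw [hF I (Finset.mem_powersetCard.1 hI).1 (Finset.mem_powersetCard.1 hI).2]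

theorem dAct_congr {f : ℂ → ℂ} {t : ℂ} {Δ : ℂ → ℂ} {x x' w : ℂ} {F F' : Finset ℂ → ℂ}
    {U : Finset ℂ} (hx : x = x') (hw : w ∉ U) (hF : ∀ V : Finset ℂ, V.card = U.card → F V = F' V) :
    dAct f t Δ x w F U = dAct f t Δ x' w F' U := by
  subst hx
  rw [dAct, dAct, hF U rfl]
  congr 1
  refine Finset.sum_congr rfl fun j hj => ?_
  rw [hF]
  rw [Finset.card_insert_of_notMem fun h => hw (Finset.mem_of_mem_erase h),
    Finset.card_erase_add_one hj]

variable (f : ℂ → ℂ) (η : ℂ) (z Λ : ℕ → ℂ)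

/-- The factor `∏_{i < n} f(u - p_i) / f(u - q_i)`. -/
def pqRatio (n : ℕ) (u : ℂ) : ℂ :=
  ∏ i ∈ Finset.range n, f (u - pPt η z Λ i) / f (u - qPt η z Λ i)

/-- The sum over the distributions of the variables `U` over the factors `V_0, …, V_{n-1}` that is,
up to normalization, the coefficient of `E_ν` in a product of operators `b`. -/
def betheB (lam : ℂ) : ℕ → Occ → Finset ℂ → ℂ
  | 0, _, U => if U = ∅ then 1 else 0
  | n + 1, ν, U => blkSum f (2 * η) (pqRatio f η z Λ n) (qPt η z Λ n) (ν n)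
      (lam - 2 * η * LamSum Λ n + 2 * (2 * η) * (U.card : ℂ) - ν n * (2 * η)) (betheB lam n ν) U

variable {f η z Λ} {lam w : ℂ}

theorem betheB_congr {n : ℕ} {ν κ : Occ} (h : ∀ i < n, ν i = κ i) :
    betheB f η z Λ lam n ν = betheB f η z Λ lam n κ := by
  induction n with
  | zero => rfl
  | succ n ih =>
    funext U
    rw [betheB, betheB, ih fun i hi => h i (by omega), h n (by omega)]

theorem betheB_update (n k : ℕ) (ν : Occ) :
    betheB f η z Λ lam n (ν.update n k) = betheB f η z Λ lam n ν :=
  betheB_congr fun i hi => by simp [Function.update, show i ≠ n by omega]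

theorem pqRatio_succ (n : ℕ) (u : ℂ) : pqRatio f η z Λ (n + 1) u
    = pqRatio f η z Λ n u * (f (u - pPt η z Λ n) / f (u - qPt η z Λ n)) :=
  Finset.prod_range_succ _ _

theorem coefA_zero {t q : ℂ} (h1 : f (w - q) ≠ 0) (h2 : f lam ≠ 0) : coefA f t q lam w 0 = 1 := by
  rw [coefA]
  simp only [Nat.cast_zero, zero_mul, add_zero]
  exact div_self (mul_ne_zero h1 h2)

theorem rowBD_betheB (hf : SigmaLike f) (ht : f (2 * η) ≠ 0) (hlam : f lam ≠ 0) (Q N n : ℕ)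
    (hn : n ≤ N)
    (hL : ∀ l < N, ∀ p ≤ Q, 1 ≤ l → f (lam - 2 * η * LamSum Λ l + 2 * (2 * η) * (p : ℂ)) ≠ 0)
    (hwq : ∀ l < N, f (w - qPt η z Λ l) ≠ 0) (U : Finset ℂ)
    (hU : ∀ u ∈ U, ∀ v ∈ U, u ≠ v → f (u - v) ≠ 0) (hw : ∀ u ∈ U, f (w - u) ≠ 0)
    (hUq : ∀ l < N, ∀ u ∈ U, f (u - qPt η z Λ l) ≠ 0) (ν : Occ) :
    ((∀ m < n, numBelow ν m ≤ Q) → numBelow ν n = U.card + 1 →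
      (rowBD f η z Λ lam w n (fun κ => betheB f η z Λ (lam + 2 * η) n κ U) ν).1
        = -(f (2 * η) / f lam) * betheB f η z Λ lam n ν (insert w U)) ∧
    (U.card ≤ Q → numBelow ν n = U.card →
      (rowBD f η z Λ lam w n (fun κ => betheB f η z Λ (lam + 2 * η) n κ U) ν).2
        = 1 / f lam * dAct f (2 * η) (pqRatio f η z Λ n)
          (lam - 2 * η * LamSum Λ n + 2 * (2 * η) * (U.card : ℂ)) w
          (betheB f η z Λ lam n ν) U) := by
  induction n generalizing U ν with
  | zero =>
    refine ⟨fun _ h => by simp [numBelow] at h, fun _ h => ?_⟩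
    have h0 : U = ∅ := by
      simp [numBelow] at h
      exact Finset.card_eq_zero.1 h.symm
    subst h0
    simp [rowBD, betheB, dAct, pqRatio, LamSum, hlam]
  | succ n ih =>
    have ih' : ∀ I ⊆ U, ∀ ν, _ := fun I (hI : I ⊆ U) ν => ih (by omega) I
      (fun u hu v hv => hU u (hI hu) v (hI hv)) (fun u hu => hw u (hI hu))
      (fun l hl u hu => hUq l hl u (hI hu)) ν
    have hpar : ∀ p ≤ Q, (n = 0 → p = 0) →
        f (lam - 2 * η * LamSum Λ n + 2 * (2 * η) * (p : ℂ)) ≠ 0 := by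
      intro p hp h0
      rcases Nat.eq_zero_or_pos n with h | h
      · subst h
        rw [h0 rfl]
        simpa [LamSum] using hlam
      · exact hL n (by omega) p hp h
    have hw' : w ∉ U := fun h => hf.ne_of_map_sub_ne_zero (hw w h) rfl
    constructor
    · intro hQ hν
      have hx : f (dynPar η Λ n lam ν) ≠ 0 := by
        rw [dynPar_eq]
        exact hpar _ (hQ n (by omega)) (by rintro rfl; simp [numBelow])
      rw [numBelow_succ] at hν
      have e1 : (numBelow ν n : ℂ) = U.card + 1 - ν n := by
        rw [eq_sub_iff_add_eq]; exact_mod_cast hν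
      -- the first term
      have h1 : (rowBD f η z Λ lam w n (fun κ => betheB f η z Λ (lam + 2 * η) (n + 1) κ U) ν).1
          = -(f (2 * η) / f lam) * blkSum f (2 * η) (pqRatio f η z Λ n) (qPt η z Λ n) (ν n)
            (dynPar η Λ n lam ν + ν n * (2 * η) - 2 * η)
            (fun V => betheB f η z Λ lam n ν (insert w V)) U := by
        rw [(rowBD_congr_sum (U.powersetCard (ν n))
          (fun I => (∏ u ∈ I, pqRatio f η z Λ n u * f (dynPar η Λ n lam ν + ν n * (2 * η) - 2 * η
            + u - qPt η z Λ n) / f (u - qPt η z Λ n)) * cross f (2 * η) I (U \ I))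
          (fun I κ => betheB f η z Λ (lam + 2 * η) n κ (U \ I)) n _ ν).1, blkSum, Finset.mul_sum]
        · refine Finset.sum_congr rfl fun I hI => ?_
          obtain ⟨hIU, hIc⟩ := Finset.mem_powersetCard.1 hI
          have := Finset.card_le_card hIU
          rw [(ih' _ Finset.sdiff_subset _).1 (fun m hm => hQ m (by omega))
            (by rw [Finset.card_sdiff_of_subset hIU]; omega)]
          ring
        · intro κ hκ _
          rw [betheB, hκ n le_rfl, blkSum]
          refine Finset.sum_congr rfl fun I hI => ?_
          congr 4
          funext u
          congr 3
          rw [dynPar_eq, e1]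
          ring
      have hk : ∀ k : ℕ, k + 1 = ν n →
          (rowBD f η z Λ lam w n (fun κ => betheB f η z Λ (lam + 2 * η) (n + 1) κ U)
            (ν.update n k)).2
          = 1 / f lam * blkSum f (2 * η) (pqRatio f η z Λ n) (qPt η z Λ n) k
            (dynPar η Λ n lam ν + (k + 1) * (2 * η))
            (dAct f (2 * η) (pqRatio f η z Λ n) (dynPar η Λ n lam ν) w (betheB f η z Λ lam n ν))
            U := by
        intro k hk
        rw [(rowBD_congr_sum (U.powersetCard k)
          (fun I => (∏ u ∈ I, pqRatio f η z Λ n u * f (dynPar η Λ n lam ν + (k + 1) * (2 * η)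
            + u - qPt η z Λ n) / f (u - qPt η z Λ n)) * cross f (2 * η) I (U \ I))
          (fun I κ => betheB f η z Λ (lam + 2 * η) n κ (U \ I)) n _ _).2, blkSum, Finset.mul_sum]
        · refine Finset.sum_congr rfl fun I hI => ?_
          obtain ⟨hIU, hIc⟩ := Finset.mem_powersetCard.1 hI
          have := Finset.card_le_card hIU
          have hc : numBelow ν n = (U \ I).card := by
            rw [Finset.card_sdiff_of_subset hIU]; omega
          rw [(ih' _ Finset.sdiff_subset _).2 (by rw [← hc]; exact hQ n (by omega))
            (by rw [numBelow_update _ le_rfl, hc]), betheB_update, dynPar_eq, hc]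
          ring
        · intro κ hκ _
          obtain ⟨h2, h3⟩ := update_congr_ge hκ
          rw [betheB, h2, blkSum]
          refine Finset.sum_congr rfl fun I hI => ?_
          congr 4
          funext u
          congr 3
          rw [dynPar_eq, e1, ← hk]
          push_cast
          ring
      rw [rowBD, h1]
      rcases Nat.eq_zero_or_pos (ν n) with h0 | h0
      · rw [if_pos h0, h0, coefA_zero (hwq n (by omega)) hx, blkSum_zero, betheB, h0, blkSum_zero]
        ring
      · obtain ⟨k, hk'⟩ := Nat.exists_eq_add_of_le' h0
        rw [if_neg h0.ne', hk', Nat.add_sub_cancel, hk k hk'.symm]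
        have := blkSum_insert (t := 2 * η) hf (pqRatio f η z Λ n) (qPt η z Λ n)
          (dynPar η Λ n lam ν) w k
          (betheB f η z Λ lam n ν) U hU hw (hUq n (by omega)) (hwq n (by omega)) hx
        rw [betheB, hk', Finset.card_insert_of_notMem hw']
        rw [blkSum_congr (x' := dynPar η Λ n lam ν + k * (2 * η)) (F' := fun V =>
          betheB f η z Λ lam n ν (insert w V)) (by push_cast; ring) (fun _ _ _ => rfl),
          blkSum_congr (U := insert w U) (x' := dynPar η Λ n lam ν + (k + 1) * (2 * η))
            (F' := betheB f η z Λ lam n ν) (by rw [dynPar_eq, e1, hk']; push_cast; ring)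
            (fun _ _ _ => rfl),
          ← this, coefA, coefB]
        push_cast
        ring
    · intro hQ hν
      rw [numBelow_succ] at hν
      have hx : f (dynPar η Λ n lam ν) ≠ 0 := by
        rw [dynPar_eq]
        exact hpar _ (by omega) (by rintro rfl; simp [numBelow])
      have e1 : (numBelow ν n : ℂ) = U.card - ν n := by
        rw [eq_sub_iff_add_eq]; exact_mod_cast hν
      have h1 : (rowBD f η z Λ lam w n (fun κ => betheB f η z Λ (lam + 2 * η) (n + 1) κ U) ν).2
          = 1 / f lam * blkSum f (2 * η) (pqRatio f η z Λ n) (qPt η z Λ n) (ν n)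
            (dynPar η Λ n lam ν + (ν n + 1) * (2 * η))
            (dAct f (2 * η) (pqRatio f η z Λ n) (dynPar η Λ n lam ν) w (betheB f η z Λ lam n ν))
            U := by
        rw [(rowBD_congr_sum (U.powersetCard (ν n))
          (fun I => (∏ u ∈ I, pqRatio f η z Λ n u * f (dynPar η Λ n lam ν + (ν n + 1) * (2 * η)
            + u - qPt η z Λ n) / f (u - qPt η z Λ n)) * cross f (2 * η) I (U \ I))
          (fun I κ => betheB f η z Λ (lam + 2 * η) n κ (U \ I)) n _ _).2, blkSum, Finset.mul_sum]
        · refine Finset.sum_congr rfl fun I hI => ?_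
          obtain ⟨hIU, hIc⟩ := Finset.mem_powersetCard.1 hI
          have := Finset.card_le_card hIU
          have hc : numBelow ν n = (U \ I).card := by
            rw [Finset.card_sdiff_of_subset hIU]; omega
          rw [(ih' _ Finset.sdiff_subset _).2 (by omega) hc, dynPar_eq, hc]
          ring
        · intro κ hκ _
          rw [betheB, hκ n le_rfl, blkSum]
          refine Finset.sum_congr rfl fun I hI => ?_
          congr 4
          funext u
          congr 3
          rw [dynPar_eq, e1]
          ring
      have h2 : (rowBD f η z Λ lam w n (fun κ => betheB f η z Λ (lam + 2 * η) (n + 1) κ U)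
            (ν.update n (ν n + 1))).1
          = -(f (2 * η) / f lam) * blkSum f (2 * η) (pqRatio f η z Λ n) (qPt η z Λ n) (ν n + 1)
            (dynPar η Λ n lam ν + ν n * (2 * η))
            (fun V => betheB f η z Λ lam n ν (insert w V)) U := by
        rw [(rowBD_congr_sum (U.powersetCard (ν n + 1))
          (fun I => (∏ u ∈ I, pqRatio f η z Λ n u * f (dynPar η Λ n lam ν + ν n * (2 * η)
            + u - qPt η z Λ n) / f (u - qPt η z Λ n)) * cross f (2 * η) I (U \ I))
          (fun I κ => betheB f η z Λ (lam + 2 * η) n κ (U \ I)) n _ _).1, blkSum, Finset.mul_sum]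
        · refine Finset.sum_congr rfl fun I hI => ?_
          obtain ⟨hIU, hIc⟩ := Finset.mem_powersetCard.1 hI
          have := Finset.card_le_card hIU
          have hmono : ∀ m < n, numBelow ν m ≤ Q := fun m hm =>
            (Finset.sum_le_sum_of_subset (Finset.range_mono hm.le)).trans
              (show numBelow ν n ≤ Q by omega)
          rw [(ih' _ Finset.sdiff_subset _).1
            (fun m hm => by rw [numBelow_update _ hm.le]; exact hmono m hm)
            (by rw [Finset.card_sdiff_of_subset hIU, numBelow_update _ le_rfl]; omega),
            betheB_update]
          ring
        · intro κ hκ _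
          obtain ⟨h2, h3⟩ := update_congr_ge hκ
          rw [betheB, h2, blkSum]
          refine Finset.sum_congr rfl fun I hI => ?_
          congr 4
          funext u
          congr 3
          rw [dynPar_eq, e1]
          push_cast
          ring
      rw [rowBD, h1, h2]
      have := dAct_blkSum (t := 2 * η) hf (pqRatio f η z Λ n) (pqRatio f η z Λ (n + 1))
        (pPt η z Λ n) (qPt η z Λ n)
        (dynPar η Λ n lam ν) w (ν n)
        (betheB f η z Λ lam n ν) U (pqRatio_succ n) hU hw (hUq n (by omega)) (hwq n (by omega)) hx
      have hqp : 2 * η * Λ n = qPt η z Λ n - pPt η z Λ n := by rw [qPt, pPt]; ring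
      rw [dAct_congr (U := U) (x' := dynPar η Λ n lam ν - (qPt η z Λ n - pPt η z Λ n)
          + 2 * ν n * (2 * η)) (F' := blkSum f (2 * η) (pqRatio f η z Λ n) (qPt η z Λ n) (ν n)
          (dynPar η Λ n lam ν + ν n * (2 * η)) (betheB f η z Λ lam n ν)) ?_ hw' ?_, ← this,
        coefC, coefD]
      · field_simp
        ring
      · rw [dynPar_eq, e1, ← hqp, LamSum, LamSum, Finset.sum_range_succ]
        ring
      · intro V hV
        rw [betheB, hV]
        refine blkSum_congr ?_ fun _ _ _ => rfl
        rw [dynPar_eq, e1]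
        ring

end BetheB

section SkewB

variable {f : ℂ → ℂ} {η : ℂ} {z Λ : ℕ → ℂ} {lam w : ℂ}

theorem len_eq_numBelow {ν : Occ} {n : ℕ} (h : ∀ i, n ≤ i → ν i = 0) : len ν = numBelow ν n := by
  refine Finsupp.sum_of_support_subset _ (fun i hi => ?_) _ (by simp)
  rw [Finset.mem_range]
  by_contra h0
  exact Finsupp.mem_support_iff.1 hi (h i (by omega))

theorem betheB_eq_of_le {ν : Occ} {m n : ℕ} (hmn : m ≤ n) (h : ∀ i, m ≤ i → ν i = 0) :
    betheB f η z Λ lam n ν = betheB f η z Λ lam m ν := by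
  induction n, hmn using Nat.le_induction with
  | base => rfl
  | succ n hn ih =>
    funext U
    rw [betheB, h n hn, blkSum_zero, ih]

theorem sup_le_of_forall {ν : Occ} {m : ℕ} (h : ∀ i, m < i → ν i = 0) :
    ν.support.sup id ≤ m := by
  refine Finset.sup_le fun i hi => ?_
  by_contra h0
  exact Finsupp.mem_support_iff.1 hi (h i (by simpa using h0))

theorem insert_image_tail {M : ℕ} (u : Fin (M + 1) → ℂ) :
    insert (u 0) (Finset.univ.image (Fin.tail u)) = Finset.univ.image u := by
  ext x
  simp [Fin.exists_fin_succ, Fin.tail, eq_comm]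

theorem BSkew_eq_betheB (hf : SigmaLike f) (ht : f (2 * η) ≠ 0) (S M : ℕ) (lam : ℂ)
    (u : Fin M → ℂ) (ν : Occ) (hν : len ν = M) (hS : ν.support.sup id ≤ S)
    (hlam : ∀ k : ℕ, k < M → f (lam + 2 * η * k) ≠ 0)
    (hL : ∀ l k : ℕ, 1 ≤ l → l ≤ S → k + 2 ≤ 2 * M →
        f (lam - 2 * η * LamSum Λ l + 2 * η * k) ≠ 0)
    (hq : ∀ i, ∀ l : ℕ, l ≤ S → f (u i - qPt η z Λ l) ≠ 0)
    (hu : ∀ i j, i ≠ j → f (u i - u j) ≠ 0) :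
    BSkew f η z Λ M lam u ν 0 = (-1) ^ M * f (2 * η) ^ M / (∏ i ∈ Finset.range M, f (lam + 2 * η * i))
      * betheB f η z Λ lam (ν.support.sup id + 1) ν (Finset.univ.image u) := by
  induction M generalizing lam ν with
  | zero =>
    have h0 : ν = 0 := by
      ext i
      by_contra h0
      rw [len, Finsupp.sum, Finset.sum_eq_zero_iff] at hν
      exact h0 (hν i (Finsupp.mem_support_iff.2 h0))
    subst h0
    simp [BSkew, betheB, blkSum_zero]
  | succ M ih =>
    set K := ν.support.sup id with hK
    rw [BSkew, finsum_BOne_mul hf, ← hK]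
    have hν0 : ∀ i, K + 1 ≤ i → ν i = 0 := fun i hi => apply_eq_zero_of_sup_lt (by omega)
    have hνK : ν K ≠ 0 := by
      have hne : ν.support.Nonempty := by
        rw [Finset.nonempty_iff_ne_empty]
        intro h0
        rw [Finsupp.support_eq_empty.1 h0] at hν
        simp [len] at hν
      obtain ⟨m, hm, hm'⟩ := Finset.exists_mem_eq_sup _ hne id
      rw [hK, hm', id]
      exact Finsupp.mem_support_iff.1 hm
    have hlen := len_eq_numBelow hν0
    have key := (rowBD_congr_sum (f := f) (η := η) (z := z) (Λ := Λ) (lam := lam) (w := u 0) {()}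
      (fun _ => (-1) ^ M * f (2 * η) ^ M / (∏ i ∈ Finset.range M, f (lam + 2 * η + 2 * η * i)))
      (fun _ κ => betheB f η z Λ (lam + 2 * η) (K + 1) κ (Finset.univ.image (Fin.tail u)))
      (K + 1) (fun κ => BSkew f η z Λ M (lam + 2 * η) (Fin.tail u) κ 0) ν).1
    rw [key]
    · have h2 := (rowBD_betheB (z := z) (Λ := Λ) (w := u 0) hf ht
        (by simpa using hlam 0 (by omega)) M (K + 1) (K + 1) le_rfl
        (fun l hl p hp h1 => by
          have := hL l (2 * p) h1 (by omega) (by omega)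
          push_cast at this
          convert this using 2
          ring)
        (fun l hl => hq 0 l (by omega)) (Finset.univ.image (Fin.tail u))
        (by
          simp only [Finset.mem_image, Finset.mem_univ, true_and]
          rintro _ ⟨i, rfl⟩ _ ⟨j, rfl⟩ hij
          exact hu _ _ fun h => hij (congrArg u h))
        (by
          simp only [Finset.mem_image, Finset.mem_univ, true_and]
          rintro _ ⟨i, rfl⟩
          exact hu _ _ (Fin.succ_ne_zero i).symm)
        (fun l hl => by
          simp only [Finset.mem_image, Finset.mem_univ, true_and]
          rintro _ ⟨i, rfl⟩
          exact hq _ l (by omega)) ν).1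
        (fun m hm => by
          have h3 : numBelow ν m ≤ numBelow ν K :=
            Finset.sum_le_sum_of_subset (Finset.range_mono (by omega))
          have h4 := numBelow_succ ν K
          omega)
        (by
          rw [← hlen, hν, Finset.card_image_of_injective, Finset.card_univ, Fintype.card_fin]
          intro i j hij
          by_contra h
          refine hu i.succ j.succ (fun h' => h (Fin.succ_injective _ h')) ?_
          have : u i.succ = u j.succ := hij
          rw [this, sub_self, hf.map_zero])
      rw [Finset.sum_singleton, h2, insert_image_tail, Finset.prod_range_succ']
      have h5 : ∏ i ∈ Finset.range M, f (lam + 2 * η + 2 * η * i)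
          = ∏ i ∈ Finset.range M, f (lam + 2 * η * ((i + 1 : ℕ) : ℂ)) :=
        Finset.prod_congr rfl fun i _ => by push_cast; congr 1; ring
      rw [h5]
      simp only [Nat.cast_zero, mul_zero, add_zero]
      rw [pow_succ, pow_succ, ← div_div]
      ring
    · intro κ hκ hκ'
      rw [Finset.sum_singleton]
      have hκ0 : ∀ i, K + 1 ≤ i → κ i = 0 := fun i hi => (hκ i hi).trans (hν0 i hi)
      have hle : κ.support.sup id ≤ K := sup_le_of_forall fun i hi => hκ0 i hi
      rw [ih (lam + 2 * η) (Fin.tail u) κ (by rw [len_eq_numBelow hκ0]; omega) (hle.trans hS)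
        (fun k hk => by
          have := hlam (k + 1) (by omega)
          push_cast at this
          convert this using 2
          ring)
        (fun l k h1 h2 h3 => by
          have := hL l (k + 1) h1 h2 (by omega)
          push_cast at this
          convert this using 2
          ring)
        (fun i l hl => hq _ l hl) (fun i j hij => hu _ _ fun h => hij (Fin.succ_injective _ h))]
      rw [betheB_eq_of_le (ν := κ) (by omega : κ.support.sup id + 1 ≤ K + 1)
        fun i hi => apply_eq_zero_of_sup_lt (by omega)]

end SkewB

section Symmetrization

variable (f : ℂ → ℂ) (t : ℂ) (h : ℕ → ℕ → ℂ → ℂ)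

/-- The sum over the bijections between the positions of a list and a set of variables, built one
position at a time. The weight of a variable `u` at a position with label `a` that is followed by
`r` positions is `h a r u`. -/
def symSum : List ℕ → Finset ℂ → ℂ
  | [], U => if U = ∅ then 1 else 0
  | a :: l, U => ∑ u ∈ U, h a l.length u * (∏ y ∈ U.erase u, f (u - y - t) / f (u - y))
      * symSum l (U.erase u)

variable {f t h}

theorem symSum_replicate_append (hf : SigmaLike f) (ht : f t ≠ 0) {g : ℂ → ℂ} {X : ℂ} {a : ℕ}
    (hh : ∀ r u, h a r u = g u * f (X + u + t + 2 * r * t)) (l : List ℕ) (k : ℕ) (U : Finset ℂ)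
    (hU : ∀ u ∈ U, ∀ v ∈ U, u ≠ v → f (u - v) ≠ 0) :
    symSum f t h (List.replicate k a ++ l) U = (∏ j ∈ Finset.Icc 1 k, f (j * t) / f t)
      * ∑ I ∈ U.powersetCard k, (∏ u ∈ I, g u * f (X + u + k * t + 2 * l.length * t))
        * cross f t I (U \ I) * symSum f t h l (U \ I) := by
  induction k generalizing U with
  | zero => simp [cross]
  | succ k ih =>
    have ih' : ∀ j ∈ U, _ := fun j hj => ih (U.erase j) fun u hu v hv =>
      hU u (Finset.mem_of_mem_erase hu) v (Finset.mem_of_mem_erase hv)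
    rw [List.replicate_succ, List.cons_append, symSum,
      Finset.sum_congr rfl fun j hj => by rw [ih' j hj]]
    simp only [Finset.mul_sum]
    rw [sum_sum_powersetCard_erase U k (fun I j => h a (List.replicate k a ++ l).length j
      * (∏ y ∈ U.erase j, f (j - y - t) / f (j - y)) * ((∏ j ∈ Finset.Icc 1 k, f (j * t) / f t)
      * ((∏ u ∈ I, g u * f (X + u + k * t + 2 * l.length * t))
        * cross f t I (U.erase j \ I) * symSum f t h l (U.erase j \ I))))]
    refine Finset.sum_congr rfl fun J hJ => ?_
    obtain ⟨hJU, hJc⟩ := Finset.mem_powersetCard.1 hJ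
    have hb := hf.sum_block ht J k hJc (X + 2 * l.length * t) fun u hu v hv =>
      hU u (hJU hu) v (hJU hv)
    have hterm : ∀ j ∈ J, h a (List.replicate k a ++ l).length j
        * (∏ y ∈ U.erase j, f (j - y - t) / f (j - y)) * ((∏ j ∈ Finset.Icc 1 k, f (j * t) / f t)
        * ((∏ u ∈ J.erase j, g u * f (X + u + k * t + 2 * l.length * t))
        * cross f t (J.erase j) (U.erase j \ J.erase j)
        * symSum f t h l (U.erase j \ J.erase j)))
        = (∏ j ∈ Finset.Icc 1 k, f (j * t) / f t) * (∏ u ∈ J, g u) * cross f t J (U \ J)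
          * symSum f t h l (U \ J) * (f (X + 2 * l.length * t + j + t + 2 * k * t)
          * ∏ u ∈ J.erase j, f (j - u - t) / f (j - u)
            * f (X + 2 * l.length * t + u + k * t)) := by
      intro j hj
      have e1 : X + j + t + 2 * ((List.replicate k a ++ l).length : ℕ) * t
          = X + 2 * l.length * t + j + t + 2 * k * t := by
        rw [List.length_append, List.length_replicate]; push_cast; ring
      have e2 : ∀ u, X + u + k * t + 2 * l.length * t = X + 2 * l.length * t + u + k * t :=
        fun u => by ring
      rw [prod_erase_eq hJU hj, erase_sdiff_erase hj, hh, e1, ← Finset.mul_prod_erase J g hj,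
        cross_erase_left hj]
      simp only [e2, Finset.prod_mul_distrib]
      ring
    have e3 : ∀ u, X + u + ((k + 1 : ℕ) : ℂ) * t + 2 * l.length * t
        = X + 2 * l.length * t + u + (k + 1) * t := fun u => by push_cast; ring
    rw [Finset.sum_congr rfl hterm, ← Finset.mul_sum, hb, Finset.prod_Icc_succ_top (by omega)]
    simp only [e3, Finset.prod_mul_distrib]
    rw [Nat.cast_add, Nat.cast_one]
    generalize ∏ j ∈ Finset.Icc 1 k, f (j * t) / f t = C
    ring

/-- The weight of a bijection between positions and variables. -/
def symWeight (f : ℂ → ℂ) (t : ℂ) (h : ℕ → ℕ → ℂ → ℂ) (n : ℕ) (a : Fin n → ℕ) (g : Fin n → ℂ) :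
    ℂ :=
  (∏ i : Fin n, ∏ j ∈ Finset.Ioi i, f (g i - g j - t) / f (g i - g j))
    * ∏ i : Fin n, h (a i) (n - 1 - i) (g i)

theorem symWeight_cons (n : ℕ) (a : Fin (n + 1) → ℕ) (u : ℂ) (g : Fin n → ℂ) :
    symWeight f t h (n + 1) a (Fin.cons u g)
      = h (a 0) n u * (∏ j, f (u - g j - t) / f (u - g j)) * symWeight f t h n (Fin.tail a) g := by
  have e : ∀ i : Fin n, n - ((i.succ : Fin (n + 1)) : ℕ) = n - 1 - i := fun i => by
    rw [Fin.val_succ]; omega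
  simp only [symWeight, Fin.prod_univ_succ (n := n), Fin.prod_Ioi_zero, Fin.prod_Ioi_succ,
    Fin.cons_zero, Fin.cons_succ, e, Fin.val_zero, Nat.add_sub_cancel, Nat.sub_zero, Fin.tail]
  ring

theorem symSum_ofFn (n : ℕ) (a : Fin n → ℕ) (U : Finset ℂ) (hU : U.card = n) :
    symSum f t h (List.ofFn a) U
      = ∑ g ∈ (Fintype.piFinset fun _ : Fin n => U).filter Function.Injective,
          symWeight f t h n a g := by
  induction n generalizing U with
  | zero =>
    have : U = ∅ := Finset.card_eq_zero.1 hU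
    subst this
    simp [symSum, symWeight, Function.injective_of_subsingleton]
  | succ n ih =>
    rw [List.ofFn_succ, symSum]
    have h1 : ∀ u ∈ U, h (a 0) (List.ofFn fun i : Fin n => a i.succ).length u
        * (∏ y ∈ U.erase u, f (u - y - t) / f (u - y))
        * symSum f t h (List.ofFn fun i : Fin n => a i.succ) (U.erase u)
        = ∑ g ∈ (Fintype.piFinset fun _ : Fin n => U.erase u).filter Function.Injective,
          symWeight f t h (n + 1) a (Fin.cons u g) := by
      intro u hu
      have hc : (U.erase u).card = n := by rw [Finset.card_erase_of_mem hu, hU]; rfl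
      rw [ih _ _ hc, List.length_ofFn, Finset.mul_sum]
      refine Finset.sum_congr rfl fun g hg => ?_
      obtain ⟨hg1, hg2⟩ := Finset.mem_filter.1 hg
      rw [Fintype.mem_piFinset] at hg1
      have himg : Finset.univ.image g = U.erase u := by
        refine Finset.eq_of_subset_of_card_le (Finset.image_subset_iff.2 fun i _ => hg1 i) ?_
        rw [Finset.card_image_of_injective _ hg2, hc, Finset.card_univ, Fintype.card_fin]
      rw [symWeight_cons, ← himg, Finset.prod_image fun i _ j _ hij => hg2 hij]
      rfl
    rw [Finset.sum_congr rfl h1, Finset.sum_sigma']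
    refine Finset.sum_bij' (fun x _ => Fin.cons x.1 x.2) (fun g _ => ⟨g 0, Fin.tail g⟩)
      ?_ ?_ ?_ ?_ ?_
    · rintro ⟨u, g⟩ hx
      simp only [Finset.mem_sigma, Finset.mem_filter, Fintype.mem_piFinset, Finset.mem_erase]
        at hx ⊢
      refine ⟨fun i => ?_, Fin.cons_injective_iff.2 ⟨?_, hx.2.2⟩⟩
      · refine Fin.cases ?_ (fun i => ?_) i
        · exact hx.1
        · exact (hx.2.1 i).2
      · rintro ⟨i, hi⟩
        exact (hx.2.1 i).1 hi
    · intro g hg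
      simp only [Finset.mem_sigma, Finset.mem_filter, Fintype.mem_piFinset, Finset.mem_erase]
        at hg ⊢
      exact ⟨hg.1 0, fun i => ⟨fun h0 => Fin.succ_ne_zero i (hg.2 h0), hg.1 _⟩,
        fun i j hij => Fin.succ_injective _ (hg.2 hij)⟩
    · rintro ⟨u, g⟩ _
      simp
    · intro g _
      exact Fin.cons_self_tail g
    · rintro ⟨u, g⟩ _
      rfl

theorem sum_equiv_eq_sum_piFinset {ι : Type*} [Fintype ι] [DecidableEq ι] (n : ℕ)
    (hn : Fintype.card ι = n)
    {v : ι → ℂ} (hv : Function.Injective v) (W : (Fin n → ℂ) → ℂ) :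
    ∑ σ : Fin n ≃ ι, W (fun i => v (σ i))
      = ∑ g ∈ (Fintype.piFinset fun _ : Fin n => Finset.univ.image v).filter Function.Injective,
          W g := by
  refine Finset.sum_bij (fun σ _ i => v (σ i)) ?_ ?_ ?_ ?_
  · intro σ _
    simp only [Finset.mem_filter, Fintype.mem_piFinset, Finset.mem_image, Finset.mem_univ, true_and]
    exact ⟨fun i => ⟨_, rfl⟩, hv.comp σ.injective⟩
  · intro σ _ τ _ hστ
    exact Equiv.ext fun i => hv (congrFun hστ i)
  · intro g hg
    simp only [Finset.mem_filter, Fintype.mem_piFinset, Finset.mem_image, Finset.mem_univ, true_and]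
      at hg
    choose c hc using hg.1
    have hinj : Function.Injective c := fun i j hij => hg.2 (by rw [← hc i, ← hc j, hij])
    have hbij : Function.Bijective c :=
      (Fintype.bijective_iff_injective_and_card c).2 ⟨hinj, by rw [hn, Fintype.card_fin]⟩
    exact ⟨Equiv.ofBijective c hbij, Finset.mem_univ _, funext hc⟩
  · intro σ _
    rfl

theorem sum_equiv_symWeight {ι : Type*} [Fintype ι] [DecidableEq ι] (n : ℕ)
    (hn : Fintype.card ι = n) {v : ι → ℂ} (hv : Function.Injective v) (a : Fin n → ℕ) :
    ∑ σ : Fin n ≃ ι, symWeight f t h n a (fun i => v (σ i))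
      = symSum f t h (List.ofFn a) (Finset.univ.image v) := by
  rw [sum_equiv_eq_sum_piFinset n hn hv,
    symSum_ofFn _ _ _ (by rw [Finset.card_image_of_injective _ hv, Finset.card_univ, hn])]

end Symmetrization

section OccLists

/-- The parts smaller than `n` of a signature, in decreasing order. -/
def partList (ν : Occ) : ℕ → List ℕ
  | 0 => []
  | n + 1 => List.replicate (ν n) n ++ partList ν n

theorem length_partList (ν : Occ) (n : ℕ) : (partList ν n).length = numBelow ν n := by
  induction n with
  | zero => rfl
  | succ n ih => rw [partList, List.length_append, List.length_replicate, ih, numBelow_succ]; omega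

theorem lt_of_mem_partList {ν : Occ} {n a : ℕ} (h : a ∈ partList ν n) : a < n := by
  induction n with
  | zero => simp [partList] at h
  | succ n ih =>
    rw [partList, List.mem_append] at h
    rcases h with h | h
    · rw [List.eq_of_mem_replicate h]; omega
    · have := ih h; omega

theorem pairwise_partList (ν : Occ) (n : ℕ) : (partList ν n).Pairwise (· ≥ ·) := by
  induction n with
  | zero => simp [partList]
  | succ n ih =>
    rw [partList, List.pairwise_append]
    refine ⟨List.pairwise_replicate.2 (Or.inr le_rfl), ih, fun a ha b hb => ?_⟩
    rw [List.eq_of_mem_replicate ha]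
    exact (lt_of_mem_partList hb).le

theorem count_partList (ν : Occ) (n a : ℕ) :
    (partList ν n).count a = if a < n then ν a else 0 := by
  induction n with
  | zero => simp [partList]
  | succ n ih =>
    rw [partList, List.count_append, ih, List.count_replicate]
    rcases lt_trichotomy a n with h | h | h
    · simp [h, h.ne', Nat.lt_succ_of_lt h]
    · simp [h]
    · simp [h.ne, show ¬ a < n by omega, show ¬ a < n + 1 by omega]

theorem occ_apply {M : ℕ} (μ : Fin M → ℕ) (a : ℕ) :
    occ μ a = (Finset.univ.filter fun i => μ i = a).card := by
  simp [occ, Finsupp.finsetSum_apply, Finsupp.single_apply]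

theorem count_ofFn_eq_occ {M : ℕ} (μ : Fin M → ℕ) (a : ℕ) : (List.ofFn μ).count a = occ μ a := by
  rw [occ_apply, List.ofFn_eq_map, List.count, List.countP_map, List.countP_eq_length_filter]
  rw [← List.toFinset_card_of_nodup ((List.nodup_finRange M).filter _)]
  congr 1
  ext i
  simp

theorem occ_apply_pos_iff {M : ℕ} (μ : Fin M → ℕ) (a : ℕ) : occ μ a ≠ 0 ↔ ∃ i, μ i = a := by
  rw [occ_apply, Finset.card_ne_zero]
  simp [Finset.Nonempty]

theorem ofFn_eq_partList {M : ℕ} {μ : Fin M → ℕ} (hμ : Antitone μ) {n : ℕ} (hn : ∀ i, μ i < n) :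
    List.ofFn μ = partList (occ μ) n := by
  refine List.Perm.eq_of_pairwise' (r := (· ≥ ·)) ?_ (pairwise_partList _ _) ?_
  · rw [List.pairwise_ofFn]
    exact fun i j hij => hμ hij.le
  · rw [List.perm_iff_count]
    intro a
    rw [count_ofFn_eq_occ, count_partList]
    split_ifs with h
    · rfl
    · by_contra h0
      obtain ⟨i, hi⟩ := (occ_apply_pos_iff μ a).1 h0
      exact h (hi ▸ hn i)

theorem len_occ {M : ℕ} (μ : Fin M → ℕ) : len (occ μ) = M := by
  have : len (occ μ) = ∑ i : Fin M, len (Finsupp.single (μ i) 1) := by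
    rw [occ]
    exact map_sum (Finsupp.liftAddHom fun _ : ℕ => AddMonoidHom.id ℕ) _ _
  rw [this]
  simp [len]

end OccLists

section FormulaB

variable {f : ℂ → ℂ} {η : ℂ} {z Λ : ℕ → ℂ} {lam : ℂ}

/-- The weight of the variable `u` at a position with label `a` that is followed by `r`
positions. -/
def weightB (f : ℂ → ℂ) (η : ℂ) (z Λ : ℕ → ℂ) (lam : ℂ) (a r : ℕ) (u : ℂ) : ℂ :=
  phi f η z Λ a u
    * f (lam - qPt η z Λ a - 2 * η * LamSum Λ a + u + 2 * η + 2 * r * (2 * η))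

theorem betheB_eq_symSum (hf : SigmaLike f) (ht : f (2 * η) ≠ 0) (ν : Occ) (n : ℕ)
    (hν : ∀ i < n, ∀ j : ℕ, 1 ≤ j → j ≤ ν i → f (j * (2 * η)) ≠ 0)
    (U : Finset ℂ) (hc : U.card = numBelow ν n)
    (hU : ∀ u ∈ U, ∀ v ∈ U, u ≠ v → f (u - v) ≠ 0) :
    betheB f η z Λ lam n ν U
      = (∏ i ∈ Finset.range n, ∏ j ∈ Finset.Icc 1 (ν i), f (2 * η) / f (j * (2 * η)))
        * symSum f (2 * η) (weightB f η z Λ lam) (partList ν n) U := by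
  induction n generalizing U with
  | zero => simp [betheB, symSum, partList]
  | succ n ih =>
    rw [numBelow_succ] at hc
    have hone : (∏ j ∈ Finset.Icc 1 (ν n), f (2 * η) / f (j * (2 * η)))
        * ∏ j ∈ Finset.Icc 1 (ν n), f (j * (2 * η)) / f (2 * η) = 1 := by
      rw [← Finset.prod_mul_distrib]
      refine Finset.prod_eq_one fun j hj => ?_
      rw [Finset.mem_Icc] at hj
      exact div_mul_div_cancel₀ (hν n (by omega) j hj.1 hj.2) |>.trans (div_self ht)
    rw [partList, symSum_replicate_append hf ht (g := phi f η z Λ n)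
      (X := lam - qPt η z Λ n - 2 * η * LamSum Λ n) (fun r u => rfl) _ _ _ hU, betheB, blkSum,
      Finset.prod_range_succ, mul_assoc (∏ i ∈ Finset.range n, _),
      ← mul_assoc (∏ j ∈ Finset.Icc 1 (ν n), f (2 * η) / f (j * (2 * η))), hone, one_mul,
      Finset.mul_sum]
    refine Finset.sum_congr rfl fun I hI => ?_
    obtain ⟨hIU, hIc⟩ := Finset.mem_powersetCard.1 hI
    rw [ih (fun i hi => hν i (by omega)) (U \ I)
      (by rw [Finset.card_sdiff_of_subset hIU]; omega)
      fun u hu v hv => hU u (Finset.sdiff_subset hu) v (Finset.sdiff_subset hv)]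
    have h1 : ∀ u ∈ I, pqRatio f η z Λ n u * f (lam - 2 * η * LamSum Λ n
        + 2 * (2 * η) * (U.card : ℂ) - ν n * (2 * η) + u - qPt η z Λ n) / f (u - qPt η z Λ n)
        = phi f η z Λ n u * f (lam - qPt η z Λ n - 2 * η * LamSum Λ n + u + ν n * (2 * η)
          + 2 * (partList ν n).length * (2 * η)) := by
      intro u _
      have e : lam - 2 * η * LamSum Λ n
          + 2 * (2 * η) * (U.card : ℂ) - ν n * (2 * η) + u - qPt η z Λ n
          = lam - qPt η z Λ n - 2 * η * LamSum Λ n + u + ν n * (2 * η)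
          + 2 * (partList ν n).length * (2 * η) := by
        rw [length_partList, hc]; push_cast; ring
      rw [e, phi, pqRatio]
      ring
    rw [Finset.prod_congr rfl h1]
    ring

theorem injective_of_map_sub_ne_zero (hf : SigmaLike f) {ι : Type*} {u : ι → ℂ}
    (hu : ∀ i j, i ≠ j → f (u i - u j) ≠ 0) : Function.Injective u := by
  intro i j hij
  by_contra h
  exact hu i j h (by rw [hij, sub_self, hf.map_zero])

theorem BFun_formula (hf : SigmaLike f) {M : ℕ} {μ : Fin M → ℕ} (hμ : Antitone μ) (u : Fin M → ℂ)
    (hm : ∀ i j : ℕ, 1 ≤ j → j ≤ occ μ i → f (2 * η * j) ≠ 0)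
    (hlam : ∀ k : ℕ, k < M → f (lam + 2 * η * k) ≠ 0)
    (hL : ∀ l k : ℕ, 1 ≤ l → (∃ s, l ≤ μ s) → k + 2 ≤ 2 * M →
        f (lam - 2 * η * LamSum Λ l + 2 * η * k) ≠ 0)
    (hq : ∀ i, ∀ l : ℕ, (∃ s, l ≤ μ s) → f (u i - qPt η z Λ l) ≠ 0)
    (hu : ∀ i j, i ≠ j → f (u i - u j) ≠ 0) :
    BFun f η z Λ M lam u (occ μ) =
        (-1) ^ M * f (2 * η) ^ M / (∏ i ∈ Finset.range M, f (lam + 2 * η * i))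
        * (∏ i ∈ (occ μ).support, ∏ j ∈ Finset.Icc 1 (occ μ i), f (2 * η) / f (2 * η * j))
        * ∑ σ : Equiv.Perm (Fin M),
            (∏ i : Fin M, ∏ j ∈ Finset.Ioi i,
              f (u (σ i) - u (σ j) - 2 * η) / f (u (σ i) - u (σ j)))
            * ∏ i : Fin M, phi f η z Λ (μ i) (u (σ i))
                * f (lam + u (σ i) - qPt η z Λ (μ i) + 2 * η
                    + 4 * η * ((M : ℂ) - ((i : ℕ) + 1 : ℂ)) - 2 * η * LamSum Λ (μ i)) := by
  rcases Nat.eq_zero_or_pos M with h0 | h0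
  · subst h0
    have : occ μ = 0 := by simp [occ]
    simp [BFun, BSkew, this]
  have hM0 : occ μ (μ ⟨0, h0⟩) ≠ 0 := (occ_apply_pos_iff _ _).2 ⟨_, rfl⟩
  have ht : f (2 * η) ≠ 0 := by simpa using hm _ 1 le_rfl (Nat.one_le_iff_ne_zero.2 hM0)
  have hmax : ∀ s, μ s ≤ μ ⟨0, h0⟩ := fun s => hμ (Fin.mk_le_of_le_val (Nat.zero_le _))
  have hsup : (occ μ).support.sup id = μ ⟨0, h0⟩ := by
    refine le_antisymm (sup_le_of_forall fun i hi => ?_) (le_sup_of_apply_ne_zero hM0)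
    by_contra h
    obtain ⟨s, hs⟩ := (occ_apply_pos_iff _ _).1 h
    have := hmax s
    omega
  have hinj := injective_of_map_sub_ne_zero hf hu
  have hzero : ∀ i, μ ⟨0, h0⟩ + 1 ≤ i → occ μ i = 0 := fun i hi =>
    apply_eq_zero_of_sup_lt (by omega)
  rw [BFun, BSkew_eq_betheB hf ht (μ ⟨0, h0⟩) M lam u (occ μ) (len_occ μ) hsup.le hlam
    (fun l k h1 h2 h3 => hL l k h1 ⟨_, h2⟩ h3) (fun i l hl => hq i l ⟨_, hl⟩) hu, hsup,
    betheB_eq_symSum hf ht _ _ ?_ _ ?_ ?_, ← ofFn_eq_partList hμ fun i => Nat.lt_succ_of_le (hmax i),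
    ← sum_equiv_symWeight M (Fintype.card_fin M) hinj, ← mul_assoc]
  · congr 1
    · congr 1
      simp only [mul_comm _ (2 * η)]
      symm
      refine Finset.prod_subset (fun i hi => ?_) fun i _ hi => ?_
      · rw [Finset.mem_range, ← hsup]
        exact Nat.lt_succ_of_le (le_sup_of_apply_ne_zero (Finsupp.mem_support_iff.1 hi))
      · rw [Finsupp.notMem_support_iff.1 hi]
        rfl
    · refine Finset.sum_congr rfl fun σ _ => ?_
      rw [symWeight]
      congr 1
      refine Finset.prod_congr rfl fun i _ => ?_
      rw [weightB]
      congr 2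
      have : ((M - 1 - (i : ℕ) : ℕ) : ℂ) = (M : ℂ) - ((i : ℕ) + 1 : ℂ) := by
        rw [Nat.sub_sub, Nat.cast_sub (by omega)]
        push_cast; ring
      rw [this]
      ring
  · intro i _ j h1 h2
    rw [mul_comm]
    exact hm i j h1 h2
  · rw [Finset.card_image_of_injective _ hinj, Finset.card_univ, Fintype.card_fin,
      ← len_eq_numBelow hzero, len_occ]
  · simp only [Finset.mem_image, Finset.mem_univ, true_and]
    rintro _ ⟨i, rfl⟩ _ ⟨j, rfl⟩ hij
    exact hu _ _ fun h => hij (congrArg u h)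

end FormulaB

section Columns

variable (f : ℂ → ℂ) (η : ℂ) (z Λ : ℕ → ℂ) (w : ℂ)

/-- The action of the columns of the monodromy matrix of the factors `V_s, …, V_{s+r-1}` on
functions of the occupation numbers: `colCD r s x g ν` consists of `∑ g(κ) c_κ` for `∑ c_κ E_κ` the
vectors `c E_ν` and `d E_ν`, where `x` is the dynamical parameter seen by `V_s`. At the right
end the operators are divided by the value of `f` at the dynamical parameter. -/
def colCD : ℕ → ℕ → ℂ → (Occ → ℂ) → Occ → ℂ × ℂ
  | 0, _, x, g, ν => (0, g ν / f x)
  | r + 1, s, x, g, ν =>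
    (coefA f (2 * η) (qPt η z Λ s) x w (ν s)
        * (colCD r (s + 1) (x - 2 * η * Λ s + 2 * (2 * η) * (ν s : ℂ)) g ν).1
      + if ν s = 0 then 0 else
        coefC f (2 * η) (pPt η z Λ s) (qPt η z Λ s) x w (ν s - 1)
          * (colCD r (s + 1) (x - 2 * η * Λ s + 2 * (2 * η) * ((ν s - 1 : ℕ) : ℂ)) g
            (ν.update s (ν s - 1))).2,
    coefB f (2 * η) (qPt η z Λ s) x w (ν s)
        * (colCD r (s + 1) (x - 2 * η * Λ s + 2 * (2 * η) * ((ν s + 1 : ℕ) : ℂ)) g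
          (ν.update s (ν s + 1))).1
      + coefD f (2 * η) (pPt η z Λ s) (qPt η z Λ s) x w (ν s)
        * (colCD r (s + 1) (x - 2 * η * Λ s + 2 * (2 * η) * (ν s : ℂ)) g ν).2)

/-- The number of particles in the factors `V_s, …, V_{s+r-1}`. -/
def numIn (ν : Occ) : ℕ → ℕ → ℕ
  | 0, _ => 0
  | r + 1, s => ν s + numIn ν r (s + 1)

variable {f η z Λ w}

theorem numIn_congr {ν κ : Occ} {r s : ℕ} (h : ∀ i, s ≤ i → ν i = κ i) :
    numIn ν r s = numIn κ r s := by
  induction r generalizing s with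
  | zero => rfl
  | succ r ih => rw [numIn, numIn, h s le_rfl, ih fun i hi => h i (by omega)]

theorem numIn_update (ν : Occ) (r : ℕ) {s i : ℕ} (h : i < s) (k : ℕ) :
    numIn (ν.update i k) r s = numIn ν r s :=
  numIn_congr fun j hj => by simp [Function.update, show j ≠ i by omega]

theorem update_congr_le {κ ν : Occ} {s k : ℕ} (h : ∀ i, i < s + 1 → κ i = ν.update s k i) :
    κ s = k ∧ ∀ i, i < s → κ i = ν i := by
  refine ⟨by simp [h s (by omega)], fun i hi => ?_⟩
  rw [h i (by omega)]
  simp [Function.update, show i ≠ s by omega]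

/-- Locality and linearity of `colCD`. -/
theorem colCD_congr_sum {ι : Type*} (S : Finset ι) (c : ι → ℂ) (h : ι → Occ → ℂ) (r s : ℕ) (x : ℂ)
    (g : Occ → ℂ) (ν : Occ) :
    ((∀ κ : Occ, (∀ i, i < s → κ i = ν i) → (∀ i, s + r ≤ i → κ i = ν i) →
        numIn κ r s + 1 = numIn ν r s → g κ = ∑ i ∈ S, c i * h i κ) →
      (colCD f η z Λ w r s x g ν).1 = ∑ i ∈ S, c i * (colCD f η z Λ w r s x (h i) ν).1) ∧
    ((∀ κ : Occ, (∀ i, i < s → κ i = ν i) → (∀ i, s + r ≤ i → κ i = ν i) →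
        numIn κ r s = numIn ν r s → g κ = ∑ i ∈ S, c i * h i κ) →
      (colCD f η z Λ w r s x g ν).2 = ∑ i ∈ S, c i * (colCD f η z Λ w r s x (h i) ν).2) := by
  induction r generalizing s x ν with
  | zero =>
    refine ⟨fun _ => by simp [colCD], fun H => ?_⟩
    simp only [colCD, H ν (by simp) (by simp) rfl, Finset.sum_div]
    exact Finset.sum_congr rfl fun i _ => by ring
  | succ r ih =>
    have hup : ∀ {κ : Occ} {k : ℕ}, (∀ i, s + 1 + r ≤ i → κ i = ν.update s k i) →
        ∀ i, s + (r + 1) ≤ i → κ i = ν i := by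
      intro κ k hκ i hi
      rw [hκ i (by omega)]
      simp [Function.update, show i ≠ s by omega]
    refine ⟨fun H => ?_, fun H => ?_⟩
    · rw [colCD, (ih (s + 1) _ ν).1]
      · by_cases h0 : ν s = 0
        · simp only [colCD, h0, if_true, add_zero, Finset.mul_sum]
          exact Finset.sum_congr rfl fun i _ => by ring
        · rw [if_neg h0, (ih (s + 1) _ (ν.update s (ν s - 1))).2]
          · simp only [colCD, if_neg h0, Finset.mul_sum, ← Finset.sum_add_distrib]
            exact Finset.sum_congr rfl fun i _ => by ring
          · intro κ hκ hκ' hk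
            obtain ⟨h1, h2⟩ := update_congr_le hκ
            rw [numIn_update _ _ (by omega)] at hk
            exact H κ h2 (hup hκ') (by rw [numIn, numIn]; omega)
      · intro κ hκ hκ' hk
        exact H κ (fun i hi => hκ i (by omega)) (fun i hi => hκ' i (by omega))
          (by rw [numIn, numIn, hκ s (by omega)]; omega)
    · rw [colCD, (ih (s + 1) _ (ν.update s (ν s + 1))).1, (ih (s + 1) _ ν).2]
      · simp only [colCD, Finset.mul_sum, ← Finset.sum_add_distrib]
        exact Finset.sum_congr rfl fun i _ => by ring
      · intro κ hκ hκ' hk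
        exact H κ (fun i hi => hκ i (by omega)) (fun i hi => hκ' i (by omega))
          (by rw [numIn, numIn, hκ s (by omega)]; omega)
      · intro κ hκ hκ' hk
        obtain ⟨h1, h2⟩ := update_congr_le hκ
        rw [numIn_update _ _ (by omega)] at hk
        exact H κ h2 (hup hκ') (by rw [numIn, numIn]; omega)

/-- The monodromy matrix of the factors `V_s, …, V_{s+r-1}`, built from the left. -/
def segMat (f : ℂ → ℂ) (η : ℂ) (z Λ : ℕ → ℂ) (lam w : ℂ) :
    ℕ → ℕ → Matrix (Fin 2) (Fin 2) (Module.End ℂ Fock)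
  | 0, _ => 1
  | r + 1, s => segMat f η z Λ lam w r (s + 1) * siteMat f η z Λ s lam w

theorem segMat_succ_right (lam : ℂ) (r s : ℕ) : segMat f η z Λ lam w (r + 1) s
    = siteMat f η z Λ (s + r) lam w * segMat f η z Λ lam w r s := by
  induction r generalizing s with
  | zero => simp [segMat]
  | succ r ih =>
    rw [segMat, ih, segMat, mul_assoc, show s + 1 + r = s + (r + 1) by omega]

theorem monodromy_eq_segMat (lam : ℂ) (n : ℕ) :
    monodromy f η z Λ n lam w = segMat f η z Λ lam w n 0 := by
  induction n with
  | zero => rfl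
  | succ n ih => rw [segMat_succ_right, monodromy, ih, zero_add]

theorem dynPar_succ (n : ℕ) (lam : ℂ) (ν : Occ) : dynPar η Λ (n + 1) lam ν
    = dynPar η Λ n lam ν - 2 * η * Λ n + 2 * (2 * η) * (ν n : ℂ) := by
  rw [dynPar, dynPar, prefixWeight, prefixWeight, Finset.sum_range_succ]
  ring

theorem segMat_basisVec (hf : SigmaLike f) (lam : ℂ) (g : Occ → ℂ) (r s : ℕ) (ν : Occ) :
    (Finsupp.linearCombination ℂ (fun κ => g κ / f (dynPar η Λ (s + r) lam κ))
        (segMat f η z Λ lam w r s 1 0 (basisVec ν)),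
      Finsupp.linearCombination ℂ (fun κ => g κ / f (dynPar η Λ (s + r) lam κ))
        (segMat f η z Λ lam w r s 1 1 (basisVec ν)))
      = colCD f η z Λ w r s (dynPar η Λ s lam ν) g ν := by
  induction r generalizing s ν with
  | zero => simp [segMat, colCD, basisVec]
  | succ r ih =>
    have ih1 := fun ν => congrArg Prod.fst (ih (s + 1) ν)
    have ih2 := fun ν => congrArg Prod.snd (ih (s + 1) ν)
    simp only [show s + 1 + r = s + (r + 1) by omega] at ih1 ih2
    simp only [segMat, Matrix.mul_apply, Fin.sum_univ_two, LinearMap.add_apply,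
      Module.End.mul_apply, siteMat_basisVec_zero_zero hf,
      siteMat_basisVec_zero_one hf, siteMat_basisVec_one_zero hf, siteMat_basisVec_one_one hf,
      map_add, map_smul, smul_eq_mul, colCD, apply_ite (segMat f η z Λ lam w r (s + 1) 1 1),
      map_zero, apply_ite (Finsupp.linearCombination ℂ fun κ => g κ / f (dynPar η Λ (s + (r + 1)) lam κ)), ih1, ih2,
      dynPar_succ, dynPar_update, update_apply_self]

end Columns

section BetheD

/-- The normalization of `k` particles in one factor with dynamical parameter `x`, where
`δ = q - p`. -/
def siteNorm (f : ℂ → ℂ) (t δ x : ℂ) (k : ℕ) : ℂ :=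
  (∏ j ∈ Finset.range k, f (δ - j * t) * f ((j + 1) * t) / f t)
    * ∏ i ∈ Finset.range k, 1 / (f (x + i * t) * f (x - δ + 2 * k * t - 2 * t - i * t))

theorem siteNorm_zero (f : ℂ → ℂ) (t δ x : ℂ) : siteNorm f t δ x 0 = 1 := by simp [siteNorm]

theorem siteNorm_succ (f : ℂ → ℂ) (t δ x : ℂ) (k : ℕ) :
    siteNorm f t δ (x + t) k * (f (δ - k * t) * f ((k + 1) * t) / f t)
      / (f x * f (x - δ + 2 * k * t)) = siteNorm f t δ x (k + 1) := by
  rw [siteNorm, siteNorm, Finset.prod_range_succ _ k, Finset.prod_range_succ' _ k]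
  have e1 : ∀ i : ℕ, x + ((i + 1 : ℕ) : ℂ) * t = x + t + i * t := fun i => by push_cast; ring
  have e2 : ∀ i : ℕ, x - δ + 2 * ((k + 1 : ℕ) : ℂ) * t - 2 * t - ((i + 1 : ℕ) : ℂ) * t
      = x + t - δ + 2 * k * t - 2 * t - i * t := fun i => by push_cast; ring
  have e3 : x + ((0 : ℕ) : ℂ) * t = x := by simp
  have e4 : x - δ + 2 * ((k + 1 : ℕ) : ℂ) * t - 2 * t - ((0 : ℕ) : ℂ) * t
      = x - δ + 2 * k * t := by push_cast; ring
  simp only [e1, e2, e3, e4]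
  generalize ∏ i ∈ Finset.range k, 1 / (f (x + t + i * t) * f (x + t - δ + 2 * k * t - 2 * t - i * t))
    = A
  generalize ∏ j ∈ Finset.range k, f (δ - j * t) * f ((j + 1) * t) / f t = B
  ring

theorem siteNorm_shift {f : ℂ → ℂ} {t δ x : ℂ} {k : ℕ} (h1 : f (x + k * t) ≠ 0)
    (h2 : f (x - δ + k * t - t) ≠ 0) :
    siteNorm f t δ (x + t) k * (f (x + k * t) / f x)
      = siteNorm f t δ x k * (f (x - δ + k * t - t) / f (x - δ + 2 * k * t - t)) := by
  have a1 := Finset.prod_range_succ (fun i : ℕ => 1 / f (x + i * t)) k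
  rw [Finset.prod_range_succ'] at a1
  have a2 := Finset.prod_range_succ (fun i : ℕ => 1 / f (x - δ + 2 * k * t - t - i * t)) k
  rw [Finset.prod_range_succ'] at a2
  have e1 : ∀ i : ℕ, x + ((i + 1 : ℕ) : ℂ) * t = x + t + i * t := fun i => by push_cast; ring
  have e2 : ∀ i : ℕ, x - δ + 2 * k * t - t - ((i + 1 : ℕ) : ℂ) * t
      = x - δ + 2 * k * t - 2 * t - i * t := fun i => by push_cast; ring
  have e3 : x + ((0 : ℕ) : ℂ) * t = x := by simp
  have e4 : x - δ + 2 * k * t - t - ((0 : ℕ) : ℂ) * t = x - δ + 2 * k * t - t := by simp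
  have e5 : x - δ + 2 * k * t - t - k * t = x - δ + k * t - t := by ring
  have e6 : ∀ i : ℕ, x + t - δ + 2 * k * t - 2 * t - i * t = x - δ + 2 * k * t - t - i * t :=
    fun i => by ring
  simp only [e1, e2, e3, e4, e5] at a1 a2
  simp only [siteNorm, ← div_div, e6]
  have e7 : ∀ g h : ℕ → ℂ, ∏ i ∈ Finset.range k, 1 / g i / h i
      = (∏ i ∈ Finset.range k, 1 / g i) * ∏ i ∈ Finset.range k, 1 / h i := by
    intro g h
    rw [← Finset.prod_mul_distrib]
    exact Finset.prod_congr rfl fun i _ => by ring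
  rw [e7, e7]
  generalize ∏ i ∈ Finset.range k, 1 / f (x + t + i * t) = P at *
  generalize ∏ i ∈ Finset.range k, 1 / f (x + i * t) = P' at *
  generalize ∏ i ∈ Finset.range k, 1 / f (x - δ + 2 * k * t - t - i * t) = R at *
  generalize ∏ i ∈ Finset.range k, 1 / f (x - δ + 2 * k * t - 2 * t - i * t) = R' at *
  generalize ∏ j ∈ Finset.range k, f (δ - j * t) * f ((j + 1) * t) / f t = B
  have b1 : P * (f (x + k * t) / f x) = P' := by
    rw [mul_div_assoc', mul_comm, ← mul_one_div, mul_assoc, a1, mul_comm, mul_assoc,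
      one_div_mul_cancel h1, mul_one]
  have b2 : R' * (f (x - δ + k * t - t) / f (x - δ + 2 * k * t - t)) = R := by
    rw [mul_div_assoc', mul_comm, ← mul_one_div, mul_assoc, a2, mul_comm, mul_assoc,
      one_div_mul_cancel h2, mul_one]
  rw [← b1, ← b2]
  ring

variable (f : ℂ → ℂ) (η : ℂ) (z Λ : ℕ → ℂ) (Θ : ℂ → ℂ)

/-- The factor `Θ(u) ∏_{s ≤ i < s + r} f(u - p_i) / f(u - q_i)`. -/
def tailRatio : ℕ → ℕ → ℂ → ℂ
  | 0, _, u => Θ u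
  | r + 1, s, u => tailRatio r (s + 1) u * (f (u - pPt η z Λ s) / f (u - qPt η z Λ s))

/-- The sum over the distributions of the variables `U` over the factors `V_s, …, V_{s+r-1}`, with
`x` the dynamical parameter seen by `V_s`. -/
def betheD : ℕ → ℕ → ℂ → Occ → Finset ℂ → ℂ
  | 0, _, _, _, U => if U = ∅ then 1 else 0
  | r + 1, s, x, ν, U => siteNorm f (2 * η) (qPt η z Λ s - pPt η z Λ s) x (ν s)
      * blkSum f (2 * η) (tailRatio f η z Λ Θ r (s + 1)) (qPt η z Λ s) (ν s)
        (2 * η - (x - 2 * η * Λ s + 2 * (2 * η) * (ν s : ℂ)) + ν s * (2 * η))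
        (betheD r (s + 1) (x - 2 * η * Λ s + 2 * (2 * η) * (ν s : ℂ)) ν) U

variable {f η z Λ Θ} {w : ℂ}

theorem betheD_congr {ν κ : Occ} {r s : ℕ} (x : ℂ) (h : ∀ i, s ≤ i → ν i = κ i) :
    betheD f η z Λ Θ r s x ν = betheD f η z Λ Θ r s x κ := by
  induction r generalizing s x with
  | zero => rfl
  | succ r ih =>
    funext U
    rw [betheD, betheD, h s le_rfl, ih _ fun i hi => h i (by omega)]

theorem betheD_update (ν : Occ) (r s k : ℕ) (x : ℂ) :
    betheD f η z Λ Θ r (s + 1) x (ν.update s k) = betheD f η z Λ Θ r (s + 1) x ν :=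
  betheD_congr _ fun i hi => by simp [Function.update, show i ≠ s by omega]

theorem colCD_fst_eq_zero {r s : ℕ} {x : ℂ} {g : Occ → ℂ} {ν : Occ} (h : numIn ν r s = 0) :
    (colCD f η z Λ w r s x g ν).1 = 0 := by
  rw [(colCD_congr_sum (∅ : Finset ℕ) (fun _ => 0) (fun _ _ => 0) r s x g ν).1, Finset.sum_empty]
  intro κ _ _ hk
  omega

theorem two_eta_mul (s : ℕ) : 2 * η * Λ s = qPt η z Λ s - pPt η z Λ s := by rw [qPt, pPt]; ring

/-- The action of the rest of the chain on `betheD`, in terms of the sum over the variables of the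
factor `V_s` with occupation number `k`. -/
theorem colCD_betheD_rest (r s k : ℕ) (x X : ℂ) (U : Finset ℂ) (ν : Occ) (hν : ν s = k)
    (hX : X = x - 2 * η * Λ s + 2 * (2 * η) * (k : ℂ)) :
    (colCD f η z Λ w r (s + 1) X (fun κ => betheD f η z Λ Θ (r + 1) s (x + 2 * η) κ U) ν).1
      = siteNorm f (2 * η) (qPt η z Λ s - pPt η z Λ s) (x + 2 * η) k
        * blkSum f (2 * η) (tailRatio f η z Λ Θ r (s + 1)) (qPt η z Λ s) k (-X + k * (2 * η))
        (fun V => (colCD f η z Λ w r (s + 1) X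
          (fun κ => betheD f η z Λ Θ r (s + 1) (X + 2 * η) κ V) ν).1) U ∧
    (colCD f η z Λ w r (s + 1) X (fun κ => betheD f η z Λ Θ (r + 1) s (x + 2 * η) κ U) ν).2
      = siteNorm f (2 * η) (qPt η z Λ s - pPt η z Λ s) (x + 2 * η) k
        * blkSum f (2 * η) (tailRatio f η z Λ Θ r (s + 1)) (qPt η z Λ s) k (-X + k * (2 * η))
        (fun V => (colCD f η z Λ w r (s + 1) X
          (fun κ => betheD f η z Λ Θ r (s + 1) (X + 2 * η) κ V) ν).2) U := by
  have hg : ∀ κ : Occ, (∀ i, i < s + 1 → κ i = ν i) →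
      betheD f η z Λ Θ (r + 1) s (x + 2 * η) κ U
      = ∑ I ∈ U.powersetCard k, (siteNorm f (2 * η) (qPt η z Λ s - pPt η z Λ s) (x + 2 * η) k
        * ((∏ u ∈ I, tailRatio f η z Λ Θ r (s + 1) u * f (-X + k * (2 * η) + u - qPt η z Λ s)
          / f (u - qPt η z Λ s)) * cross f (2 * η) I (U \ I)))
        * betheD f η z Λ Θ r (s + 1) (X + 2 * η) κ (U \ I) := by
    intro κ hκ
    have e1 : x + 2 * η - 2 * η * Λ s + 2 * (2 * η) * (k : ℂ) = X + 2 * η := by rw [hX]; ring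
    have e2 : 2 * η - (X + 2 * η) + k * (2 * η) = -X + k * (2 * η) := by ring
    rw [betheD, hκ s (by omega), hν, e1, e2, blkSum, Finset.mul_sum]
    exact Finset.sum_congr rfl fun I _ => by ring
  constructor
  · rw [(colCD_congr_sum _ _ (fun I κ => betheD f η z Λ Θ r (s + 1) (X + 2 * η) κ (U \ I)) r (s + 1)
      X _ ν).1 fun κ hκ _ _ => hg κ hκ, blkSum, Finset.mul_sum]
    exact Finset.sum_congr rfl fun I _ => by ring
  · rw [(colCD_congr_sum _ _ (fun I κ => betheD f η z Λ Θ r (s + 1) (X + 2 * η) κ (U \ I)) r (s + 1)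
      X _ ν).2 fun κ hκ _ _ => hg κ hκ, blkSum, Finset.mul_sum]
    exact Finset.sum_congr rfl fun I _ => by ring

theorem dAct_const_mul (t c : ℂ) (Δ : ℂ → ℂ) (x : ℂ) (F : Finset ℂ → ℂ) (U : Finset ℂ) :
    dAct f t Δ x w (fun V => c * F V) U = c * dAct f t Δ x w F U := by
  rw [dAct, dAct, mul_add, Finset.mul_sum]
  congr 1
  · ring
  · exact Finset.sum_congr rfl fun j _ => by ring

theorem colCD_betheD (hf : SigmaLike f) (ht : f (2 * η) ≠ 0) (lam : ℂ) (T : ℕ)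
    (hL : ∀ l j : ℕ, 1 ≤ l → j < T → f (lam - 2 * η * LamSum Λ l + 2 * η * j) ≠ 0)
    (hwq : ∀ l, f (w - qPt η z Λ l) ≠ 0) (r s J : ℕ) (hs : 1 ≤ s) (x : ℂ)
    (hx : x = lam - 2 * η * LamSum Λ s + 2 * η * J) (U : Finset ℂ)
    (hJ : J + 2 * U.card + 1 ≤ T)
    (hU : ∀ u ∈ U, ∀ v ∈ U, u ≠ v → f (u - v) ≠ 0) (hw : ∀ u ∈ U, f (w - u) ≠ 0)
    (hUq : ∀ l, ∀ u ∈ U, f (u - qPt η z Λ l) ≠ 0) (ν : Occ) :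
    (numIn ν r s = U.card + 1 →
      Θ w * (colCD f η z Λ w r s x (fun κ => betheD f η z Λ Θ r s (x + 2 * η) κ U) ν).1
        = betheD f η z Λ Θ r s x ν (insert w U)) ∧
    (numIn ν r s = U.card →
      Θ w * (colCD f η z Λ w r s x (fun κ => betheD f η z Λ Θ r s (x + 2 * η) κ U) ν).2
        = 1 / f x * dActN f (2 * η) (tailRatio f η z Λ Θ r s) (-(x + 2 * η)) w
          (betheD f η z Λ Θ r s (x + 2 * η + 2 * η) ν) U) := by
  induction r generalizing s J x U ν with
  | zero =>
    refine ⟨fun h => by simp [numIn] at h, fun h => ?_⟩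
    have h0 : U = ∅ := by
      simp only [numIn] at h
      exact Finset.card_eq_zero.1 h.symm
    subst h0
    simp [colCD, betheD, dActN, tailRatio, div_eq_inv_mul, mul_comm]
  | succ r ih =>
    have hw' : w ∉ U := fun h => hf.ne_of_map_sub_ne_zero (hw w h) rfl
    have hlab : ∀ k : ℕ, x - 2 * η * Λ s + 2 * (2 * η) * (k : ℂ)
        = lam - 2 * η * LamSum Λ (s + 1) + 2 * η * ((J + 2 * k : ℕ) : ℂ) := by
      intro k
      rw [hx, LamSum, LamSum, Finset.sum_range_succ]
      push_cast
      ring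
    have hx0 : ∀ k : ℕ, J + k < T → f (x + k * (2 * η)) ≠ 0 := by
      intro k hk
      convert hL s (J + k) hs hk using 2
      rw [hx]; push_cast; ring
    have hx1 : ∀ k : ℕ, J + k < T →
        f (x - (qPt η z Λ s - pPt η z Λ s) + k * (2 * η)) ≠ 0 := by
      intro k hk
      convert hL (s + 1) (J + k) (by omega) hk using 2
      rw [← two_eta_mul, hx, LamSum, LamSum, Finset.sum_range_succ]; push_cast; ring
    have hxx : f x ≠ 0 := by simpa using hx0 0 (by omega)
    -- the induction hypothesis for subsets of the variables
    have hc : ∀ k : ℕ, ∀ I ⊆ U, J + 2 * k + 2 * (U \ I).card + 1 ≤ T → ∀ κ, _ :=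
      fun k I (hI : I ⊆ U) h κ => ih (s + 1) (J + 2 * k) (by omega) _ (hlab k) (U \ I) h
        (fun u hu v hv => hU u (Finset.sdiff_subset hu) v (Finset.sdiff_subset hv))
        (fun u hu => hw u (Finset.sdiff_subset hu))
        (fun l u hu => hUq l u (Finset.sdiff_subset hu)) κ
    constructor
    · intro hn
      rw [numIn] at hn
      rcases Nat.eq_zero_or_pos (ν s) with h0 | h0
      · rw [colCD, if_pos h0, h0, coefA_zero (hwq s) hxx, add_zero, one_mul,
          (colCD_betheD_rest r s 0 x _ U ν h0 rfl).1, betheD, h0, siteNorm_zero, siteNorm_zero,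
          blkSum_zero, blkSum_zero, one_mul, one_mul]
        have := (hc 0 ∅ (Finset.empty_subset _) (by simpa using hJ) ν).1
          (by rw [Finset.sdiff_empty]; omega)
        simpa using this
      · obtain ⟨k, hk⟩ : ∃ k, ν s = k + 1 := Nat.exists_eq_add_of_le' h0
        have hkU : k ≤ U.card := by omega
        rw [colCD, if_neg h0.ne', hk, Nat.add_sub_cancel,
          (colCD_betheD_rest r s (k + 1) x _ U ν hk rfl).1,
          (colCD_betheD_rest r s k x _ U _ (update_apply_self _ _ _) rfl).2, betheD, hk]
        set y := x - 2 * η * Λ s + 2 * (2 * η) * ((k + 1 : ℕ) : ℂ) with hy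
        set y' := x - 2 * η * Λ s + 2 * (2 * η) * (k : ℂ) with hy'
        have hyy : y' + 2 * η + 2 * η = y := by rw [hy, hy']; push_cast; ring
        have b1 : Θ w * blkSum f (2 * η) (tailRatio f η z Λ Θ r (s + 1)) (qPt η z Λ s) (k + 1)
            (-y + ((k + 1 : ℕ) : ℂ) * (2 * η)) (fun V => (colCD f η z Λ w r (s + 1) y
              (fun κ => betheD f η z Λ Θ r (s + 1) (y + 2 * η) κ V) ν).1) U
            = blkSum f (2 * η) (tailRatio f η z Λ Θ r (s + 1)) (qPt η z Λ s) (k + 1)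
              (2 * η - y + k * (2 * η))
              (fun V => betheD f η z Λ Θ r (s + 1) y ν (insert w V)) U := by
          rw [blkSum, blkSum, Finset.mul_sum]
          refine Finset.sum_congr rfl fun I hI => ?_
          obtain ⟨hIU, hIc⟩ := Finset.mem_powersetCard.1 hI
          have hcard := Finset.card_sdiff_of_subset hIU
          have := Finset.card_le_card hIU
          have e : -y + ((k + 1 : ℕ) : ℂ) * (2 * η) = 2 * η - y + k * (2 * η) := by
            push_cast; ring
          rw [← (hc (k + 1) I hIU (by omega) ν).1 (by omega), e]
          ring
        have b2 : Θ w * blkSum f (2 * η) (tailRatio f η z Λ Θ r (s + 1)) (qPt η z Λ s) k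
            (-y' + (k : ℂ) * (2 * η)) (fun V => (colCD f η z Λ w r (s + 1) y'
              (fun κ => betheD f η z Λ Θ r (s + 1) (y' + 2 * η) κ V) (ν.update s k)).2) U
            = 1 / f y' * blkSum f (2 * η) (tailRatio f η z Λ Θ r (s + 1)) (qPt η z Λ s) k
              (2 * η - y + (k + 1) * (2 * η))
              (dActN f (2 * η) (tailRatio f η z Λ Θ r (s + 1)) (2 * η - y) w
                (betheD f η z Λ Θ r (s + 1) y ν)) U := by
          rw [blkSum, blkSum, Finset.mul_sum, Finset.mul_sum]
          refine Finset.sum_congr rfl fun I hI => ?_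
          obtain ⟨hIU, hIc⟩ := Finset.mem_powersetCard.1 hI
          have hcard := Finset.card_sdiff_of_subset hIU
          have := Finset.card_le_card hIU
          have e : -y' + (k : ℂ) * (2 * η) = 2 * η - y + (k + 1) * (2 * η) := by
            rw [← hyy]; ring
          have e2 : -(y' + 2 * η) = 2 * η - y := by rw [← hyy]; ring
          have := (hc k I hIU (by omega) (ν.update s k)).2
            (by rw [numIn_update _ _ (by omega)]; omega)
          rw [← hy', hyy, e2, betheD_update] at this
          rw [e, mul_left_comm, this]
          ring
        have hstep := blkSum_insert_dActN (t := 2 * η) hf (tailRatio f η z Λ Θ r (s + 1))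
          (qPt η z Λ s) (2 * η - y) w k (betheD f η z Λ Θ r (s + 1) y ν) U hkU hU hw (hUq s)
          (hwq s) (fun hlt => by
            have := hL (s + 1) (J + 2 * k + 1) (by omega) (by omega)
            rw [← neg_sub, hf.odd, neg_ne_zero]
            convert this using 2
            rw [hy, hlab]; push_cast; ring)
        rw [mul_add, mul_left_comm (Θ w), mul_left_comm (Θ w), b1, mul_left_comm (Θ w),
          mul_left_comm (Θ w), b2]
        have e3 : 2 * η - y + ((k + 1 : ℕ) : ℂ) * (2 * η) = 2 * η - y + (k + 1) * (2 * η) := by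
          push_cast; ring
        rw [e3, ← hstep]
        have hyδ : y = x - (qPt η z Λ s - pPt η z Λ s) + 2 * ((k + 1 : ℕ) : ℂ) * (2 * η) := by
          rw [hy, two_eta_mul]; ring
        have hyδ' : y' = x - (qPt η z Λ s - pPt η z Λ s) + 2 * k * (2 * η) := by
          rw [hy', two_eta_mul]; ring
        have h4 : f (2 * η - y + (k + 1) * (2 * η))
            = -f (x - (qPt η z Λ s - pPt η z Λ s) + ((k + 1 : ℕ) : ℂ) * (2 * η) - 2 * η) :=
          hf.map_eq_neg (by rw [hyδ]; push_cast; ring)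
        have h5 : f (2 * η - y) = -f (x - (qPt η z Λ s - pPt η z Λ s)
            + 2 * ((k + 1 : ℕ) : ℂ) * (2 * η) - 2 * η) :=
          hf.map_eq_neg (by rw [hyδ]; ring)
        rw [mul_add]
        congr 1
        · rcases hkU.lt_or_eq with hlt | heq
          · have h1 := siteNorm_shift (k := k + 1) (hx0 (k + 1) (by omega)) (by
              have e : x - (qPt η z Λ s - pPt η z Λ s) + ((k + 1 : ℕ) : ℂ) * (2 * η) - 2 * η
                  = x - (qPt η z Λ s - pPt η z Λ s) + k * (2 * η) := by push_cast; ring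
              rw [e]
              exact hx1 k (by omega))
            have h6 : f (w - qPt η z Λ s + ((k + 1 : ℕ) : ℂ) * (2 * η))
                = f (w - qPt η z Λ s + (k + 1) * (2 * η)) := by push_cast; rfl
            have h7 : coefA f (2 * η) (qPt η z Λ s) x w (k + 1)
                * siteNorm f (2 * η) (qPt η z Λ s - pPt η z Λ s) (x + 2 * η) (k + 1)
                = siteNorm f (2 * η) (qPt η z Λ s - pPt η z Λ s) x (k + 1)
                * (f (w - qPt η z Λ s + (k + 1) * (2 * η)) * f (2 * η - y + (k + 1) * (2 * η))
                  / (f (w - qPt η z Λ s) * f (2 * η - y))) := by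
              rw [coefA, h4, h5, mul_neg, mul_neg, neg_div_neg_eq, mul_div_mul_comm,
                mul_div_mul_comm, mul_assoc, mul_comm _ (siteNorm _ _ _ _ _), h1, h6]
              ring
            rw [← mul_assoc, h7, mul_assoc]
          · rw [blkSum_of_card_lt _ _ _ _ (by omega)]
            ring
        · have h2 := siteNorm_succ f (2 * η) (qPt η z Λ s - pPt η z Λ s) x k
          rw [← hyδ'] at h2
          have h3 : f (2 * η - y + w - qPt η z Λ s + (k + 1) * (2 * η))
              = -f (x + pPt η z Λ s - w + k * (2 * η)) :=
            hf.map_eq_neg (by rw [hyδ]; push_cast; ring)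
          rw [← h2, h3, coefC]
          ring
    · intro hn
      rw [numIn] at hn
      set k := ν s with hk
      have hyy : ∀ k : ℕ, x - 2 * η * Λ s + 2 * (2 * η) * ((k + 1 : ℕ) : ℂ)
          = x - 2 * η * Λ s + 2 * (2 * η) * (k : ℂ) + 2 * η + 2 * η := fun k => by push_cast; ring
      rcases Finset.eq_empty_or_nonempty U with hU0 | hU0
      · subst hU0
        rw [Finset.card_empty] at hn
        have hk0 : k = 0 := by omega
        have hX : f (x - (qPt η z Λ s - pPt η z Λ s)) ≠ 0 := by
          simpa using hx1 0 (by simpa using hJ)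
        have h1 := (hc 0 ∅ (Finset.empty_subset _) (by simpa using hJ) ν).2
          (by rw [Finset.sdiff_empty, Finset.card_empty]; omega)
        have e1 : x + 2 * η + 2 * η - (qPt η z Λ s - pPt η z Λ s)
            = x - (qPt η z Λ s - pPt η z Λ s) + 2 * η + 2 * η := by ring
        rw [colCD, colCD_fst_eq_zero (s := s + 1) (ν := ν.update s (ν s + 1))
          (by rw [numIn_update _ _ (by omega)]; omega), ← hk, hk0,
          (colCD_betheD_rest r s 0 x _ ∅ ν (hk.symm.trans hk0) rfl).2]
        simp only [two_eta_mul (z := z), dActN, tailRatio, betheD, coefD, ← hk, hk0, siteNorm_zero,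
          blkSum_zero, Nat.cast_zero, mul_zero, zero_mul, add_zero, sub_zero, Finset.sum_empty,
          Finset.prod_empty, zero_div, zero_add, mul_one, one_mul, Finset.sdiff_empty, e1]
          at h1 ⊢
        rw [mul_left_comm, h1]
        field_simp
      · have hU1 : 1 ≤ U.card := Finset.card_pos.2 hU0
        have hkU : k ≤ U.card := by omega
        rw [colCD, ← hk, (colCD_betheD_rest r s k x _ U ν hk.symm rfl).2,
          (colCD_betheD_rest r s (k + 1) x _ U _ (update_apply_self _ _ _) rfl).1]
        set y := x - 2 * η * Λ s + 2 * (2 * η) * (k : ℂ) with hy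
        set y' := x - 2 * η * Λ s + 2 * (2 * η) * ((k + 1 : ℕ) : ℂ) with hy'
        have hyy : y' = y + 2 * η + 2 * η := by rw [hy, hy']; push_cast; ring
        have hyδ : y = x - (qPt η z Λ s - pPt η z Λ s) + 2 * k * (2 * η) := by
          rw [hy, two_eta_mul]; ring
        have b1 : Θ w * blkSum f (2 * η) (tailRatio f η z Λ Θ r (s + 1)) (qPt η z Λ s) (k + 1)
            (-y' + ((k + 1 : ℕ) : ℂ) * (2 * η)) (fun V => (colCD f η z Λ w r (s + 1) y'
              (fun κ => betheD f η z Λ Θ r (s + 1) (y' + 2 * η) κ V) (ν.update s (k + 1))).1) U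
            = blkSum f (2 * η) (tailRatio f η z Λ Θ r (s + 1)) (qPt η z Λ s) (k + 1)
              (-(y + 2 * η) + k * (2 * η))
              (fun V => betheD f η z Λ Θ r (s + 1) y' ν (insert w V)) U := by
          rw [blkSum, blkSum, Finset.mul_sum]
          refine Finset.sum_congr rfl fun I hI => ?_
          obtain ⟨hIU, hIc⟩ := Finset.mem_powersetCard.1 hI
          have hcard := Finset.card_sdiff_of_subset hIU
          have := Finset.card_le_card hIU
          have e : -y' + ((k + 1 : ℕ) : ℂ) * (2 * η) = -(y + 2 * η) + k * (2 * η) := by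
            rw [hyy]; push_cast; ring
          have := (hc (k + 1) I hIU (by omega) (ν.update s (k + 1))).1
            (by rw [numIn_update _ _ (by omega)]; omega)
          rw [← hy', betheD_update] at this
          rw [← this, e]
          ring
        have b2 : Θ w * blkSum f (2 * η) (tailRatio f η z Λ Θ r (s + 1)) (qPt η z Λ s) k
            (-y + (k : ℂ) * (2 * η)) (fun V => (colCD f η z Λ w r (s + 1) y
              (fun κ => betheD f η z Λ Θ r (s + 1) (y + 2 * η) κ V) ν).2) U
            = 1 / f y * blkSum f (2 * η) (tailRatio f η z Λ Θ r (s + 1)) (qPt η z Λ s) k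
              (-(y + 2 * η) + (k + 1) * (2 * η))
              (dActN f (2 * η) (tailRatio f η z Λ Θ r (s + 1)) (-(y + 2 * η)) w
                (betheD f η z Λ Θ r (s + 1) y' ν)) U := by
          rw [blkSum, blkSum, Finset.mul_sum, Finset.mul_sum]
          refine Finset.sum_congr rfl fun I hI => ?_
          obtain ⟨hIU, hIc⟩ := Finset.mem_powersetCard.1 hI
          have hcard := Finset.card_sdiff_of_subset hIU
          have := Finset.card_le_card hIU
          have e : -y + (k : ℂ) * (2 * η) = -(y + 2 * η) + (k + 1) * (2 * η) := by ring
          have := (hc k I hIU (by omega) ν).2 (by omega)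
          rw [← hy, ← hyy] at this
          rw [e, mul_left_comm, this]
          ring
        have hstep := dActN_blkSum (t := 2 * η) hf ht (tailRatio f η z Λ Θ r (s + 1))
          (tailRatio f η z Λ Θ (r + 1) s) (pPt η z Λ s) (qPt η z Λ s) (-(y + 2 * η)) w k
          (betheD f η z Λ Θ r (s + 1) y' ν) U hkU (fun u => rfl) hU hw (hUq s)
          (hwq s) (fun hlt => by
            have := hL (s + 1) (J + 2 * k + 1) (by omega) (by omega)
            rw [hf.odd, neg_ne_zero]
            convert this using 2
            rw [hy, hlab]; push_cast; ring)
        rw [mul_add, mul_left_comm (Θ w), mul_left_comm (Θ w), b1, mul_left_comm (Θ w),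
          mul_left_comm (Θ w), b2]
        have hxt : f (x + 2 * η) ≠ 0 := by simpa using hx0 1 (by omega)
        have hfin : dActN f (2 * η) (tailRatio f η z Λ Θ (r + 1) s) (-(x + 2 * η)) w
            (betheD f η z Λ Θ (r + 1) s (x + 2 * η + 2 * η) ν) U
            = siteNorm f (2 * η) (qPt η z Λ s - pPt η z Λ s) (x + 2 * η + 2 * η) k
              / f (-(x + 2 * η)) * dAct f (2 * η) (tailRatio f η z Λ Θ (r + 1) s)
              (-(y + 2 * η) - (qPt η z Λ s - pPt η z Λ s) + 2 * k * (2 * η)) w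
              (blkSum f (2 * η) (tailRatio f η z Λ Θ r (s + 1)) (qPt η z Λ s) k
                (-(y + 2 * η) + k * (2 * η)) (betheD f η z Λ Θ r (s + 1) y' ν)) U := by
          have hxt' : f (-(x + 2 * η)) ≠ 0 := by rwa [hf.odd, neg_ne_zero]
          have hlab' : x + 2 * η + 2 * η - 2 * η * Λ s + 2 * (2 * η) * (k : ℂ) = y' := by
            rw [hyy, hy]; ring
          rw [div_mul_eq_mul_div, eq_div_iff hxt', mul_comm, ← dAct_eq_mul_dActN hxt',
            ← dAct_const_mul]
          refine dAct_congr (by rw [hyδ]; ring) hw' fun V _ => ?_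
          rw [betheD, ← hk, hlab', hyy]
          have e8 : 2 * η - (y + 2 * η + 2 * η) + k * (2 * η) = -(y + 2 * η) + k * (2 * η) := by
            ring
          rw [e8]
        have h1 := siteNorm_shift (f := f) (t := 2 * η) (δ := qPt η z Λ s - pPt η z Λ s)
          (x := x + 2 * η) (k := k) (by
            have e : x + 2 * η + k * (2 * η) = x + ((k + 1 : ℕ) : ℂ) * (2 * η) := by
              push_cast; ring
            rw [e]
            exact hx0 (k + 1) (by omega)) (by
            have e : x + 2 * η - (qPt η z Λ s - pPt η z Λ s) + k * (2 * η) - 2 * η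
                = x - (qPt η z Λ s - pPt η z Λ s) + k * (2 * η) := by ring
            rw [e]
            exact hx1 k (by omega))
        have h2 := siteNorm_succ f (2 * η) (qPt η z Λ s - pPt η z Λ s) (x + 2 * η) k
        have e5 : x + 2 * η - (qPt η z Λ s - pPt η z Λ s) + k * (2 * η) - 2 * η
                = x - (qPt η z Λ s - pPt η z Λ s) + k * (2 * η) := by ring
        have e6 : x + 2 * η - (qPt η z Λ s - pPt η z Λ s) + 2 * k * (2 * η) - 2 * η = y := by
          rw [hyδ]; ring
        have e7 : x + 2 * η - (qPt η z Λ s - pPt η z Λ s) + 2 * k * (2 * η) = y + 2 * η := by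
          rw [hyδ]; ring
        rw [e5, e6] at h1
        rw [e7] at h2
        have h3 : f (-(y + 2 * η) - (qPt η z Λ s - pPt η z Λ s) + k * (2 * η))
            = -f (x + 2 * η + k * (2 * η)) := hf.map_eq_neg (by rw [hyδ]; ring)
        have h4 : f (-(y + 2 * η) + pPt η z Λ s - w + k * (2 * η))
            = -f (x + w - qPt η z Λ s + (k + 1) * (2 * η)) := hf.map_eq_neg (by rw [hyδ]; ring)
        rw [hfin, ← hstep, mul_add, mul_add, add_comm]
        congr 1
        · rw [coefD, h3, hf.odd]
          generalize blkSum f (2 * η) _ _ k _ _ U = BS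
          linear_combination (-(f (w - pPt η z Λ s - k * (2 * η)) / (f (w - qPt η z Λ s) * f x)
            * BS)) * h1
        · rw [coefB, h4, hf.odd, hf.odd, ← h2]
          generalize blkSum f (2 * η) _ _ (k + 1) _ _ U = BS
          linear_combination (-(f (x + w - qPt η z Λ s + (k + 1) * (2 * η))
            / (f (w - qPt η z Λ s) * f x)
            * siteNorm f (2 * η) (qPt η z Λ s - pPt η z Λ s) (x + 2 * η + 2 * η) k
            * (f (qPt η z Λ s - pPt η z Λ s - k * (2 * η)) * f ((k + 1) * (2 * η)))
            / (f (x + 2 * η) * f (y + 2 * η)) * BS)) * mul_inv_cancel₀ ht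

end BetheD

section FirstSite

variable {f : ℂ → ℂ} {t : ℂ}

/-- The sum over the subsets of `V` with `m` elements that goes to the factors after the first. -/
def splitSum (f : ℂ → ℂ) (t : ℂ) (a b : ℂ → ℂ) (m : ℕ) (G : Finset ℂ → ℂ) (V : Finset ℂ) : ℂ :=
  ∑ I ∈ V.powersetCard m, (∏ u ∈ I, a u) * (∏ y ∈ V \ I, b y) * cross f t (V \ I) I * G I

theorem predSubsets_zero {α : Type*} (U : Finset α) : predSubsets U 0 = ∅ := by
  ext I
  simp [mem_predSubsets]

theorem cross_insert_insert {V I : Finset ℂ} {w : ℂ} (hw : w ∉ V) (hI : I ⊆ V) :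
    cross f t (insert w V \ insert w I) (insert w I)
      = (∏ y ∈ V \ I, f (y - w - t) / f (y - w)) * cross f t (V \ I) I := by
  rw [Finset.insert_sdiff_insert, Finset.sdiff_insert_of_notMem hw,
    cross_insert_right fun h => hw (hI h)]

theorem splitSum_insert (a b : ℂ → ℂ) (m : ℕ) (G : Finset ℂ → ℂ) {V : Finset ℂ} {w : ℂ}
    (hw : w ∉ V) :
    splitSum f t a b m G (insert w V)
      = b w * ∑ I ∈ V.powersetCard m, (∏ u ∈ I, a u) * (∏ y ∈ V \ I, b y) * cross f t (V \ I) I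
          * ((∏ u ∈ I, f (w - u - t) / f (w - u)) * G I)
        + ∑ I ∈ predSubsets V m, (∏ u ∈ I, a u) * cross f t (V \ I) I * G (insert w I)
          * (a w * ∏ y ∈ V \ I, f (y - w - t) / f (y - w) * b y) := by
  rw [splitSum, sum_powersetCard_insert hw, Finset.mul_sum]
  congr 1
  · refine Finset.sum_congr rfl fun I hI => ?_
    have hIV := (Finset.mem_powersetCard.1 hI).1
    rw [Finset.insert_sdiff_of_notMem _ fun h => hw (hIV h),
      Finset.prod_insert fun h => hw (Finset.mem_sdiff.1 h).1,
      cross_insert_left fun h => hw (Finset.mem_sdiff.1 h).1]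
    ring
  · refine Finset.sum_congr rfl fun I hI => ?_
    have hIV := (mem_predSubsets.1 hI).1
    rw [cross_insert_insert hw hIV, Finset.insert_sdiff_insert,
      Finset.sdiff_insert_of_notMem hw, Finset.prod_insert fun h => hw (hIV h),
      Finset.prod_mul_distrib]
    ring

theorem sum_predSubsets_sdiff {α M : Type*} [DecidableEq α] [AddCommMonoid M] (U : Finset α)
    (m : ℕ) (G : Finset α → α → M) :
    ∑ I ∈ U.powersetCard m, ∑ j ∈ I, G (I.erase j) j
      = ∑ I ∈ predSubsets U m, ∑ j ∈ U \ I, G I j := by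
  cases m with
  | zero => simp [predSubsets_zero]
  | succ m => rw [predSubsets_succ, sum_powersetCard_sdiff]

theorem splitSum_dActN (a b θ : ℂ → ℂ) (x w : ℂ) (m : ℕ) (G : Finset ℂ → ℂ) (V : Finset ℂ) :
    splitSum f t a b m (dActN f t θ x w G) V
      = θ w * ∑ I ∈ V.powersetCard m, (∏ u ∈ I, a u) * (∏ y ∈ V \ I, b y) * cross f t (V \ I) I
          * ((∏ u ∈ I, f (w - u - t) / f (w - u)) * G I)
        + ∑ I ∈ predSubsets V m, (∏ u ∈ I, a u) * cross f t (V \ I) I * G (insert w I)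
          * ((∑ j ∈ V \ I, f t * f (x - w + j) / f (w - j) * (θ j * a j)
            * ∏ y ∈ (V \ I).erase j, f (y - j - t) / f (y - j) * b y) / f x) := by
  have h1 : ∀ I ∈ V.powersetCard m,
      (∏ u ∈ I, a u) * (∏ y ∈ V \ I, b y) * cross f t (V \ I) I * dActN f t θ x w G I
      = θ w * ((∏ u ∈ I, a u) * (∏ y ∈ V \ I, b y) * cross f t (V \ I) I
          * ((∏ u ∈ I, f (w - u - t) / f (w - u)) * G I))
        + ∑ j ∈ I, (∏ u ∈ I.erase j, a u) * cross f t (V \ I.erase j) (I.erase j)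
          * G (insert w (I.erase j))
          * (f t * f (x - w + j) / f (w - j) * (θ j * a j)
            * (∏ y ∈ (V \ I.erase j).erase j, f (y - j - t) / f (y - j) * b y) / f x) := by
    intro I hI
    have hIV := (Finset.mem_powersetCard.1 hI).1
    rw [dActN, mul_add, Finset.sum_div, Finset.mul_sum]
    congr 1
    · ring
    · refine Finset.sum_congr rfl fun j hj => ?_
      have hjQ : j ∉ V \ I := fun h => (Finset.mem_sdiff.1 h).2 hj
      have e1 : V \ I.erase j = insert j (V \ I) := Finset.sdiff_erase (hIV hj)
      have e2 : cross f t (V \ I) I = (∏ y ∈ V \ I, f (y - j - t) / f (y - j))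
          * cross f t (V \ I) (I.erase j) := by
        rw [← cross_insert_right (Finset.notMem_erase j I), Finset.insert_erase hj]
      rw [e1, Finset.erase_insert hjQ, cross_insert_left hjQ, e2, Finset.prod_mul_distrib,
        ← Finset.mul_prod_erase I a hj]
      ring
  rw [splitSum, Finset.sum_congr rfl h1, Finset.sum_add_distrib, ← Finset.mul_sum]
  congr 1
  rw [sum_predSubsets_sdiff V m (fun I j => (∏ u ∈ I, a u) * cross f t (V \ I) I
          * G (insert w I) * (f t * f (x - w + j) / f (w - j) * (θ j * a j)
            * (∏ y ∈ (V \ I).erase j, f (y - j - t) / f (y - j) * b y) / f x))]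
  refine Finset.sum_congr rfl fun I _ => ?_
  rw [← Finset.mul_sum, Finset.sum_div]

theorem splitSum_step (a b b' θ : ℂ → ℂ) (x w α β γ : ℂ) (m : ℕ) (G : Finset ℂ → ℂ)
    {V : Finset ℂ} (hw : w ∉ V) (h1 : m ≤ V.card → α * θ w = γ * b w)
    (h2 : ∀ Q ⊆ V, Q.card + m = V.card + 1 → 1 ≤ m →
      α * ((∑ j ∈ Q, f t * f (x - w + j) / f (w - j) * (θ j * a j)
        * ∏ y ∈ Q.erase j, f (y - j - t) / f (y - j) * b y) / f x) + β * ∏ y ∈ Q, b' y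
      = γ * (a w * ∏ y ∈ Q, f (y - w - t) / f (y - w) * b y)) :
    α * splitSum f t a b m (dActN f t θ x w G) V
      + β * ∑ I ∈ predSubsets V m, (∏ u ∈ I, a u) * (∏ y ∈ V \ I, b' y) * cross f t (V \ I) I
        * G (insert w I)
      = γ * splitSum f t a b m G (insert w V) := by
  rw [splitSum_insert a b m G hw, splitSum_dActN, mul_add, mul_add, ← mul_assoc, ← mul_assoc γ,
    add_assoc]
  congr 1
  · rcases le_or_gt m V.card with h | h
    · rw [h1 h]
    · rw [Finset.powersetCard_eq_empty.2 h]
      simp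
  · rw [Finset.mul_sum, Finset.mul_sum, Finset.mul_sum, ← Finset.sum_add_distrib]
    refine Finset.sum_congr rfl fun I hI => ?_
    obtain ⟨hIV, hIm⟩ := mem_predSubsets.1 hI
    have hle := Finset.card_le_card hIV
    have := h2 (V \ I) Finset.sdiff_subset (by rw [Finset.card_sdiff_of_subset hIV]; omega)
      (by omega)
    linear_combination ((∏ u ∈ I, a u) * cross f t (V \ I) I * G (insert w I)) * this

/-- The normalization of `k` particles in the first factor after `n` operators `d`. -/
def firstNorm (f : ℂ → ℂ) (t δ lam : ℂ) (N k n : ℕ) : ℂ :=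
  (-f t) ^ (N - k) / (∏ i ∈ Finset.range n, f (lam + i * t))
    * ∏ i ∈ Finset.Ico N (n + k), f (lam - δ + i * t) / f (lam - δ + (i + k) * t)

theorem firstNorm_succ {δ lam : ℂ} {N k n : ℕ} (h : N ≤ n + k) :
    firstNorm f t δ lam N k (n + 1) = firstNorm f t δ lam N k n
      * (f (lam + n * t - δ + k * t) / (f (lam + n * t) * f (lam + n * t - δ + 2 * k * t))) := by
  rw [firstNorm, firstNorm, Finset.prod_range_succ, show n + 1 + k = n + k + 1 by omega,
    Finset.prod_Ico_succ_top h]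
  have e1 : lam - δ + ((n + k : ℕ) : ℂ) * t = lam + n * t - δ + k * t := by push_cast; ring
  have e2 : lam - δ + (((n + k : ℕ) : ℂ) + k) * t = lam + n * t - δ + 2 * k * t := by
    push_cast; ring
  rw [e1, e2, ← div_div]
  ring

theorem firstNorm_add_one {δ lam : ℂ} {N k n : ℕ} (h : N ≤ n + k) (hk : k < N)
    (hN : f (lam - δ + (N + k) * t) ≠ 0) :
    f t * firstNorm f t δ lam N (k + 1) n = -(firstNorm f t δ lam N k n
      * (f (lam + n * t - δ + k * t) * f (lam - δ + (N + k) * t)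
        / (f (lam + n * t - δ + 2 * k * t) * f (lam + n * t - δ + 2 * k * t + t)))) := by
  have hp : (-f t) ^ (N - k) = (-f t) ^ (N - (k + 1)) * (-f t) := by
    rw [← pow_succ]; congr 1; omega
  have htel : (∏ i ∈ Finset.Ico N (n + k), f (lam - δ + (i + k) * t))
      * (f (lam + n * t - δ + 2 * k * t) * f (lam + n * t - δ + 2 * k * t + t))
      = f (lam - δ + (N + k) * t)
        * ∏ i ∈ Finset.Ico N (n + (k + 1)), f (lam - δ + (i + (k + 1 : ℕ)) * t) := by
    have e1 := Finset.prod_Ico_succ_top (show N ≤ n + k + 1 by omega)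
      fun i : ℕ => f (lam - δ + ((i : ℂ) + k) * t)
    rw [Finset.prod_Ico_succ_top h, Finset.prod_eq_prod_Ico_succ_bot (by omega),
      ← Finset.prod_Ico_add' _ N (n + k + 1) 1] at e1
    have e2 : lam - δ + (((n + k : ℕ) : ℂ) + k) * t = lam + n * t - δ + 2 * k * t := by
      push_cast; ring
    have e3 : lam - δ + (((n + k + 1 : ℕ) : ℂ) + k) * t = lam + n * t - δ + 2 * k * t + t := by
      push_cast; ring
    have e4 : ∀ i : ℕ, lam - δ + (((i + 1 : ℕ) : ℂ) + k) * t
        = lam - δ + ((i : ℂ) + (k + 1 : ℕ)) * t := fun i => by push_cast; ring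
    simp only [e2, e3, e4] at e1
    rw [← mul_assoc]
    exact e1.symm
  have e1 : lam - δ + ((n + k : ℕ) : ℂ) * t = lam + n * t - δ + k * t := by push_cast; ring
  rw [firstNorm, firstNorm, hp, Finset.prod_div_distrib, Finset.prod_div_distrib,
    show n + (k + 1) = n + k + 1 by omega,
    Finset.prod_Ico_succ_top h (fun i : ℕ => f (lam - δ + i * t)), e1,
    div_eq_mul_one_div _ (∏ i ∈ Finset.Ico N (n + k + 1), _)]
  have hq : 1 / ∏ i ∈ Finset.Ico N (n + k + 1), f (lam - δ + ((i : ℂ) + ((k + 1 : ℕ) : ℂ)) * t)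
      = f (lam - δ + (N + k) * t) / ((∏ i ∈ Finset.Ico N (n + k), f (lam - δ + (i + k) * t))
      * (f (lam + n * t - δ + 2 * k * t) * f (lam + n * t - δ + 2 * k * t + t))) := by
    rw [htel, div_mul_cancel_left₀ hN, one_div]
    rfl
  rw [hq]
  ring

end FirstSite

section RowD

variable (f : ℂ → ℂ) (η : ℂ) (z Λ : ℕ → ℂ) (Θ : ℂ → ℂ)

/-- The weight of a variable that leaves the first factor. -/
def leaveWeight (lam : ℂ) (N : ℕ) (u : ℂ) : ℂ :=
  f (lam + u - qPt η z Λ 0 + 2 * η * N) / f (u - qPt η z Λ 0)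

/-- The weight of a variable that stays in the first factor with `k` particles. -/
def stayWeight (k : ℕ) (u : ℂ) : ℂ :=
  f (u - pPt η z Λ 0 - 2 * η * k) / f (u - pPt η z Λ 0)

/-- The coefficient of `E_{0^N}` in a product of normalized operators `d` with the parameters `V`,
applied to `E_ν`, in the tensor product of `r + 1` factors. -/
def rowD (r : ℕ) (lam : ℂ) (N : ℕ) (V : Finset ℂ) (ν : Occ) : ℂ :=
  firstNorm f (2 * η) (qPt η z Λ 0 - pPt η z Λ 0) lam N (ν 0) V.card
    * splitSum f (2 * η) (leaveWeight f η z Λ lam N) (stayWeight f η z Λ (ν 0)) (N - ν 0)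
      (betheD f η z Λ Θ r 1
        (lam + V.card * (2 * η) - 2 * η * Λ 0 + 2 * (2 * η) * (ν 0 : ℂ) + 2 * η) ν) V

variable {f η z Λ Θ} {w : ℂ}

theorem splitSum_congr {t : ℂ} {a b : ℂ → ℂ} {m : ℕ} {G G' : Finset ℂ → ℂ} {V : Finset ℂ}
    (h : ∀ I ⊆ V, I.card = m → G I = G' I) : splitSum f t a b m G V = splitSum f t a b m G' V := by
  refine Finset.sum_congr rfl fun I hI => ?_
  rw [h I (Finset.mem_powersetCard.1 hI).1 (Finset.mem_powersetCard.1 hI).2]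

theorem splitSum_const_mul {t : ℂ} {a b : ℂ → ℂ} {m : ℕ} (c : ℂ) (G : Finset ℂ → ℂ)
    (V : Finset ℂ) :
    splitSum f t a b m (fun I => c * G I) V = c * splitSum f t a b m G V := by
  rw [splitSum, splitSum, Finset.mul_sum]
  exact Finset.sum_congr rfl fun I _ => by ring

theorem colCD_rowD_rest (r : ℕ) (lam : ℂ) (N k : ℕ) (V : Finset ℂ) (ν : Occ) (hk : ν 0 = k) (X : ℂ)
    (hX : X = lam + V.card * (2 * η) - 2 * η * Λ 0 + 2 * (2 * η) * (k : ℂ)) :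
    (colCD f η z Λ w r 1 X (rowD f η z Λ Θ r lam N V) ν).1
      = firstNorm f (2 * η) (qPt η z Λ 0 - pPt η z Λ 0) lam N k V.card
        * splitSum f (2 * η) (leaveWeight f η z Λ lam N) (stayWeight f η z Λ k) (N - k)
        (fun I => (colCD f η z Λ w r 1 X (fun κ => betheD f η z Λ Θ r 1 (X + 2 * η) κ I) ν).1) V ∧
    (colCD f η z Λ w r 1 X (rowD f η z Λ Θ r lam N V) ν).2
      = firstNorm f (2 * η) (qPt η z Λ 0 - pPt η z Λ 0) lam N k V.card
        * splitSum f (2 * η) (leaveWeight f η z Λ lam N) (stayWeight f η z Λ k) (N - k)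
        (fun I => (colCD f η z Λ w r 1 X (fun κ => betheD f η z Λ Θ r 1 (X + 2 * η) κ I) ν).2)
        V := by
  have hg : ∀ κ : Occ, (∀ i, i < 1 → κ i = ν i) → rowD f η z Λ Θ r lam N V κ
      = ∑ I ∈ V.powersetCard (N - k),
        (firstNorm f (2 * η) (qPt η z Λ 0 - pPt η z Λ 0) lam N k V.card
        * ((∏ u ∈ I, leaveWeight f η z Λ lam N u) * (∏ y ∈ V \ I, stayWeight f η z Λ k y)
          * cross f (2 * η) (V \ I) I)) * betheD f η z Λ Θ r 1 (X + 2 * η) κ I := by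
    intro κ hκ
    rw [rowD, hκ 0 (by omega), hk, ← hX, splitSum, Finset.mul_sum]
    exact Finset.sum_congr rfl fun I _ => by ring
  constructor
  · rw [(colCD_congr_sum _ _ (fun I κ => betheD f η z Λ Θ r 1 (X + 2 * η) κ I) r 1
      X _ ν).1 fun κ hκ _ _ => hg κ hκ, splitSum, Finset.mul_sum]
    exact Finset.sum_congr rfl fun I _ => by ring
  · rw [(colCD_congr_sum _ _ (fun I κ => betheD f η z Λ Θ r 1 (X + 2 * η) κ I) r 1
      X _ ν).2 fun κ hκ _ _ => hg κ hκ, splitSum, Finset.mul_sum]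
    exact Finset.sum_congr rfl fun I _ => by ring

/-- The identity behind the action of `d` on the first factor. -/
theorem rowD_scalar_identity (hf : SigmaLike f) (ht : f (2 * η) ≠ 0) (lam : ℂ) (N k n : ℕ) (X : ℂ)
    (hX : X = lam + n * (2 * η) - 2 * η * Λ 0 + 2 * (2 * η) * (k : ℂ))
    (hk : k < N) (Q : Finset ℂ) (hQ : Q.card + N = n + k + 1)
    (hX1 : f (X + 2 * η) ≠ 0) (hNk : N ≤ n + k → f (lam - 2 * η * Λ 0 + (N + k) * (2 * η)) ≠ 0)
    (θ : ℂ → ℂ) (hθ : ∀ u ∈ Q, θ u = f (u - qPt η z Λ 0) / f (u - pPt η z Λ 0))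
    (hU : ∀ u ∈ Q, ∀ v ∈ Q, u ≠ v → f (u - v) ≠ 0) (hw : ∀ u ∈ Q, f (w - u) ≠ 0)
    (hUq : ∀ u ∈ Q, f (u - qPt η z Λ 0) ≠ 0) :
    coefD f (2 * η) (pPt η z Λ 0) (qPt η z Λ 0) (lam + n * (2 * η)) w k
        * firstNorm f (2 * η) (qPt η z Λ 0 - pPt η z Λ 0) lam N k n / f X
        * ((∑ j ∈ Q, f (2 * η) * f (-(X + 2 * η) - w + j) / f (w - j)
          * (θ j * leaveWeight f η z Λ lam N j)
          * ∏ y ∈ Q.erase j, f (y - j - 2 * η) / f (y - j) * stayWeight f η z Λ k y)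
            / f (-(X + 2 * η)))
      + coefB f (2 * η) (qPt η z Λ 0) (lam + n * (2 * η)) w k
        * firstNorm f (2 * η) (qPt η z Λ 0 - pPt η z Λ 0) lam N (k + 1) n
        * ∏ y ∈ Q, stayWeight f η z Λ (k + 1) y
      = firstNorm f (2 * η) (qPt η z Λ 0 - pPt η z Λ 0) lam N k (n + 1)
        * (leaveWeight f η z Λ lam N w
          * ∏ y ∈ Q, f (y - w - 2 * η) / f (y - w) * stayWeight f η z Λ k y) := by
  have hδ := two_eta_mul (η := η) (z := z) (Λ := Λ) 0
  rcases Nat.lt_or_ge (n + k) N with hlt | hge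
  · have hQ0 : Q = ∅ := Finset.card_eq_zero.1 (by omega)
    subst hQ0
    have hN : N = n + k + 1 := by simpa using hQ
    have e1 : N - k = (N - (k + 1)) + 1 := by omega
    have e2 : lam + n * (2 * η) + w - qPt η z Λ 0 + (k + 1) * (2 * η)
        = lam + w - qPt η z Λ 0 + 2 * η * N := by rw [hN]; push_cast; ring
    simp only [Finset.sum_empty, Finset.prod_empty, zero_div, mul_zero, zero_add, mul_one,
      firstNorm, coefB, leaveWeight, Finset.prod_range_succ, e1, e2, pow_succ,
      Finset.Ico_eq_empty_of_le (show n + (k + 1) ≤ N by omega),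
      Finset.Ico_eq_empty_of_le (show n + 1 + k ≤ N by omega)]
    rw [← div_div]
    ring_nf
  · have hrow := hf.sum_step_row ht Q (2 * η) w (-(X + 2 * η)) (lam - qPt η z Λ 0 + 2 * η * N)
      (pPt η z Λ 0 + 2 * η * k) hU hw (by
        have hc : (Q.card : ℂ) = n + k + 1 - N := by
          rw [eq_sub_iff_add_eq]; exact_mod_cast hQ
        rw [hX, hc, hδ]; ring)
    have hA : f (w + (lam - qPt η z Λ 0 + 2 * η * N) + Q.card * (2 * η))
        = f (lam + n * (2 * η) + w - qPt η z Λ 0 + (k + 1) * (2 * η)) := by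
      have hc : (Q.card : ℂ) = n + k + 1 - N := by
        rw [eq_sub_iff_add_eq]; exact_mod_cast hQ
      rw [hc]; congr 1; ring
    have hC : f (pPt η z Λ 0 + 2 * η * k + (lam - qPt η z Λ 0 + 2 * η * N))
        = f (lam - (qPt η z Λ 0 - pPt η z Λ 0) + (N + k) * (2 * η)) := by congr 1; ring
    have hE : f (lam - qPt η z Λ 0 + 2 * η * N + w) = f (lam + w - qPt η z Λ 0 + 2 * η * N) := by
      congr 1; ring
    have hP : f (w - (pPt η z Λ 0 + 2 * η * k)) = f (w - pPt η z Λ 0 - k * (2 * η)) := by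
      congr 1; ring
    rw [hA, hC, hE, hP] at hrow
    have s1 : ∑ j ∈ Q, f (2 * η) * f (-(X + 2 * η) - w + j) / f (w - j)
          * (θ j * leaveWeight f η z Λ lam N j)
          * ∏ y ∈ Q.erase j, f (y - j - 2 * η) / f (y - j) * stayWeight f η z Λ k y
        = (∏ u ∈ Q, 1 / f (u - pPt η z Λ 0)) * ∑ j ∈ Q, f (2 * η) * f (-(X + 2 * η) - w + j)
          / f (w - j) * f (lam - qPt η z Λ 0 + 2 * η * N + j) * ∏ u ∈ Q.erase j,
            f (u - j - 2 * η) / f (u - j) * f (u - (pPt η z Λ 0 + 2 * η * k)) := by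
      rw [Finset.mul_sum]
      refine Finset.sum_congr rfl fun j hj => ?_
      have e1 : ∀ u, f (u - j - 2 * η) / f (u - j) * stayWeight f η z Λ k u
          = 1 / f (u - pPt η z Λ 0) * (f (u - j - 2 * η) / f (u - j)
            * f (u - (pPt η z Λ 0 + 2 * η * k))) := fun u => by
        rw [stayWeight, sub_sub u]; ring_nf
      have e2 : θ j * leaveWeight f η z Λ lam N j
          = 1 / f (j - pPt η z Λ 0) * f (lam - qPt η z Λ 0 + 2 * η * N + j) := by
        rw [hθ j hj, leaveWeight, show lam + j - qPt η z Λ 0 + 2 * η * N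
          = lam - qPt η z Λ 0 + 2 * η * N + j by ring]
        have := hUq j hj
        field_simp
      simp only [e1, e2]
      rw [Finset.prod_mul_distrib, ← Finset.mul_prod_erase Q (fun u => 1 / f (u - pPt η z Λ 0)) hj]
      ring
    have s2 : ∏ y ∈ Q, stayWeight f η z Λ (k + 1) y = (∏ u ∈ Q, 1 / f (u - pPt η z Λ 0))
        * ∏ u ∈ Q, f (u - (pPt η z Λ 0 + 2 * η * k) - 2 * η) := by
      rw [← Finset.prod_mul_distrib]
      refine Finset.prod_congr rfl fun u _ => ?_
      rw [stayWeight, show u - pPt η z Λ 0 - 2 * η * ((k + 1 : ℕ) : ℂ)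
        = u - (pPt η z Λ 0 + 2 * η * k) - 2 * η by push_cast; ring]
      ring
    have s3 : ∏ y ∈ Q, f (y - w - 2 * η) / f (y - w) * stayWeight f η z Λ k y
        = (∏ u ∈ Q, 1 / f (u - pPt η z Λ 0))
        * ∏ u ∈ Q, f (u - w - 2 * η) / f (u - w) * f (u - (pPt η z Λ 0 + 2 * η * k)) := by
      rw [← Finset.prod_mul_distrib]
      refine Finset.prod_congr rfl fun u _ => ?_
      rw [stayWeight, sub_sub u (pPt η z Λ 0)]
      ring
    have hn1 := firstNorm_succ (f := f) (t := 2 * η) (δ := qPt η z Λ 0 - pPt η z Λ 0)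
      (lam := lam) hge
    have hn2 := firstNorm_add_one (f := f) (t := 2 * η) (δ := qPt η z Λ 0 - pPt η z Λ 0)
      (lam := lam) hge hk (by rw [← hδ]; exact hNk hge)
    have eX : lam + n * (2 * η) - (qPt η z Λ 0 - pPt η z Λ 0) + 2 * k * (2 * η) = X := by
      rw [hX, hδ]; ring
    rw [eX] at hn1 hn2
    rw [s1, s2, s3, hn1, coefD, coefB, leaveWeight, hf.odd (X + 2 * η)]
    rw [hf.odd (X + 2 * η)] at hrow
    generalize (∑ j ∈ Q, f (2 * η) * f (-(X + 2 * η) - w + j)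
          / f (w - j) * f (lam - qPt η z Λ 0 + 2 * η * N + j) * ∏ u ∈ Q.erase j,
            f (u - j - 2 * η) / f (u - j) * f (u - (pPt η z Λ 0 + 2 * η * k))) = S at hrow ⊢
    generalize ∏ u ∈ Q, 1 / f (u - pPt η z Λ 0) = P
    generalize (∏ u ∈ Q, f (u - w - 2 * η) / f (u - w) * f (u - (pPt η z Λ 0 + 2 * η * k)))
      = T at hrow ⊢
    generalize ∏ u ∈ Q, f (u - (pPt η z Λ 0 + 2 * η * k) - 2 * η) = R at hrow ⊢
    generalize firstNorm f (2 * η) (qPt η z Λ 0 - pPt η z Λ 0) lam N k n = F at hn2 ⊢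
    generalize firstNorm f (2 * η) (qPt η z Λ 0 - pPt η z Λ 0) lam N (k + 1) n = F₁ at hn2 ⊢
    generalize f (lam + n * (2 * η) + w - qPt η z Λ 0 + (k + 1) * (2 * η)) = A at hrow ⊢
    generalize f (lam - (qPt η z Λ 0 - pPt η z Λ 0) + (N + k) * (2 * η)) = C at hrow hn2
    generalize f (w - pPt η z Λ 0 - k * (2 * η)) = B at hrow ⊢
    generalize f (lam + w - qPt η z Λ 0 + 2 * η * N) = E at hrow ⊢
    generalize f (lam + n * (2 * η) - (qPt η z Λ 0 - pPt η z Λ 0) + k * (2 * η)) = e at hn2 ⊢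
    generalize f (X + 2 * η) = x₁ at *
    generalize f X = x₀ at *
    generalize f (lam + n * (2 * η)) = l at *
    generalize f (w - qPt η z Λ 0) = g
    have hrow' : B * S = A * C * R - x₁ * E * T := by linear_combination -hrow
    have : B * e / (g * l) * F / x₀ * (P * S / -x₁) = - (e * F * P / (g * l * x₀ * x₁)) * (B * S) := by
      ring
    rw [this, hrow']
    have h3 : -(A * f (2 * η) / (g * l)) * F₁ * (P * R) = -(A * P * R / (g * l)) * (f (2 * η) * F₁) := by
      ring
    rw [h3, hn2]
    linear_combination (e * F * P * E * T / (g * l * x₀)) * mul_inv_cancel₀ hX1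

theorem colCD_rowD (hf : SigmaLike f) (ht : f (2 * η) ≠ 0) (lam : ℂ) (T N r : ℕ)
    (hL : ∀ l j : ℕ, 1 ≤ l → j < T → f (lam - 2 * η * LamSum Λ l + 2 * η * j) ≠ 0)
    (V : Finset ℂ) (hT : V.card + 1 + 2 * N ≤ T)
    (hwq : ∀ l, f (w - qPt η z Λ l) ≠ 0)
    (hU : ∀ u ∈ V, ∀ v ∈ V, u ≠ v → f (u - v) ≠ 0) (hw : ∀ u ∈ V, f (w - u) ≠ 0)
    (hUq : ∀ l, ∀ u ∈ V, f (u - qPt η z Λ l) ≠ 0)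
    (hθ : ∀ u ∈ insert w V, tailRatio f η z Λ Θ r 1 u
      = f (u - qPt η z Λ 0) / f (u - pPt η z Λ 0)) (ν : Occ) (hν : numIn ν (r + 1) 0 = N) :
    Θ w * (colCD f η z Λ w (r + 1) 0 (lam + V.card * (2 * η)) (rowD f η z Λ Θ r lam N V) ν).2
      = rowD f η z Λ Θ r lam N (insert w V) ν := by
  have hwV : w ∉ V := fun h => hf.ne_of_map_sub_ne_zero (hw w h) rfl
  obtain ⟨k, hk⟩ : ∃ k, ν 0 = k := ⟨_, rfl⟩
  rw [numIn, hk, zero_add] at hν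
  set n := V.card with hn
  set X := lam + n * (2 * η) - 2 * η * Λ 0 + 2 * (2 * η) * (k : ℂ) with hX
  have hX' : lam + n * (2 * η) - 2 * η * Λ 0 + 2 * (2 * η) * ((k + 1 : ℕ) : ℂ)
      = X + 2 * η + 2 * η := by rw [hX]; push_cast; ring
  have hS : LamSum Λ 1 = Λ 0 := by simp [LamSum]
  have hlab : X = lam - 2 * η * LamSum Λ 1 + 2 * η * ((n + 2 * k : ℕ) : ℂ) := by
    rw [hX, hS]; push_cast; ring
  have hlab' : X + 2 * η + 2 * η
      = lam - 2 * η * LamSum Λ 1 + 2 * η * ((n + 2 * k + 2 : ℕ) : ℂ) := by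
    rw [hX, hS]; push_cast; ring
  have hX0 : f X ≠ 0 := by rw [hlab]; exact hL 1 _ le_rfl (by omega)
  have hc : ∀ (x : ℂ) (J : ℕ), x = lam - 2 * η * LamSum Λ 1 + 2 * η * (J : ℂ) → ∀ I ⊆ V,
      J + 2 * I.card + 1 ≤ T → ∀ κ, _ :=
    fun x J hx I (hI : I ⊆ V) h κ => colCD_betheD (Θ := Θ) (z := z) hf ht lam T hL hwq r 1 J le_rfl
      x hx I h (fun u hu v hv => hU u (hI hu) v (hI hv)) (fun u hu => hw u (hI hu))
      (fun l u hu => hUq l u (hI hu)) κ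
  have h1 : Θ w * (colCD f η z Λ w r 1 X (rowD f η z Λ Θ r lam N V) ν).2
      = firstNorm f (2 * η) (qPt η z Λ 0 - pPt η z Λ 0) lam N k n / f X
        * splitSum f (2 * η) (leaveWeight f η z Λ lam N) (stayWeight f η z Λ k) (N - k)
        (dActN f (2 * η) (tailRatio f η z Λ Θ r 1) (-(X + 2 * η)) w
          (betheD f η z Λ Θ r 1 (X + 2 * η + 2 * η) ν)) V := by
    rw [(colCD_rowD_rest r lam N k V ν hk X rfl).2, mul_left_comm, ← splitSum_const_mul,
      splitSum_congr fun I hI hIc => (hc X _ hlab I hI (by omega) ν).2 (by omega),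
      splitSum_const_mul]
    ring
  have h2 : Θ w * (colCD f η z Λ w r 1 (X + 2 * η + 2 * η) (rowD f η z Λ Θ r lam N V)
      (ν.update 0 (k + 1))).1
      = firstNorm f (2 * η) (qPt η z Λ 0 - pPt η z Λ 0) lam N (k + 1) n
        * ∑ I ∈ predSubsets V (N - k), (∏ u ∈ I, leaveWeight f η z Λ lam N u)
          * (∏ y ∈ V \ I, stayWeight f η z Λ (k + 1) y) * cross f (2 * η) (V \ I) I
          * betheD f η z Λ Θ r 1 (X + 2 * η + 2 * η) ν (insert w I) := by
    rcases Nat.eq_zero_or_pos (N - k) with h0 | h0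
    · rw [colCD_fst_eq_zero (by rw [numIn_update _ _ (by omega)]; omega), h0, predSubsets_zero]
      simp
    · rw [(colCD_rowD_rest r lam N (k + 1) V _ (update_apply_self _ _ _) _ hX'.symm).1,
        mul_left_comm, ← splitSum_const_mul, show N - k = N - (k + 1) + 1 by omega,
        predSubsets_succ, splitSum_congr fun I hI hIc => (hc _ _ hlab' I hI (by omega)
          (ν.update 0 (k + 1))).1 (by rw [numIn_update _ _ (by omega)]; omega), splitSum]
      simp only [show betheD f η z Λ Θ r 1 (X + 2 * η + 2 * η) (ν.update 0 (k + 1))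
        = betheD f η z Λ Θ r 1 (X + 2 * η + 2 * η) ν from betheD_update ν r 0 (k + 1) _, hn]
  have hcard : (insert w V).card = n + 1 := Finset.card_insert_of_notMem hwV
  have hlast : lam + ((n + 1 : ℕ) : ℂ) * (2 * η) - 2 * η * Λ 0 + 2 * (2 * η) * (k : ℂ) + 2 * η
      = X + 2 * η + 2 * η := by rw [hX]; push_cast; ring
  rw [colCD, hk, hX', zero_add, ← hX, mul_add, mul_left_comm, h2, mul_left_comm (Θ w), h1, rowD, hcard,
    hk, hlast, ← splitSum_step (leaveWeight f η z Λ lam N) (stayWeight f η z Λ k)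
      (stayWeight f η z Λ (k + 1)) (tailRatio f η z Λ Θ r 1) (-(X + 2 * η)) w
      (coefD f (2 * η) (pPt η z Λ 0) (qPt η z Λ 0) (lam + n * (2 * η)) w k
        * firstNorm f (2 * η) (qPt η z Λ 0 - pPt η z Λ 0) lam N k n / f X)
      (coefB f (2 * η) (qPt η z Λ 0) (lam + n * (2 * η)) w k
        * firstNorm f (2 * η) (qPt η z Λ 0 - pPt η z Λ 0) lam N (k + 1) n) _ _ _ hwV]
  · ring
  · intro hm
    have eX : lam + n * (2 * η) - (qPt η z Λ 0 - pPt η z Λ 0) + 2 * k * (2 * η) = X := by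
      rw [hX, two_eta_mul (z := z)]; ring
    rw [hθ w (Finset.mem_insert_self _ _), firstNorm_succ (by omega), eX, coefD, stayWeight,
      mul_comm (2 * η) (k : ℂ)]
    have := hwq 0
    field_simp
  · intro Q hQ hQc hm
    refine rowD_scalar_identity hf ht lam N k n X hX (by omega) Q (by omega) ?_ ?_ _
      (fun u hu => hθ u (Finset.mem_insert_of_mem (hQ hu)))
      (fun u hu v hv => hU u (hQ hu) v (hQ hv)) (fun u hu => hw u (hQ hu))
      (fun u hu => hUq 0 u (hQ hu))
    · rw [show X + 2 * η = lam - 2 * η * LamSum Λ 1 + 2 * η * ((n + 2 * k + 1 : ℕ) : ℂ) by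
        rw [hlab]; push_cast; ring]
      exact hL 1 _ le_rfl (by omega)
    · intro h
      rw [show lam - 2 * η * Λ 0 + (N + k) * (2 * η)
        = lam - 2 * η * LamSum Λ 1 + 2 * η * ((N + k : ℕ) : ℂ) by rw [hS]; push_cast; ring]
      exact hL 1 _ le_rfl (by omega)

end RowD

section Volume

variable {f : ℂ → ℂ} {η : ℂ} {z Λ : ℕ → ℂ} {lam w : ℂ}

theorem rowBD_basisVec_snd_eq_zero {n : ℕ} {κ ρ : Occ}
    (h : ¬((∀ i, n ≤ i → κ i = ρ i) ∧ numBelow κ n = numBelow ρ n)) :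
    (rowBD f η z Λ lam w n (basisVec κ) ρ).2 = 0 := by
  rw [(rowBD_congr_sum (∅ : Finset ℕ) (fun _ => 0) (fun _ _ => 0) n (basisVec κ) ρ).2,
    Finset.sum_empty]
  intro κ' h1 h2
  have hne : κ ≠ κ' := by
    rintro rfl
    exact h ⟨h1, h2⟩
  simp [basisVec, hne]

theorem rowBD_basisVec_fst_eq_zero {n : ℕ} {κ ρ : Occ} (h : κ n ≠ ρ n) :
    (rowBD f η z Λ lam w n (basisVec κ) ρ).1 = 0 := by
  rw [(rowBD_congr_sum (∅ : Finset ℕ) (fun _ => 0) (fun _ _ => 0) n (basisVec κ) ρ).1,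
    Finset.sum_empty]
  intro κ' h1 h2
  have hne : κ ≠ κ' := by
    rintro rfl
    exact h (h1 n le_rfl)
  simp [basisVec, hne]

theorem opD_basisVec_apply (hf : SigmaLike f) (n : ℕ) (κ ρ : Occ) :
    opD f η z Λ n lam w (basisVec κ) ρ = (rowBD f η z Λ lam w n (basisVec κ) ρ).2 :=
  congrArg Prod.snd (monodromy_apply_eq_rowBD hf n (basisVec κ) ρ)

theorem opD_succ_apply (hf : SigmaLike f) {n : ℕ} {κ : Occ} (hκ : κ n = 0) (ρ : Occ) :
    opD f η z Λ (n + 1) lam w (basisVec κ) ρ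
      = coefD f (2 * η) (pPt η z Λ n) (qPt η z Λ n) (dynPar η Λ n lam ρ) w 0
        * opD f η z Λ n lam w (basisVec κ) ρ := by
  have h1 : (rowBD f η z Λ lam w n (basisVec κ) (ρ.update n (ρ n + 1))).1 = 0 :=
    rowBD_basisVec_fst_eq_zero (by rw [hκ, update_apply_self]; omega)
  simp only [opD_basisVec_apply hf, rowBD, h1, mul_zero, zero_add]
  by_cases h : ρ n = 0
  · rw [h]
  · rw [rowBD_basisVec_snd_eq_zero fun h' => h (by rw [← h'.1 n le_rfl, hκ]), mul_zero, mul_zero]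

/-- The normalization of the operators in `V_0 ⊗ ⋯ ⊗ V_{K-1}`. -/
def volRatio (f : ℂ → ℂ) (η : ℂ) (z Λ : ℕ → ℂ) (K : ℕ) (u : ℂ) : ℂ :=
  ∏ i ∈ Finset.range K, f (u - qPt η z Λ i) / f (u - pPt η z Λ i)

theorem tailRatio_volRatio {u : ℂ} (hp : ∀ l, f (u - pPt η z Λ l) ≠ 0)
    (hq : ∀ l, f (u - qPt η z Λ l) ≠ 0) (r s : ℕ) :
    tailRatio f η z Λ (volRatio f η z Λ (s + r)) r s u = volRatio f η z Λ s u := by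
  induction r generalizing s with
  | zero => rfl
  | succ r ih =>
    rw [tailRatio, show s + (r + 1) = s + 1 + r by omega, ih, volRatio, Finset.prod_range_succ,
      mul_assoc, div_mul_div_cancel₀ (hp s), div_self (hq s), mul_one, volRatio]

theorem DVol_eq (hf : SigmaLike f) (κ ρ : Occ) (m : ℕ) :
    DVol f η z Λ lam w κ ρ m = volRatio f η z Λ (m + 1) w
      * (1 / f (lam - 2 * η * LamSum Λ (m + 1) + 2 * (2 * η) * (len κ : ℂ)))
      * opD f η z Λ (m + 1) lam w (basisVec κ) ρ := by
  rw [DVol]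
  congr 2
  · refine Finset.prod_congr rfl fun i _ => ?_
    rw [← neg_div_neg_eq, ← hf.odd, ← hf.odd]
    congr 2 <;> simp only [qPt, pPt] <;> ring
  · congr 2
    ring

theorem DVol_succ (hf : SigmaLike f) (hp : ∀ l, f (w - pPt η z Λ l) ≠ 0)
    (hq : ∀ l, f (w - qPt η z Λ l) ≠ 0) {κ : Occ}
    (hL : ∀ l, 1 ≤ l → f (lam - 2 * η * LamSum Λ l + 2 * (2 * η) * (len κ : ℂ)) ≠ 0) (ρ : Occ) {m : ℕ}
    (hκ : ∀ i, m + 1 ≤ i → κ i = 0) :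
    DVol f η z Λ lam w κ ρ (m + 1) = DVol f η z Λ lam w κ ρ m := by
  rw [DVol_eq hf, DVol_eq hf, opD_succ_apply hf (hκ _ le_rfl)]
  by_cases h : numBelow κ (m + 1) = numBelow ρ (m + 1)
  · rw [← len_eq_numBelow hκ] at h
    have e1 : dynPar η Λ (m + 1) lam ρ
        = lam - 2 * η * LamSum Λ (m + 1) + 2 * (2 * η) * (len κ : ℂ) := by
      rw [dynPar_eq, h]
    have e2 : lam - 2 * η * LamSum Λ (m + 1) + 2 * (2 * η) * (len κ : ℂ)
        - (qPt η z Λ (m + 1) - pPt η z Λ (m + 1))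
        = lam - 2 * η * LamSum Λ (m + 1 + 1) + 2 * (2 * η) * (len κ : ℂ) := by
      rw [← two_eta_mul, LamSum, LamSum, Finset.sum_range_succ _ (m + 1)]
      ring
    rw [coefD, e1, Nat.cast_zero, zero_mul, sub_zero, add_zero, e2, volRatio,
      Finset.prod_range_succ, ← volRatio]
    have h1 := hL (m + 1) (by omega)
    have h2 := hL (m + 1 + 1) (by omega)
    have h3 := hp (m + 1)
    have h4 := hq (m + 1)
    generalize f (lam - 2 * η * LamSum Λ (m + 1) + 2 * (2 * η) * (len κ : ℂ)) = A at *
    generalize f (lam - 2 * η * LamSum Λ (m + 1 + 1) + 2 * (2 * η) * (len κ : ℂ)) = B at *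
    generalize f (w - pPt η z Λ (m + 1)) = P at *
    generalize f (w - qPt η z Λ (m + 1)) = Q at *
    field_simp
  · rw [opD_basisVec_apply hf, rowBD_basisVec_snd_eq_zero fun h' => h h'.2]
    simp only [mul_zero]

theorem tendsto_DVol (hf : SigmaLike f) (hp : ∀ l, f (w - pPt η z Λ l) ≠ 0)
    (hq : ∀ l, f (w - qPt η z Λ l) ≠ 0) {κ : Occ}
    (hL : ∀ l, 1 ≤ l → f (lam - 2 * η * LamSum Λ l + 2 * (2 * η) * (len κ : ℂ)) ≠ 0) (ρ : Occ) {m : ℕ}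
    (hκ : ∀ i, m + 1 ≤ i → κ i = 0) :
    Tendsto (DVol f η z Λ lam w κ ρ) atTop (𝓝 (DVol f η z Λ lam w κ ρ m)) := by
  refine tendsto_const_nhds.congr' ?_
  filter_upwards [eventually_ge_atTop m] with k hk
  induction k, hk using Nat.le_induction with
  | base => rfl
  | succ k hk ih => rw [ih, DVol_succ hf hp hq hL ρ fun i hi => hκ i (by omega)]

theorem DOne_eq (hf : SigmaLike f) (hp : ∀ l, f (w - pPt η z Λ l) ≠ 0)
    (hq : ∀ l, f (w - qPt η z Λ l) ≠ 0) {κ : Occ}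
    (hL : ∀ l, 1 ≤ l → f (lam - 2 * η * LamSum Λ l + 2 * (2 * η) * (len κ : ℂ)) ≠ 0) (ρ : Occ) {m : ℕ}
    (hκ : ∀ i, m + 1 ≤ i → κ i = 0) :
    DOne f η z Λ lam w κ ρ = DVol f η z Λ lam w κ ρ m :=
  (tendsto_DVol hf hp hq hL ρ hκ).limUnder_eq

theorem exists_bound (κ : Occ) : ∃ m, ∀ i, m + 1 ≤ i → κ i = 0 :=
  ⟨κ.support.sup id, fun i hi => by
    by_contra h
    have := Finset.le_sup (f := id) (Finsupp.mem_support_iff.2 h)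
    simp only [id] at this
    omega⟩

theorem tendsto_DOne (hf : SigmaLike f) (hp : ∀ l, f (w - pPt η z Λ l) ≠ 0)
    (hq : ∀ l, f (w - qPt η z Λ l) ≠ 0) {κ : Occ}
    (hL : ∀ l, 1 ≤ l → f (lam - 2 * η * LamSum Λ l + 2 * (2 * η) * (len κ : ℂ)) ≠ 0) (ρ : Occ) :
    Tendsto (DVol f η z Λ lam w κ ρ) atTop (𝓝 (DOne f η z Λ lam w κ ρ)) := by
  obtain ⟨m, hm⟩ := exists_bound κ
  rw [DOne_eq hf hp hq hL ρ hm]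
  exact tendsto_DVol hf hp hq hL ρ hm

/-- The occupation numbers with `N` particles in the factors `V_0, …, V_r`. -/
def occSet (r N : ℕ) : Finset Occ := (Finset.range (r + 1)).finsuppAntidiag N

theorem mem_occSet {r N : ℕ} {ν : Occ} :
    ν ∈ occSet r N ↔ (∀ i, r + 1 ≤ i → ν i = 0) ∧ numBelow ν (r + 1) = N := by
  rw [occSet, Finset.mem_finsuppAntidiag, and_comm, numBelow]
  refine and_congr_left fun _ => ⟨fun h i hi => ?_, fun h i hi => ?_⟩
  · by_contra h'
    have := Finset.mem_range.1 (h (Finsupp.mem_support_iff.2 h'))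
    omega
  · rw [Finset.mem_range]
    by_contra h'
    exact Finsupp.mem_support_iff.1 hi (h i (by omega))

theorem len_of_mem_occSet {r N : ℕ} {ν : Occ} (h : ν ∈ occSet r N) : len ν = N := by
  rw [mem_occSet] at h
  rw [len_eq_numBelow h.1, h.2]

theorem mem_occSet_of_opD_ne_zero (hf : SigmaLike f) {r N : ℕ} {κ ρ : Occ} (hκ : κ ∈ occSet r N)
    (h : opD f η z Λ (r + 1) lam w (basisVec κ) ρ ≠ 0) : ρ ∈ occSet r N := by
  rw [opD_basisVec_apply hf] at h
  rw [mem_occSet] at hκ ⊢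
  by_cases h' : (∀ i, r + 1 ≤ i → κ i = ρ i) ∧ numBelow κ (r + 1) = numBelow ρ (r + 1)
  · exact ⟨fun i hi => by rw [← h'.1 i hi, hκ.1 i hi], by rw [← h'.2, hκ.2]⟩
  · exact absurd (rowBD_basisVec_snd_eq_zero h') h

theorem mem_occSet_of_DOne_ne_zero (hf : SigmaLike f) (hp : ∀ l, f (w - pPt η z Λ l) ≠ 0)
    (hq : ∀ l, f (w - qPt η z Λ l) ≠ 0) {r N : ℕ}
    (hL : ∀ l, 1 ≤ l → f (lam - 2 * η * LamSum Λ l + 2 * (2 * η) * (N : ℂ)) ≠ 0) {κ ρ : Occ}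
    (hκ : κ ∈ occSet r N) (h : DOne f η z Λ lam w κ ρ ≠ 0) : ρ ∈ occSet r N := by
  rw [DOne_eq hf hp hq (by rwa [len_of_mem_occSet hκ]) ρ (mem_occSet.1 hκ).1, DVol_eq hf] at h
  exact mem_occSet_of_opD_ne_zero hf hκ (right_ne_zero_of_mul h)

theorem sum_mul_DOne (hf : SigmaLike f) (hp : ∀ l, f (w - pPt η z Λ l) ≠ 0)
    (hq : ∀ l, f (w - qPt η z Λ l) ≠ 0) {r N : ℕ}
    (hL : ∀ l, 1 ≤ l → f (lam - 2 * η * LamSum Λ l + 2 * (2 * η) * (N : ℂ)) ≠ 0) {κ : Occ}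
    (hκ : κ ∈ occSet r N) (g : Occ → ℂ) :
    ∑ ρ ∈ occSet r N, g ρ * DOne f η z Λ lam w κ ρ
      = volRatio f η z Λ (r + 1) w * (colCD f η z Λ w (r + 1) 0 lam g κ).2 := by
  have h0 : dynPar η Λ 0 lam κ = lam := by simp [dynPar, prefixWeight]
  have h1 := congrArg Prod.snd (segMat_basisVec (f := f) (z := z) (Λ := Λ) (η := η) (w := w) hf lam g
    (r + 1) 0 κ)
  rw [h0, zero_add, ← monodromy_eq_segMat] at h1
  simp only at h1
  rw [← h1, Finsupp.linearCombination_apply, Finsupp.sum_of_support_subset (s := occSet r N),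
    Finset.mul_sum]
  · refine Finset.sum_congr rfl fun ρ hρ => ?_
    rw [DOne_eq hf hp hq (by rwa [len_of_mem_occSet hκ]) ρ (mem_occSet.1 hκ).1, DVol_eq hf, dynPar_eq,
      (mem_occSet.1 hρ).2, len_of_mem_occSet hκ, smul_eq_mul, opD]
    ring
  · exact fun ρ hρ => mem_occSet_of_opD_ne_zero hf hκ (Finsupp.mem_support_iff.1 hρ)
  · simp

theorem DSkew_support (r N n : ℕ) (lam : ℂ) (w : Fin n → ℂ)
    (H : ∀ k : Fin n, ∀ κ ∈ occSet r N, ∀ ρ,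
      DOne f η z Λ (lam + 2 * η * (k : ℕ)) (w k) κ ρ ≠ 0 → ρ ∈ occSet r N)
    {ν : Occ} (hν : ν ∈ occSet r N) (μ : Occ) (h : DSkew f η z Λ n lam w ν μ ≠ 0) :
    μ ∈ occSet r N := by
  induction n generalizing lam μ with
  | zero =>
    rw [DSkew] at h
    split_ifs at h with h'
    · rwa [← h']
    · exact absurd rfl h
  | succ n ih =>
    rw [DSkew] at h
    obtain ⟨κ, hκ⟩ : ∃ κ, DOne f η z Λ lam (w 0) κ μ
        * DSkew f η z Λ n (lam + 2 * η) (Fin.tail w) ν κ ≠ 0 := by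
      by_contra! h'
      exact h ((finsum_congr h').trans finsum_zero)
    refine H 0 κ (ih (lam + 2 * η) (Fin.tail w) (fun k κ hκ ρ h => H k.succ κ hκ ρ ?_) κ
      (right_ne_zero_of_mul hκ)) μ (by simpa using left_ne_zero_of_mul hκ)
    rwa [show lam + 2 * η * ((k.succ : Fin (n + 1)) : ℕ) = lam + 2 * η + 2 * η * (k : ℕ) by
      rw [Fin.val_succ]; push_cast; ring]

theorem DSkew_succ_eq_sum (r N n : ℕ) (lam : ℂ) (w : Fin (n + 1) → ℂ)
    (H : ∀ k : Fin (n + 1), ∀ κ ∈ occSet r N, ∀ ρ,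
      DOne f η z Λ (lam + 2 * η * (k : ℕ)) (w k) κ ρ ≠ 0 → ρ ∈ occSet r N)
    {ν : Occ} (hν : ν ∈ occSet r N) (μ : Occ) :
    DSkew f η z Λ (n + 1) lam w ν μ = ∑ κ ∈ occSet r N,
      DOne f η z Λ lam (w 0) κ μ * DSkew f η z Λ n (lam + 2 * η) (Fin.tail w) ν κ := by
  rw [DSkew]
  refine finsum_eq_sum_of_support_subset _ fun κ hκ => ?_
  refine DSkew_support r N n (lam + 2 * η) (Fin.tail w) (fun k κ hκ ρ h => H k.succ κ hκ ρ ?_) hν κ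
    (right_ne_zero_of_mul hκ)
  rwa [show lam + 2 * η * ((k.succ : Fin (n + 1)) : ℕ) = lam + 2 * η + 2 * η * (k : ℕ) by
    rw [Fin.val_succ]; push_cast; ring]

/-- The branching rule that splits off the last variable. -/
theorem DSkew_succ_eq_sum_last (r N n : ℕ) (lam : ℂ) (w : Fin (n + 1) → ℂ)
    (H : ∀ k : Fin (n + 1), ∀ κ ∈ occSet r N, ∀ ρ,
      DOne f η z Λ (lam + 2 * η * (k : ℕ)) (w k) κ ρ ≠ 0 → ρ ∈ occSet r N)
    {ν : Occ} (hν : ν ∈ occSet r N) (μ : Occ) :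
    DSkew f η z Λ (n + 1) lam w ν μ = ∑ κ ∈ occSet r N, DSkew f η z Λ n lam (Fin.init w) κ μ
      * DOne f η z Λ (lam + 2 * η * n) (w (Fin.last n)) ν κ := by
  induction n generalizing lam μ with
  | zero =>
    have h0 := H 0 ν hν μ
    simp only [Fin.val_zero, Nat.cast_zero, mul_zero, add_zero] at h0
    rw [DSkew, finsum_eq_single _ ν fun κ hκ => by simp [DSkew, hκ.symm]]
    simp only [DSkew, Nat.cast_zero, mul_zero, add_zero, ite_mul, one_mul, zero_mul, if_true, mul_one,
      Finset.sum_ite_eq', Fin.last_zero]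
    split_ifs with h
    · rfl
    · exact not_imp_comm.1 h0 h
  | succ n ih =>
    have e : ∀ k : ℕ, lam + 2 * η * ((k + 1 : ℕ) : ℂ) = lam + 2 * η + 2 * η * (k : ℕ) := by
      intro k
      push_cast
      ring
    have H' : ∀ k : Fin (n + 1), ∀ κ ∈ occSet r N, ∀ ρ,
        DOne f η z Λ (lam + 2 * η + 2 * η * (k : ℕ)) (Fin.tail w k) κ ρ ≠ 0 → ρ ∈ occSet r N :=
      fun k κ hκ ρ h => H k.succ κ hκ ρ (by rw [Fin.val_succ, e]; exact h)
    have H'' : ∀ k : Fin (n + 1), ∀ κ ∈ occSet r N, ∀ ρ,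
        DOne f η z Λ (lam + 2 * η * (k : ℕ)) (Fin.init w k) κ ρ ≠ 0 → ρ ∈ occSet r N :=
      fun k κ hκ ρ h => H k.castSucc κ hκ ρ h
    rw [DSkew_succ_eq_sum r N (n + 1) lam w H hν]
    have h2 := Finset.sum_congr (rfl : occSet r N = occSet r N) fun κ hκ => congrArg
      (· * DOne f η z Λ (lam + 2 * η * (n + 1 : ℕ)) (w (Fin.last (n + 1))) ν κ)
      (DSkew_succ_eq_sum r N n lam (Fin.init w) H'' hκ μ)
    refine Eq.trans ?_ h2.symm
    rw [Finset.sum_congr rfl fun κ _ => by rw [ih (lam + 2 * η) (Fin.tail w) H' κ]]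
    simp only [Finset.mul_sum, Finset.sum_mul]
    rw [Finset.sum_comm]
    refine Finset.sum_congr rfl fun κ _ => Finset.sum_congr rfl fun κ' _ => ?_
    rw [e, Fin.tail_init_eq_init_tail]
    exact (mul_assoc _ _ _).symm

theorem betheD_empty {Θ : ℂ → ℂ} (r s : ℕ) (x : ℂ) {ν : Occ} (h : ∀ i, s ≤ i → ν i = 0) :
    betheD f η z Λ Θ r s x ν ∅ = 1 := by
  induction r generalizing s x with
  | zero => rfl
  | succ r ih => rw [betheD, h s le_rfl, siteNorm_zero, blkSum_zero, one_mul,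
      ih _ _ fun i hi => h i (by omega)]

theorem rowD_empty {Θ : ℂ → ℂ} (r N : ℕ) (lam : ℂ) {ν : Occ} (hν : ν ∈ occSet r N) :
    rowD f η z Λ Θ r lam N ∅ ν = if ν = Finsupp.single 0 N then 1 else 0 := by
  have hν' := mem_occSet.1 hν
  rw [numBelow, Finset.sum_range_succ'] at hν'
  by_cases h0 : ν 0 = N
  · have h1 : ∀ i, 1 ≤ i → ν i = 0 := by
      intro i hi
      by_cases hr : r + 1 ≤ i
      · exact hν'.1 i hr
      · have h2 : ∑ i ∈ Finset.range r, ν (i + 1) = 0 := by omega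
        have := Finset.sum_eq_zero_iff.1 h2 (i - 1) (Finset.mem_range.2 (by omega))
        rwa [Nat.sub_add_cancel hi] at this
    have h2 : ν = Finsupp.single 0 N := by
      ext i
      by_cases hi : i = 0
      · subst hi; simp [h0]
      · rw [h1 i (by omega), Finsupp.single_eq_of_ne hi]
    rw [if_pos h2, rowD, h0, splitSum, Nat.sub_self, Finset.powersetCard_zero,
      Finset.sum_singleton, betheD_empty _ _ _ h1]
    simp [firstNorm, cross]
  · have h2 : ν ≠ Finsupp.single 0 N := by
      rintro rfl
      simp at h0
    rw [if_neg h2, rowD, splitSum, Finset.powersetCard_eq_empty.2, Finset.sum_empty, mul_zero]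
    rw [Finset.card_empty]
    omega

theorem numBelow_add_numIn (ν : Occ) (r s : ℕ) :
    numBelow ν s + numIn ν r s = numBelow ν (s + r) := by
  induction r generalizing s with
  | zero => simp [numIn]
  | succ r ih => rw [numIn, ← add_assoc, ← numBelow_succ, ih, Nat.add_right_comm, add_assoc]

theorem numIn_eq_numBelow (ν : Occ) (r : ℕ) : numIn ν r 0 = numBelow ν r := by
  simpa [numBelow] using numBelow_add_numIn ν r 0

theorem image_init_last {n : ℕ} (v : Fin (n + 1) → ℂ) :
    Finset.univ.image v = insert (v (Fin.last n)) (Finset.univ.image (Fin.init v)) := by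
  ext x
  simp only [Finset.mem_image, Finset.mem_univ, true_and, Finset.mem_insert, Fin.exists_fin_succ']
  exact or_comm.trans (or_congr eq_comm Iff.rfl)

theorem DSkew_eq_rowD (hf : SigmaLike f) (ht : f (2 * η) ≠ 0) (N r n : ℕ) (lam : ℂ)
    (hL : ∀ l j : ℕ, 1 ≤ l → j < n + 2 * N → f (lam - 2 * η * LamSum Λ l + 2 * η * j) ≠ 0)
    (v : Fin n → ℂ) (hp : ∀ i, ∀ l, f (v i - pPt η z Λ l) ≠ 0)
    (hq : ∀ i, ∀ l, f (v i - qPt η z Λ l) ≠ 0) (hv : ∀ i j, i ≠ j → f (v i - v j) ≠ 0)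
    {ν : Occ} (hν : ν ∈ occSet r N) :
    DSkew f η z Λ n lam v ν (Finsupp.single 0 N)
      = rowD f η z Λ (volRatio f η z Λ (r + 1)) r lam N (Finset.univ.image v) ν := by
  induction n generalizing ν with
  | zero => rw [DSkew, Finset.univ_eq_empty, Finset.image_empty, rowD_empty r N lam hν]
  | succ n ih =>
    have hL' : ∀ k : ℕ, k < n + 1 → ∀ l, 1 ≤ l →
        f (lam + 2 * η * k - 2 * η * LamSum Λ l + 2 * (2 * η) * (N : ℂ)) ≠ 0 := by
      intro k hk l hl
      convert hL l (k + 2 * N) hl (by omega) using 2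
      push_cast
      ring
    have H : ∀ k : Fin (n + 1), ∀ κ ∈ occSet r N, ∀ ρ,
        DOne f η z Λ (lam + 2 * η * (k : ℕ)) (v k) κ ρ ≠ 0 → ρ ∈ occSet r N :=
      fun k κ hκ ρ h => mem_occSet_of_DOne_ne_zero hf (hp k) (hq k) (hL' k k.isLt) hκ h
    have hinit : ∀ i j : Fin n, i ≠ j → f (Fin.init v i - Fin.init v j) ≠ 0 := fun i j hij =>
      hv _ _ fun h => hij (Fin.castSucc_injective n h)
    have hcard : (Finset.univ.image (Fin.init v)).card = n := by
      rw [Finset.card_image_of_injective _ (injective_of_map_sub_ne_zero hf hinit), Finset.card_univ,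
        Fintype.card_fin]
    have hmem : ∀ P : ℂ → Prop, (∀ i : Fin n, P (v i.castSucc)) →
        ∀ u ∈ Finset.univ.image (Fin.init v), P u := by
      intro P hP u hu
      obtain ⟨i, -, rfl⟩ := Finset.mem_image.1 hu
      exact hP i
    rw [DSkew_succ_eq_sum_last r N n lam v H hν, Finset.sum_congr rfl fun κ hκ => by
      rw [ih (fun l j hl hj => hL l j hl (by omega)) (Fin.init v) (fun i => hp i.castSucc)
        (fun i => hq i.castSucc) hinit hκ],
      sum_mul_DOne hf (hp _) (hq _) (hL' n (by omega)) hν, image_init_last,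
      ← colCD_rowD hf ht lam (n + 1 + 2 * N) N r hL _ (by omega) (hq _), hcard, mul_comm (2 * η)]
    · intro u hu u' hu' huu
      obtain ⟨i, -, rfl⟩ := Finset.mem_image.1 hu
      obtain ⟨j, -, rfl⟩ := Finset.mem_image.1 hu'
      exact hinit i j fun h => huu (by rw [h])
    · exact hmem _ fun i => hv _ _ (Fin.castSucc_lt_last i).ne'
    · exact fun l => hmem _ fun i => hq _ l
    · rw [← image_init_last]
      intro u hu
      obtain ⟨i, -, rfl⟩ := Finset.mem_image.1 hu
      rw [add_comm r 1, tailRatio_volRatio (hp i) (hq i)]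
      simp [volRatio]
    · rw [numIn_eq_numBelow, (mem_occSet.1 hν).2]

end Volume

section FormulaD

variable {f : ℂ → ℂ} {η : ℂ} {z Λ : ℕ → ℂ} {lam : ℂ}

/-- The parts of a signature in `{s, …, s + r - 1}`, in increasing order. -/
def ascList (ν : Occ) : ℕ → ℕ → List ℕ
  | 0, _ => []
  | r + 1, s => List.replicate (ν s) s ++ ascList ν r (s + 1)

theorem length_ascList (ν : Occ) (r s : ℕ) : (ascList ν r s).length = numIn ν r s := by
  induction r generalizing s with
  | zero => rfl
  | succ r ih => rw [ascList, List.length_append, List.length_replicate, ih, numIn]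

theorem partList_add (ν : Occ) (r s : ℕ) :
    partList ν (s + r) = (ascList ν r s).reverse ++ partList ν s := by
  induction r generalizing s with
  | zero => rfl
  | succ r ih =>
    rw [show s + (r + 1) = s + 1 + r by omega, ih, ascList, partList, List.reverse_append,
      List.reverse_replicate, List.append_assoc]

/-- The weight of the variable `v` at a position with label `a` that is followed by `r`
positions. -/
def weightD (f : ℂ → ℂ) (η : ℂ) (z Λ : ℕ → ℂ) (y : ℂ) (N a r : ℕ) (v : ℂ) : ℂ :=
  -psi f η z Λ a v * f (-(y + pPt η z Λ a - 2 * η * LamSum Λ a + 2 * (2 * η) * (N : ℂ)) + v + 2 * η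
    + 2 * r * (2 * η))

/-- The part of `siteNorm` that is not absorbed by the symmetrization. -/
def siteFactor (f : ℂ → ℂ) (η : ℂ) (Λ : ℕ → ℂ) (y : ℂ) (ν : Occ) (i : ℕ) : ℂ :=
  ∏ j ∈ Finset.range (ν i), f (2 * η * (Λ i - j))
    / (f (y + 2 * η * (2 * numBelow ν i + ν i + j - LamSum Λ (i + 1)))
      * f (y + 2 * η * (2 * numBelow ν i + 1 + j - LamSum Λ i)))

theorem siteNorm_eq_siteFactor (y : ℂ) (ν : Occ) (i : ℕ) :
    siteNorm f (2 * η) (qPt η z Λ i - pPt η z Λ i)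
        (y + 2 * η - 2 * η * LamSum Λ i + 2 * (2 * η) * (numBelow ν i : ℂ)) (ν i)
      = (∏ j ∈ Finset.Icc 1 (ν i), f (j * (2 * η)) / f (2 * η)) * siteFactor f η Λ y ν i := by
  have h1 : ∀ g : ℕ → ℂ, ∏ j ∈ Finset.Icc 1 (ν i), g j = ∏ j ∈ Finset.range (ν i), g (j + 1) := by
    intro g
    rw [Finset.range_eq_Ico, Finset.prod_Ico_add' g 0 (ν i) 1]
    rfl
  have h2 : siteFactor f η Λ y ν i = ∏ j ∈ Finset.range (ν i), f (2 * η * (Λ i - j))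
      / (f (y + 2 * η * (2 * numBelow ν i + ν i + (ν i - 1 - j : ℕ) - LamSum Λ (i + 1)))
      * f (y + 2 * η * (2 * numBelow ν i + 1 + j - LamSum Λ i))) := by
    rw [siteFactor, Finset.prod_div_distrib, Finset.prod_div_distrib, Finset.prod_mul_distrib,
      Finset.prod_mul_distrib, Finset.prod_range_reflect (fun j : ℕ =>
      f (y + 2 * η * (2 * numBelow ν i + ν i + j - LamSum Λ (i + 1))))]
  rw [siteNorm, h1, h2, ← Finset.prod_mul_distrib, ← Finset.prod_mul_distrib]
  refine Finset.prod_congr rfl fun j hj => ?_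
  have hj' := Finset.mem_range.1 hj
  have e1 : qPt η z Λ i - pPt η z Λ i - j * (2 * η) = 2 * η * (Λ i - j) := by
    rw [← two_eta_mul]; ring
  have e2 : y + 2 * η - 2 * η * LamSum Λ i + 2 * (2 * η) * (numBelow ν i : ℂ) + j * (2 * η)
      = y + 2 * η * (2 * numBelow ν i + 1 + j - LamSum Λ i) := by ring
  have e3 : y + 2 * η - 2 * η * LamSum Λ i + 2 * (2 * η) * (numBelow ν i : ℂ)
      - (qPt η z Λ i - pPt η z Λ i) + 2 * (ν i : ℂ) * (2 * η) - 2 * (2 * η) - j * (2 * η)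
      = y + 2 * η * (2 * numBelow ν i + ν i + (ν i - 1 - j : ℕ) - LamSum Λ (i + 1)) := by
    rw [← two_eta_mul, LamSum, LamSum, Finset.sum_range_succ, Nat.sub_sub,
      Nat.cast_sub (by omega)]
    push_cast; ring
  rw [e1, e2, e3]
  push_cast
  ring

theorem betheD_eq_symSum (hf : SigmaLike f) (ht : f (2 * η) ≠ 0) (y : ℂ) (N : ℕ) (ν : Occ) (K : ℕ)
    (hN : numBelow ν K = N) (r s : ℕ) (hK : s + r = K) (x : ℂ)
    (hx : x = y + 2 * η - 2 * η * LamSum Λ s + 2 * (2 * η) * (numBelow ν s : ℂ))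
    (U : Finset ℂ) (hU : ∀ u ∈ U, ∀ v ∈ U, u ≠ v → f (u - v) ≠ 0)
    (hp : ∀ u ∈ U, ∀ l, f (u - pPt η z Λ l) ≠ 0) (hq : ∀ u ∈ U, ∀ l, f (u - qPt η z Λ l) ≠ 0) :
    betheD f η z Λ (volRatio f η z Λ K) r s x ν U
      = (-1) ^ numIn ν r s * (∏ i ∈ Finset.Ico s (s + r), siteFactor f η Λ y ν i)
        * symSum f (2 * η) (weightD f η z Λ y N) (ascList ν r s) U := by
  induction r generalizing s x U with
  | zero => simp [betheD, numIn, ascList, symSum]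
  | succ r ih =>
    have hX : x - 2 * η * Λ s + 2 * (2 * η) * (ν s : ℂ)
        = y + 2 * η - 2 * η * LamSum Λ (s + 1) + 2 * (2 * η) * (numBelow ν (s + 1) : ℂ) := by
      rw [hx, numBelow_succ, LamSum, LamSum, Finset.sum_range_succ]
      push_cast; ring
    have hnum : numBelow ν s + ν s + numIn ν r (s + 1) = N := by
      rw [← numBelow_succ, numBelow_add_numIn, ← hN, ← hK, Nat.add_right_comm, add_assoc]
    rw [ascList, symSum_replicate_append hf ht (g := fun u => -psi f η z Λ s u)
      (X := -(y + pPt η z Λ s - 2 * η * LamSum Λ s + 2 * (2 * η) * (N : ℂ))) (fun r u => rfl) _ _ _ hU,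
      betheD, hx, siteNorm_eq_siteFactor, ← hx, blkSum, Finset.prod_eq_prod_Ico_succ_bot
        (by omega), numIn, pow_add]
    simp only [Finset.mul_sum]
    refine Finset.sum_congr rfl fun I hI => ?_
    obtain ⟨hIU, hIc⟩ := Finset.mem_powersetCard.1 hI
    have hsub := Finset.sdiff_subset (s := U) (t := I)
    rw [ih (s + 1) (by omega) _ hX (U \ I) (fun u hu v hv => hU u (hsub hu) v (hsub hv))
      (fun u hu => hp u (hsub hu)) fun u hu => hq u (hsub hu), ← hIc]
    have h1 : ∀ u ∈ I, tailRatio f η z Λ (volRatio f η z Λ K) r (s + 1) u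
        * f (2 * η - (x - 2 * η * Λ s + 2 * (2 * η) * (ν s : ℂ)) + ν s * (2 * η) + u - qPt η z Λ s)
          / f (u - qPt η z Λ s)
        = -1 * (-psi f η z Λ s u * f (-(y + pPt η z Λ s - 2 * η * LamSum Λ s
          + 2 * (2 * η) * (N : ℂ)) + u + ν s * (2 * η)
          + 2 * (ascList ν r (s + 1)).length * (2 * η))) := by
      intro u hu
      have e : 2 * η - (x - 2 * η * Λ s + 2 * (2 * η) * (ν s : ℂ)) + ν s * (2 * η) + u - qPt η z Λ s
          = -(y + pPt η z Λ s - 2 * η * LamSum Λ s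
          + 2 * (2 * η) * (N : ℂ)) + u + ν s * (2 * η)
          + 2 * (ascList ν r (s + 1)).length * (2 * η) := by
        rw [length_ascList, hx, ← hnum, two_eta_mul (η := η) (z := z) (Λ := Λ) s]
        push_cast; ring
      have h2 := hq u (hIU hu) s
      rw [e, ← hK, show s + (r + 1) = s + 1 + r by omega,
        tailRatio_volRatio (hp u (hIU hu)) (hq u (hIU hu)), volRatio, Finset.prod_range_succ, psi]
      generalize f (-(y + pPt η z Λ s - 2 * η * LamSum Λ s
          + 2 * (2 * η) * (N : ℂ)) + u + ν s * (2 * η)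
          + 2 * (ascList ν r (s + 1)).length * (2 * η)) = A
      generalize f (u - qPt η z Λ s) = Q at *
      field_simp
    rw [← hIc] at h1
    rw [Finset.prod_congr rfl h1, Finset.prod_mul_distrib, Finset.prod_const,
      show s + 1 + r = s + (r + 1) by omega]
    ring

theorem sum_equiv_eq_symSum_rev {ι : Type*} [Fintype ι] [DecidableEq ι] (hf : SigmaLike f)
    (y : ℂ) (N n : ℕ) (hn : Fintype.card ι = n) {v : ι → ℂ} (hv : Function.Injective v)
    (a : Fin n → ℕ) :
    ∑ σ : Fin n ≃ ι,
      (∏ i : Fin n, ∏ j ∈ Finset.Ioi i, f (v (σ i) - v (σ j) + 2 * η) / f (v (σ i) - v (σ j)))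
      * ∏ i : Fin n, psi f η z Λ (a i) (v (σ i)) * f (y - v (σ i) + pPt η z Λ (a i) + 2 * η
          + 4 * η * ((N : ℂ) - ((i : ℕ) + 1 : ℂ)) - 2 * η * LamSum Λ (a i))
      = symSum f (2 * η) (weightD f η z Λ y N) (List.ofFn a).reverse (Finset.univ.image v) := by
  have hrev : (List.ofFn a).reverse = List.ofFn fun i => a i.rev := by
    refine List.ext_getElem (by simp) fun i h1 h2 => ?_
    simp only [List.getElem_reverse, List.getElem_ofFn, List.length_ofFn]
    congr 1
    ext
    simp only [Fin.val_rev]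
    omega
  rw [hrev, ← sum_equiv_symWeight n hn hv]
  refine Fintype.sum_equiv (Equiv.equivCongr Fin.revPerm (Equiv.refl ι)) _ _ fun σ => ?_
  rw [symWeight]
  congr 1
  · rw [Finset.prod_sigma', Finset.prod_sigma']
    refine Finset.prod_bij' (fun x _ => ⟨x.2.rev, x.1.rev⟩) (fun x _ => ⟨x.2.rev, x.1.rev⟩)
      ?_ ?_ ?_ ?_ ?_
    · rintro ⟨i, j⟩ h
      simpa using h
    · rintro ⟨i, j⟩ h
      simpa using h
    · rintro ⟨i, j⟩ _
      simp
    · rintro ⟨i, j⟩ _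
      simp
    · rintro ⟨i, j⟩ _
      have h1 : f (v (σ i) - v (σ j) + 2 * η) = -f (v (σ j) - v (σ i) - 2 * η) :=
        hf.map_eq_neg (by ring)
      simp only [Equiv.equivCongr_apply_apply, Fin.revPerm_symm, Fin.revPerm_apply, Fin.rev_rev,
        Equiv.refl_apply]
      rw [h1, hf.map_sub_comm (v (σ i)), neg_div_neg_eq]
  · refine Fintype.prod_equiv Fin.revPerm _ _ fun i => ?_
    simp only [Equiv.equivCongr_apply_apply, Fin.revPerm_symm, Fin.revPerm_apply, Fin.rev_rev,
        Equiv.refl_apply, weightD]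
    rw [neg_mul, ← mul_neg, ← hf.odd]
    congr 2
    have : n - 1 - (i.rev : ℕ) = i := by rw [Fin.val_rev]; omega
    rw [this]
    ring

theorem reverse_ofFn_castLE_eq_ascList {N : ℕ} {ν : Fin N → ℕ} (hν : Antitone ν) {r : ℕ}
    (hr : ∀ i, ν i < 1 + r) :
    (List.ofFn fun i : Fin (N - occ ν 0) => ν (Fin.castLE (Nat.sub_le N (occ ν 0)) i)).reverse
      = ascList (occ ν) r 1 := by
  have h1 := ofFn_eq_partList hν hr
  rw [partList_add] at h1
  have h2 := congrArg List.length h1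
  have h3 : (partList (occ ν) 1).length = occ ν 0 := by simp [partList]
  rw [List.length_append, h3, List.length_ofFn, List.length_reverse] at h2
  rw [← List.reverse_inj, List.reverse_reverse]
  have h4 := congrArg (List.take (N - occ ν 0)) h1
  rw [List.take_left' (by rw [List.length_reverse]; omega)] at h4
  rw [← h4]
  refine List.ext_getElem (by simp) fun i h1 h2 => ?_
  simp

theorem sum_powersetCard_image {α β M : Type*} [DecidableEq α] [DecidableEq β] [AddCommMonoid M]
    {v : α → β} (hv : Function.Injective v) (s : Finset α) (m : ℕ) (F : Finset β → M) :
    ∑ I ∈ (s.image v).powersetCard m, F I = ∑ I ∈ s.powersetCard m, F (I.image v) := by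
  have h1 := Finset.powersetCard_map ⟨v, hv⟩ m s
  rw [Finset.map_eq_image] at h1
  simp only [Function.Embedding.coeFn_mk] at h1
  rw [h1, Finset.sum_map]
  refine Finset.sum_congr rfl fun I _ => ?_
  simp [Finset.map_eq_image]

end FormulaD

section FormulaD

variable {f : ℂ → ℂ} {η : ℂ} {z Λ : ℕ → ℂ} {lam : ℂ}

theorem DFun_formula (hf : SigmaLike f) {N : ℕ} {ν : Fin N → ℕ} (hν : Antitone ν) {n : ℕ}
    (v : Fin n → ℂ) (ht : f (2 * η) ≠ 0)
    (hL : ∀ l k : ℕ, 1 ≤ l → k < n + 2 * N → f (lam - 2 * η * LamSum Λ l + 2 * η * k) ≠ 0)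
    (hpq : ∀ i, ∀ l : ℕ, f (v i - pPt η z Λ l) ≠ 0 ∧ f (v i - qPt η z Λ l) ≠ 0)
    (hv : ∀ i j, i ≠ j → f (v i - v j) ≠ 0) :
    DFun f η z Λ n lam v (occ ν) =
        f (2 * η) ^ (N - occ ν 0) / (∏ i ∈ Finset.range n, f (lam + 2 * η * i))
        * (∏ i ∈ Finset.Ico N (n + occ ν 0),
            f (lam + 2 * η * ((i : ℂ) - Λ 0)) / f (lam + 2 * η * ((i : ℂ) + occ ν 0 - Λ 0)))
        * (∏ i ∈ (occ ν).support.erase 0, ∏ j ∈ Finset.range (occ ν i),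
            f (2 * η * (Λ i - j))
              / (f (lam + 2 * η * n
                    + 2 * η * (2 * numBelow (occ ν) i + occ ν i + j - LamSum Λ (i + 1)))
                * f (lam + 2 * η * n
                    + 2 * η * (2 * numBelow (occ ν) i + 1 + j - LamSum Λ i))))
        * ∑ I ∈ (Finset.univ : Finset (Fin n)).powersetCard (N - occ ν 0),
            (∏ i ∈ I, f (lam + v i - qPt η z Λ 0 + 2 * η * N) / f (v i - qPt η z Λ 0))
            * (∏ j ∈ Iᶜ, f (v j - pPt η z Λ 0 - 2 * η * occ ν 0) / f (v j - pPt η z Λ 0))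
            * (∏ i ∈ I, ∏ j ∈ Iᶜ, f (v j - v i - 2 * η) / f (v j - v i))
            * ∑ σ : Fin (N - occ ν 0) ≃ I,
                (∏ i : Fin (N - occ ν 0), ∏ j ∈ Finset.Ioi i,
                  f (v (σ i) - v (σ j) + 2 * η) / f (v (σ i) - v (σ j)))
                * ∏ i : Fin (N - occ ν 0),
                    psi f η z Λ (ν (Fin.castLE (Nat.sub_le N (occ ν 0)) i)) (v (σ i))
                    * f (lam + 2 * η * n - v (σ i)
                        + pPt η z Λ (ν (Fin.castLE (Nat.sub_le N (occ ν 0)) i)) + 2 * η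
                        + 4 * η * ((N : ℂ) - ((i : ℕ) + 1 : ℂ))
                        - 2 * η * LamSum Λ (ν (Fin.castLE (Nat.sub_le N (occ ν 0)) i))) := by
  obtain ⟨r, hr⟩ := exists_bound (occ ν)
  have hr' : ∀ i, ν i < 1 + r := by
    intro i
    by_contra h
    exact (occ_apply_pos_iff ν (ν i)).2 ⟨i, rfl⟩ (hr _ (by omega))
  have hinj := injective_of_map_sub_ne_zero hf hv
  have hnum : numBelow (occ ν) (r + 1) = N := by rw [← len_eq_numBelow hr, len_occ]
  have hmem : occ ν ∈ occSet r N := mem_occSet.2 ⟨hr, hnum⟩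
  have hcard : (Finset.univ.image v).card = n := by
    rw [Finset.card_image_of_injective _ hinj, Finset.card_univ, Fintype.card_fin]
  have hnumIn : numIn (occ ν) r 1 = N - occ ν 0 := by
    have h1 := numIn_eq_numBelow (occ ν) (r + 1)
    rw [numIn, hnum, zero_add] at h1
    omega
  have hsupp : ∏ i ∈ (occ ν).support.erase 0, siteFactor f η Λ (lam + 2 * η * n) (occ ν) i
      = ∏ i ∈ Finset.Ico 1 (1 + r), siteFactor f η Λ (lam + 2 * η * n) (occ ν) i := by
    refine Finset.prod_subset (fun i hi => ?_) fun i hi hi' => ?_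
    · obtain ⟨h0, h1⟩ := Finset.mem_erase.1 hi
      rw [Finset.mem_Ico]
      refine ⟨by omega, ?_⟩
      by_contra h
      exact Finsupp.mem_support_iff.1 h1 (hr i (by omega))
    · have : occ ν i = 0 := by
        by_contra h
        exact hi' (Finset.mem_erase.2 ⟨by have := (Finset.mem_Ico.1 hi).1; omega,
          Finsupp.mem_support_iff.2 h⟩)
      rw [siteFactor, this, Finset.prod_range_zero]
  have hS : LamSum Λ 1 = Λ 0 := by simp [LamSum]
  have hB : numBelow (occ ν) 1 = occ ν 0 := by simp [numBelow]
  rw [DFun, len_occ, DSkew_eq_rowD hf ht N r n lam hL v (fun i l => (hpq i l).1)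
    (fun i l => (hpq i l).2) hv hmem, rowD, hcard, splitSum, sum_powersetCard_image hinj]
  have hterm : ∀ I ∈ (Finset.univ : Finset (Fin n)).powersetCard (N - occ ν 0),
      (∏ u ∈ I.image v, leaveWeight f η z Λ lam N u)
        * (∏ y ∈ Finset.univ.image v \ I.image v, stayWeight f η z Λ (occ ν 0) y)
        * cross f (2 * η) (Finset.univ.image v \ I.image v) (I.image v)
        * betheD f η z Λ (volRatio f η z Λ (r + 1)) r 1
          (lam + n * (2 * η) - 2 * η * Λ 0 + 2 * (2 * η) * (occ ν 0 : ℂ) + 2 * η) (occ ν) (I.image v)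
      = (-1) ^ (N - occ ν 0)
        * (∏ i ∈ (occ ν).support.erase 0, siteFactor f η Λ (lam + 2 * η * n) (occ ν) i)
        * ((∏ i ∈ I, f (lam + v i - qPt η z Λ 0 + 2 * η * N) / f (v i - qPt η z Λ 0))
            * (∏ j ∈ Iᶜ, f (v j - pPt η z Λ 0 - 2 * η * occ ν 0) / f (v j - pPt η z Λ 0))
            * (∏ i ∈ I, ∏ j ∈ Iᶜ, f (v j - v i - 2 * η) / f (v j - v i))
            * symSum f (2 * η) (weightD f η z Λ (lam + 2 * η * n) N) (ascList (occ ν) r 1)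
              (I.image v)) := by
    intro I hI
    have hU : ∀ u ∈ I.image v, ∃ i, u = v i := fun u hu => by
      obtain ⟨i, -, rfl⟩ := Finset.mem_image.1 hu
      exact ⟨i, rfl⟩
    rw [← Finset.image_sdiff _ _ hinj, ← Finset.compl_eq_univ_sdiff, cross,
      Finset.prod_image hinj.injOn, Finset.prod_image hinj.injOn, Finset.prod_image hinj.injOn,
      Finset.prod_congr rfl fun x _ => Finset.prod_image hinj.injOn, Finset.prod_comm,
      betheD_eq_symSum hf ht (lam + 2 * η * n) N (occ ν) (r + 1) hnum r 1 (by omega) _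
      (by rw [hS, hB]; ring), hnumIn, ← hsupp]
    · simp only [leaveWeight, stayWeight]
      ring
    · intro u hu u' hu' huu
      obtain ⟨i, rfl⟩ := hU u hu
      obtain ⟨j, rfl⟩ := hU u' hu'
      exact hv i j fun h => huu (by rw [h])
    · intro u hu l
      obtain ⟨i, rfl⟩ := hU u hu
      exact (hpq i l).1
    · intro u hu l
      obtain ⟨i, rfl⟩ := hU u hu
      exact (hpq i l).2
  rw [Finset.sum_congr rfl hterm, ← Finset.mul_sum, ← mul_assoc]
  congr 1
  · have e1 : ∀ i : ℕ, lam - (qPt η z Λ 0 - pPt η z Λ 0) + i * (2 * η)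
        = lam + 2 * η * ((i : ℂ) - Λ 0) := fun i => by rw [← two_eta_mul]; ring
    have e2 : ∀ i : ℕ, lam - (qPt η z Λ 0 - pPt η z Λ 0) + (i + (occ ν 0 : ℕ)) * (2 * η)
        = lam + 2 * η * ((i : ℂ) + occ ν 0 - Λ 0) := fun i => by rw [← two_eta_mul]; ring
    have e3 : ∀ i : ℕ, lam + i * (2 * η) = lam + 2 * η * i := fun i => by ring
    simp only [firstNorm, e1, e2, e3, siteFactor]
    rw [neg_pow]
    have h1 : ((-1 : ℂ) ^ (N - occ ν 0)) * (-1) ^ (N - occ ν 0) = 1 := by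
      rw [← mul_pow]; simp
    linear_combination ((f (2 * η) ^ (N - occ ν 0) / (∏ i ∈ Finset.range n, f (lam + 2 * η * i))
        * (∏ i ∈ Finset.Ico N (n + occ ν 0),
            f (lam + 2 * η * ((i : ℂ) - Λ 0)) / f (lam + 2 * η * ((i : ℂ) + occ ν 0 - Λ 0)))
        * (∏ i ∈ (occ ν).support.erase 0, ∏ j ∈ Finset.range (occ ν i),
            f (2 * η * (Λ i - j))
              / (f (lam + 2 * η * n
                    + 2 * η * (2 * numBelow (occ ν) i + occ ν i + j - LamSum Λ (i + 1)))
                * f (lam + 2 * η * n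
                    + 2 * η * (2 * numBelow (occ ν) i + 1 + j - LamSum Λ i)))))) * h1
  · refine Finset.sum_congr rfl fun I hI => ?_
    congr 1
    rw [← reverse_ofFn_castLE_eq_ascList hν hr']
    have h2 : I.image v = Finset.univ.image fun i : I => v i := by
      ext u
      simp
    rw [h2]
    exact (sum_equiv_eq_symSum_rev hf _ N _ (by simpa using (Finset.mem_powersetCard.1 hI).2)
      (fun i j hij => Subtype.ext (hinj hij)) _).symm

end FormulaD

end EllipticBethe

end

open EllipticBethe in
theorem mainTheorem6 (f : ℂ → ℂ)
    (hf : (∃ τ : ℂ, 0 < τ.im ∧ f = theta τ) ∨ f = sinPi)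
    (η lam : ℂ) (z Λ : ℕ → ℂ) :
    -- part (i)
    (∀ (M : ℕ) (μ : Fin M → ℕ), Antitone μ → ∀ u : Fin M → ℂ,
      (∀ i j : ℕ, 1 ≤ j → j ≤ occ μ i → f (2 * η * j) ≠ 0) →
      (∀ k : ℕ, k < M → f (lam + 2 * η * k) ≠ 0) →
      (∀ l k : ℕ, 1 ≤ l → (∃ s, l ≤ μ s) → k + 2 ≤ 2 * M →
        f (lam - 2 * η * LamSum Λ l + 2 * η * k) ≠ 0) →
      (∀ i, ∀ l : ℕ, (∃ s, l ≤ μ s) → f (u i - qPt η z Λ l) ≠ 0) →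
      (∀ i j, i ≠ j → f (u i - u j) ≠ 0) →
      BFun f η z Λ M lam u (occ μ) =
        (-1) ^ M * f (2 * η) ^ M / (∏ i ∈ Finset.range M, f (lam + 2 * η * i))
        * (∏ i ∈ (occ μ).support, ∏ j ∈ Finset.Icc 1 (occ μ i), f (2 * η) / f (2 * η * j))
        * ∑ σ : Equiv.Perm (Fin M),
            (∏ i : Fin M, ∏ j ∈ Finset.Ioi i,
              f (u (σ i) - u (σ j) - 2 * η) / f (u (σ i) - u (σ j)))
            * ∏ i : Fin M, phi f η z Λ (μ i) (u (σ i))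
                * f (lam + u (σ i) - qPt η z Λ (μ i) + 2 * η
                    + 4 * η * ((M : ℂ) - ((i : ℕ) + 1 : ℂ)) - 2 * η * LamSum Λ (μ i))) ∧
    -- part (ii)
    (∀ (N : ℕ) (ν : Fin N → ℕ), Antitone ν → ∀ n : ℕ, 1 ≤ n → ∀ v : Fin n → ℂ,
      f (2 * η) ≠ 0 →
      (∀ k : ℕ, k < n → f (lam + 2 * η * k) ≠ 0) →
      (∀ l k : ℕ, 1 ≤ l → k < n + 2 * N →
        f (lam - 2 * η * LamSum Λ l + 2 * η * k) ≠ 0) →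
      (∀ i, ∀ l : ℕ, f (v i - pPt η z Λ l) ≠ 0 ∧ f (v i - qPt η z Λ l) ≠ 0) →
      (∀ i j, i ≠ j → f (v i - v j) ≠ 0) →
      -- the infinite volume limits that define the one-variable coefficients exist
      (∀ (k : Fin n) (κ ρ : Occ), len κ = N →
        Tendsto (DVol f η z Λ (lam + 2 * η * (k : ℕ)) (v k) κ ρ) atTop
          (𝓝 (DOne f η z Λ (lam + 2 * η * (k : ℕ)) (v k) κ ρ))) ∧
      DFun f η z Λ n lam v (occ ν) =
        f (2 * η) ^ (N - occ ν 0) / (∏ i ∈ Finset.range n, f (lam + 2 * η * i))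
        * (∏ i ∈ Finset.Ico N (n + occ ν 0),
            f (lam + 2 * η * ((i : ℂ) - Λ 0)) / f (lam + 2 * η * ((i : ℂ) + occ ν 0 - Λ 0)))
        * (∏ i ∈ (occ ν).support.erase 0, ∏ j ∈ Finset.range (occ ν i),
            f (2 * η * (Λ i - j))
              / (f (lam + 2 * η * n
                    + 2 * η * (2 * numBelow (occ ν) i + occ ν i + j - LamSum Λ (i + 1)))
                * f (lam + 2 * η * n
                    + 2 * η * (2 * numBelow (occ ν) i + 1 + j - LamSum Λ i))))
        * ∑ I ∈ (Finset.univ : Finset (Fin n)).powersetCard (N - occ ν 0),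
            (∏ i ∈ I, f (lam + v i - qPt η z Λ 0 + 2 * η * N) / f (v i - qPt η z Λ 0))
            * (∏ j ∈ Iᶜ, f (v j - pPt η z Λ 0 - 2 * η * occ ν 0) / f (v j - pPt η z Λ 0))
            * (∏ i ∈ I, ∏ j ∈ Iᶜ, f (v j - v i - 2 * η) / f (v j - v i))
            * ∑ σ : Fin (N - occ ν 0) ≃ I,
                (∏ i : Fin (N - occ ν 0), ∏ j ∈ Finset.Ioi i,
                  f (v (σ i) - v (σ j) + 2 * η) / f (v (σ i) - v (σ j)))
                * ∏ i : Fin (N - occ ν 0),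
                    psi f η z Λ (ν (Fin.castLE (Nat.sub_le N (occ ν 0)) i)) (v (σ i))
                    * f (lam + 2 * η * n - v (σ i)
                        + pPt η z Λ (ν (Fin.castLE (Nat.sub_le N (occ ν 0)) i)) + 2 * η
                        + 4 * η * ((N : ℂ) - ((i : ℕ) + 1 : ℂ))
                        - 2 * η * LamSum Λ (ν (Fin.castLE (Nat.sub_le N (occ ν 0)) i)))) := by
  have hσ : SigmaLike f := by
    rcases hf with ⟨τ, hτ, rfl⟩ | rfl
    · exact theta_sigmaLike hτ
    · exact sinPi_sigmaLike
  refine ⟨fun M μ hμ u hm hlam hL hq hu => BFun_formula hσ hμ u hm hlam hL hq hu,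
    fun N ν hν n _ v ht _ hL hpq hv => ⟨fun k κ ρ hκ => ?_, DFun_formula hσ hν v ht hL hpq hv⟩⟩
  refine tendsto_DOne hσ (fun l => (hpq k l).1) (fun l => (hpq k l).2) (fun l hl => ?_) ρ
  convert hL l (k + 2 * N) hl (by omega) using 2
  rw [hκ]
  push_cast
  ring
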